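/- **Proposition (acoustic reciprocal principle, dual version).** Let $d\ge 1$ and let $w\colon[0,\infty)\to(0,\infty)$ be nondecreasing (a growth bound). For $g\in C^\infty(\mathbb R^d)$ let $\mathbf W g=p$ denote the unique solution, of class $C^2$ on $\mathbb R^d\times[0,\infty)$, of $$p_{tt}-\Delta p=0\ \ (t>0),\qquad p(\cdot,0)=g,\qquad p_t(\cdot,0)=0 .$$ In convolutions in time, $\mathbf W g$ is extended to negative times as an even function of $t$. Write $D:=\frac{1}{2t}\frac{\partial}{\partial t}$ and $k:=\lceil (d-1)/2\rceil$. Let $v\colon\mathbb R\to\mathbb R$ be even with $\tau\mapsto v(\sqrt{\tau})$ in $C^{k}([0,\infty))$ (in particular this holds if $v\circ\sqrt{|\cdot|}\in C^{k}(\mathbb R)$), and suppose that $v$ decays sufficiently with respect to $w$, in the sense that for every $c\ge0$ $$\int_0^\infty (1+t)^d\,w(c+t)\,\bigl(|v(t)|+|D^{k}v(t)|\bigr)\,\mathrm dt<\infty .$$ Define the radial function $\mathbf R^\sharp v\colon\mathbb R^d\to\mathbb R$ by $$(\mathbf R^\sharp v)(x)=\begin{cases}\dfrac{(-1)^{(d-1)/2}}{\sqrt{\pi^{d-1}}}\,\bigl(D^{(d-1)/2}v\bigr)(\|x\|)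 & d\text{ odd},\\[2ex] \dfrac{2\,(-1)^{d/2}}{\sqrt{\pi^{d}}}\displaystyle\int_{\|x\|}^\infty\frac{D^{d/2}v(t)}{\sqrt{t^2-\|x\|^2}}\,t\,\mathrm dt & d\text{ even}.\end{cases}$$ (1) $\mathbf R^\sharp v$ inverts the radial Radon transform: for a radial function $u=\bar u(\|\cdot\|)$ put $\mathbf R u(t)=\bar u(|t|)$ if $d=1$ and $\mathbf R u(t)=\omega_{d-2}\int_{|t|}^\infty \bar u(s)(s^2-t^2)^{(d-3)/2}s\,\mathrm ds$ if $d>1$, where $\omega_{d-2}$ is the surface measure of the unit sphere $\mathbb S^{d-2}\subset\mathbb R^{d-1}$. Then the integrals defining $\mathbf R^\sharp v$ and $\mathbf R\mathbf R^\sharp v$ converge absolutely, and $\mathbf R\mathbf R^\sharp v(t)=v(t)$ for all $t\in\mathbb R$. (2) Let $f\in C^\infty(\mathbb R^d)$ be such that each derivative of $f$ is bounded by a constant multiple of $w(\|x\|)$. (For $f\in C_c^\infty(\mathbb R^d)$ one can take $w=1$; if $v$ has compact support, every $f\in C^\infty(\mathbb R^d)$ is admissible, for a suitable $w$.) Then $(\mathbf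 R^\sharp v)\circledast_x f$ converges absolutely at every point and belongs to $C^\infty(\mathbb R^d)$; the solutions $\mathbf W f$ and $\mathbf W\bigl((\mathbf R^\sharp v)\circledast_x f\bigr)$ exist; and for all $(x,t)\in\mathbb R^d\times(0,\infty)$ the convolution on the left below converges absolutely and $$\bigl(v\circledast_t \mathbf W f\bigr)(x,t)=\mathbf W\bigl((\mathbf R^\sharp v)\circledast_x f\bigr)(x,t).$$ Here $\circledast_x$ is convolution on $\mathbb R^d$ and $\circledast_t$ is one-dimensional convolution in the time variable. -/

import Mathlib

open MeasureTheory Set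
open scoped ContDiff Convolution Laplacian

noncomputable section

namespace AcousticReciprocity

/-- The space `ℝ^d` with its Euclidean norm. -/
abbrev Space (d : ℕ) : Type := EuclideanSpace ℝ (Fin d)

/-- `p` is a classical solution (`C²` up to the initial time) on `ℝ^d × [0, ∞)` of
`p_tt = Δ p`, `p(·, 0) = f`, `p_t(·, 0) = 0`. Only the values `p x t` with `0 ≤ t` matter. -/
structure IsWaveSolution {d : ℕ} (f : Space d → ℝ) (p : Space d → ℝ → ℝ) : Prop where
  contDiffOn : ContDiffOn ℝ 2 (fun z : Space d × ℝ => p z.1 z.2) (univ ×ˢ Ici 0)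
  wave_eq : ∀ (x : Space d) (t : ℝ), 0 < t →
    iteratedDeriv 2 (fun s => p x s) t = (Δ (fun y => p y t)) x
  init : ∀ x : Space d, p x 0 = f x
  init_deriv : ∀ x : Space d, HasDerivWithinAt (fun s => p x s) 0 (Ici 0) 0

open Classical in
/-- The wave operator `f ↦ W f`: the solution of the initial value problem with initial pressure
`f` (the solution is unique on `ℝ^d × [0, ∞)`; the value is `0` if there is none). -/
def waveOp {d : ℕ} (f : Space d → ℝ) : Space d → ℝ → ℝ :=
  if h : ∃ p : Space d → ℝ → ℝ, IsWaveSolution f p then h.choose else 0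

/-- Spatial convolution on `ℝ^d`. -/
def spaceConv {d : ℕ} (u f : Space d → ℝ) : Space d → ℝ :=
  u ⋆[ContinuousLinearMap.mul ℝ ℝ, volume] f

/-- The even extension in time of a function on `ℝ^d × [0, ∞)`, at the point `x`. -/
def evenTime {d : ℕ} (g : Space d → ℝ → ℝ) (x : Space d) : ℝ → ℝ := fun t => g x |t|

/-- Convolution in time of `v : ℝ → ℝ` with the even extension of `g`:
`(x, t) ↦ ∫ v(s) g(x, |t - s|) ds`. -/
def timeConv {d : ℕ} (v : ℝ → ℝ) (g : Space d → ℝ → ℝ) (x : Space d) : ℝ → ℝ :=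
  v ⋆[ContinuousLinearMap.mul ℝ ℝ, volume] evenTime g x

/-- The operator `(1 / (2 t)) ∂_t`. -/
def radialDeriv (v : ℝ → ℝ) : ℝ → ℝ := fun t => 1 / (2 * t) * deriv v t

/-- The radial profile `r ↦ (R♯ v)(x)`, `r = ‖x‖`, in dimension `d`. -/
def sharpProfile (d : ℕ) (v : ℝ → ℝ) (r : ℝ) : ℝ :=
  if Odd d then
    (-1) ^ ((d - 1) / 2) / √(Real.pi ^ (d - 1)) * (radialDeriv^[(d - 1) / 2] v) r
  else
    2 * (-1) ^ (d / 2) / √(Real.pi ^ d) *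
      ∫ t in Ioi r, (radialDeriv^[d / 2] v) t / √(t ^ 2 - r ^ 2) * t

/-- The radial function `R♯ v` on `ℝ^d`. -/
def sharp (d : ℕ) (v : ℝ → ℝ) : Space d → ℝ := fun x => sharpProfile d v ‖x‖

/-- The surface measure of the unit sphere `S^(d-2)` in `ℝ^(d-1)` (for `d ≥ 2`). -/
def sphereVolume (d : ℕ) : ℝ :=
  (volume : Measure (Space (d - 1))).toSphere.real univ

/-- The integrand `s ↦ ū(s) (s² - t²)^((d-3)/2) s` of the Radon transform of `ū(‖·‖)`. -/
def radonIntegrand (d : ℕ) (u : ℝ → ℝ) (t s : ℝ) : ℝ :=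
  u s * (s ^ 2 - t ^ 2) ^ (((d : ℝ) - 3) / 2) * s

/-- The Radon transform on `ℝ^d` of the radial function with profile `u : [0, ∞) → ℝ`. -/
def radialRadon (d : ℕ) (u : ℝ → ℝ) (t : ℝ) : ℝ :=
  if d = 1 then u |t| else sphereVolume d * ∫ s in Ioi |t|, radonIntegrand d u t s

/-- Smooth functions on `ℝ^d` all of whose derivatives grow at most like `w(‖x‖)`. -/
structure SmoothOfGrowth {d : ℕ} (w : ℝ → ℝ) (f : Space d → ℝ) : Prop where
  smooth : ContDiff ℝ ∞ f
  growth : ∀ n : ℕ, ∃ C : ℝ, ∀ x : Space d, ‖iteratedFDeriv ℝ n f x‖ ≤ C * w ‖x‖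

/-- Sufficient decay of a time filter `v`, relative to the growth `w`: the functions `v` and
`((1 / (2 t)) ∂_t)^k v`, with `k = ⌊d / 2⌋ = ⌈(d - 1) / 2⌉`, are integrable on `(0, ∞)` against
`(1 + t)^d w(c + t)` for every `c ≥ 0`. -/
def SufficientDecay (d : ℕ) (w : ℝ → ℝ) (v : ℝ → ℝ) : Prop :=
  ∀ c : ℝ, 0 ≤ c →
    IntegrableOn (fun t => (1 + t) ^ d * w (c + t) * v t) (Ioi 0) ∧
    IntegrableOn (fun t => (1 + t) ^ d * w (c + t) * (radialDeriv^[d / 2] v) t) (Ioi 0)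

end AcousticReciprocity

end

/-!
For compactly supported `g` the solution `W g` is a superposition of plane waves,
`W g (x, t) = Re ∫ cos(2π t ‖ξ‖) e^{2πi⟪ξ, x⟫} ĝ(ξ) dξ`. Integrating it against the even filter `v`
multiplies `ĝ` by the one-dimensional Fourier transform of `v` at the frequency `‖ξ‖`. By the
Fourier slice theorem (`fourier_radial`) that is the Fourier transform at `ξ` of any integrable
radial function whose hyperplane integrals are `v`, and `R♯ v` is such a function
(`planeIntegral_sharpProfile`). This gives the identity at time `0`
(`integral_mul_fourierWave`). The time convolution `q = v ⊛ W f` is a superposition of time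
translates of a solution that is even in time, hence again an even solution of the wave equation
(`SmoothOfGrowth.isWaveSolution_timeConv`). Its initial value is `R♯ v ⊛ f`, so it is the solution
with these data, by uniqueness.

Uniqueness, in the local form of a domain of dependence (`IsWaveSolution.eq_of_eqOn_ball`), comes
from the energy of `(p_t, ∇p)` weighted by a smooth function supported in the backward light cone
(`eq_zero_of_symmetric_system`). The local form also yields the solution for arbitrary smooth `f`
by gluing the plane-wave solutions of truncations of `f` (`smoothWave`), with derivatives bounded by
`(1 + |t|)^d w(‖x‖ + |t| + 3)` (`norm_iteratedFDeriv_smoothWave_le`). Under the decay assumption on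
`v` this bound dominates the integrals in the passage from truncations to `f` and in the
differentiation of `q` under the integral sign.

The inversion of the Radon transform is an induction on codimension. For `r ≥ 0`, integrating the
profile `U` over a two-dimensional plane at distance `r` gives `2π ∫_r^∞ U(s) s ds`, which undoes
`-(1/π) (1/(2t)) ∂_t` by the fundamental theorem of calculus (`planeIntegral_two_oddProfile`); the
boundary term at infinity vanishes because otherwise the repeated primitives, the last of which is
`v`, would stay away from `0`. In even dimension `d` the function `R♯ v` is the integral over lines
of its analogue in dimension `d + 1` (`sharpProfile_even`).
-/

noncomputable section

namespace AcousticReciprocity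

open Filter Topology

/-! ### Superposition of translates -/

section Superposition

variable {α E : Type*} [MeasurableSpace α] [NormedAddCommGroup E] [NormedSpace ℝ E]

theorem aestronglyMeasurable_translate {μ : Measure α} {n : ℕ∞} {c : α → ℝ} {j : α → E}
    {f : E → ℝ} (hf : ContDiff ℝ n f) (hc : AEStronglyMeasurable c μ)
    (hj : AEStronglyMeasurable j μ) {k : ℕ} (hk : (k : ℕ∞) ≤ n) (z : E) :
    AEStronglyMeasurable (fun a => c a • iteratedFDeriv ℝ k f (z - j a)) μ :=
  hc.smul ((hf.continuous_iteratedFDeriv (mod_cast hk)).comp_aestronglyMeasurable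
    (aestronglyMeasurable_const.sub hj))

theorem integrable_translate {μ : Measure α} {n : ℕ∞} {c : α → ℝ} {j : α → E}
    {f : E → ℝ} (hf : ContDiff ℝ n f) (hc : AEStronglyMeasurable c μ)
    (hj : AEStronglyMeasurable j μ)
    (hdom : ∀ k : ℕ, (k : ℕ∞) ≤ n → ∀ z₀ : E, ∃ b : α → ℝ, Integrable b μ ∧
      ∀ a, ∀ z ∈ Metric.ball z₀ 1, ‖c a‖ * ‖iteratedFDeriv ℝ k f (z - j a)‖ ≤ b a)
    {k : ℕ} (hk : (k : ℕ∞) ≤ n) (z : E) :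
    Integrable (fun a => c a • iteratedFDeriv ℝ k f (z - j a)) μ := by
  obtain ⟨b, hb, hbd⟩ := hdom k hk z
  refine hb.mono' (aestronglyMeasurable_translate hf hc hj hk z) (ae_of_all _ fun a => ?_)
  rw [norm_smul]
  exact hbd a z (Metric.mem_ball_self one_pos)

/-- A superposition of translates of a `C^n` function, with locally dominated derivatives, is `C^n`
and may be differentiated under the integral sign. -/
theorem hasFTaylorSeriesUpTo_integral_translate {μ : Measure α} {n : ℕ∞} {c : α → ℝ} {j : α → E}
    {f : E → ℝ} (hf : ContDiff ℝ n f) (hc : AEStronglyMeasurable c μ)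
    (hj : AEStronglyMeasurable j μ)
    (hdom : ∀ k : ℕ, (k : ℕ∞) ≤ n → ∀ z₀ : E, ∃ b : α → ℝ, Integrable b μ ∧
      ∀ a, ∀ z ∈ Metric.ball z₀ 1, ‖c a‖ * ‖iteratedFDeriv ℝ k f (z - j a)‖ ≤ b a) :
    HasFTaylorSeriesUpTo n (fun z => ∫ a, c a * f (z - j a) ∂μ)
      (fun z k => ∫ a, c a • iteratedFDeriv ℝ k f (z - j a) ∂μ) := by
  have hmeas : ∀ k : ℕ, (k : ℕ∞) ≤ n → ∀ z : E,
      AEStronglyMeasurable (fun a => c a • iteratedFDeriv ℝ k f (z - j a)) μ := fun k hk z =>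
    aestronglyMeasurable_translate hf hc hj hk z
  have hint : ∀ k : ℕ, (k : ℕ∞) ≤ n → ∀ z : E,
      Integrable (fun a => c a • iteratedFDeriv ℝ k f (z - j a)) μ := fun k hk z =>
    integrable_translate hf hc hj hdom hk z
  have hderiv : ∀ k : ℕ, (k : ℕ∞) < n → ∀ z : E,
      HasFDerivAt (fun z => ∫ a, c a • iteratedFDeriv ℝ k f (z - j a) ∂μ)
        (∫ a, c a • iteratedFDeriv ℝ (k + 1) f (z - j a) ∂μ).curryLeft z := by
    intro k hk z
    have hk1 : ((k + 1 : ℕ) : ℕ∞) ≤ n := by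
      simpa using Order.add_one_le_of_lt hk
    obtain ⟨b, hb, hbd⟩ := hdom (k + 1) hk1 z
    let Φ := (continuousMultilinearCurryLeftEquiv ℝ (fun _ : Fin (k + 1) => E) ℝ)
    have hΦ : ∀ M : ContinuousMultilinearMap ℝ (fun _ : Fin (k + 1) => E) ℝ,
        M.curryLeft = Φ M := fun M => rfl
    have hcomm : (∫ a, c a • iteratedFDeriv ℝ (k + 1) f (z - j a) ∂μ).curryLeft
        = ∫ a, Φ (c a • iteratedFDeriv ℝ (k + 1) f (z - j a)) ∂μ := by
      rw [hΦ]
      let Ψ : ContinuousMultilinearMap ℝ (fun _ : Fin (k + 1) => E) ℝ →L[ℝ]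
          (E →L[ℝ] ContinuousMultilinearMap ℝ (fun _ : Fin k => E) ℝ) :=
        ⟨Φ.toLinearEquiv.toLinearMap, Φ.continuous⟩
      exact (ContinuousLinearMap.integral_comp_comm (𝕜 := ℝ)
        (E := ContinuousMultilinearMap ℝ (fun _ : Fin (k + 1) => E) ℝ)
        (Fₗ := E →L[ℝ] ContinuousMultilinearMap ℝ (fun _ : Fin k => E) ℝ)
        Ψ (hint (k + 1) hk1 z)).symm
    rw [hcomm]
    refine hasFDerivAt_integral_of_dominated_of_fderiv_le (bound := b)
      (F' := fun z a => Φ (c a • iteratedFDeriv ℝ (k + 1) f (z - j a)))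
      (Metric.ball_mem_nhds z one_pos)
      (Eventually.of_forall fun z' => hmeas k hk.le z') (hint k hk.le z)
      (Φ.continuous.comp_aestronglyMeasurable (hmeas (k + 1) hk1 z)) ?_ hb ?_
    · refine ae_of_all _ fun a z' hz' => ?_
      rw [LinearIsometryEquiv.norm_map, norm_smul]
      exact hbd a z' hz'
    · refine ae_of_all _ fun a z' _ => ?_
      have h1 : HasFDerivAt (iteratedFDeriv ℝ k f) (iteratedFDeriv ℝ (k + 1) f (z' - j a)).curryLeft
          (z' - j a) :=
        hf.ftaylorSeries.fderiv k (mod_cast hk) (z' - j a)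
      have h2 := (h1.comp z' ((hasFDerivAt_id z').sub_const (j a))).const_smul (c a)
      have h3 : Φ (c a • iteratedFDeriv ℝ (k + 1) f (z' - j a))
          = c a • (iteratedFDeriv ℝ (k + 1) f (z' - j a)).curryLeft := by
        rw [map_smul]; rfl
      rw [h3]
      simp only [id_eq, ContinuousLinearMap.comp_id] at h2
      exact h2
  refine ⟨fun z => ?_, fun k hk z => hderiv k (mod_cast hk) z, fun k hk => ?_⟩
  · have := (ContinuousMultilinearMap.apply ℝ (fun _ : Fin 0 => E) ℝ 0).integral_comp_comm
      (hint 0 bot_le z)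
    simp only [ContinuousMultilinearMap.curry0]
    simp at this
    simpa [Subsingleton.elim (fun i : Fin 0 => (0 : E)) 0] using this.symm
  · refine continuous_iff_continuousAt.2 fun z => ?_
    obtain ⟨b, hb, hbd⟩ := hdom k (mod_cast hk) z
    refine continuousAt_of_dominated (bound := b)
      (Eventually.of_forall fun z' => hmeas k (mod_cast hk) z') ?_ hb
      (ae_of_all _ fun a => ?_)
    · filter_upwards [Metric.ball_mem_nhds z one_pos] with z' hz'
      refine ae_of_all _ fun a => ?_
      rw [norm_smul]
      exact hbd a z' hz'
    · have := hf.continuous_iteratedFDeriv (m := k) (mod_cast hk)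
      exact (Continuous.const_smul (this.comp (by fun_prop : Continuous fun z => z - j a))
        (c a)).continuousAt

end Superposition

/-! ### Energy estimate in the backward light cone -/

section Energy

variable {d : ℕ}

/-- The Lorentzian square of the displacement from `(x₀, T)`; it is positive exactly inside the
double light cone with this apex. -/
def coneFun (x₀ : Space d) (T : ℝ) (z : Space d × ℝ) : ℝ := (T - z.2) ^ 2 - ‖z.1 - x₀‖ ^ 2

/-- A smooth weight, positive exactly inside the double light cone with apex `(x₀, T)`. -/
def coneWeight (x₀ : Space d) (T : ℝ) (z : Space d × ℝ) : ℝ := expNegInvGlue (coneFun x₀ T z)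

theorem contDiff_coneFun (x₀ : Space d) (T : ℝ) : ContDiff ℝ 1 (coneFun x₀ T) :=
  ((contDiff_const.sub contDiff_snd).pow 2).sub ((contDiff_fst.sub contDiff_const).norm_sq ℝ)

theorem contDiff_coneWeight (x₀ : Space d) (T : ℝ) : ContDiff ℝ 1 (coneWeight x₀ T) :=
  (expNegInvGlue.contDiff (n := 1)).comp (contDiff_coneFun x₀ T)

theorem coneWeight_eq_zero {x₀ : Space d} {T : ℝ} {z : Space d × ℝ} (h0 : 0 ≤ z.2) (hT : z.2 ≤ T)
    (hz : z.1 ∉ Metric.ball x₀ T) : coneWeight x₀ T z = 0 := by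
  refine expNegInvGlue.zero_of_nonpos ?_
  rw [Metric.mem_ball, not_lt, dist_eq_norm] at hz
  unfold coneFun
  nlinarith

theorem coneFun_neg {x₀ : Space d} {T : ℝ} {z : Space d × ℝ} (h0 : 0 ≤ z.2) (hT : z.2 ≤ T)
    (hz : z.1 ∉ Metric.closedBall x₀ T) : coneFun x₀ T z < 0 := by
  rw [Metric.mem_closedBall, not_le, dist_eq_norm] at hz
  unfold coneFun
  nlinarith

theorem deriv_expNegInvGlue_nonneg (s : ℝ) : 0 ≤ deriv expNegInvGlue s :=
  expNegInvGlue.monotone.deriv_nonneg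

theorem deriv_expNegInvGlue_of_neg {s : ℝ} (hs : s < 0) : deriv expNegInvGlue s = 0 := by
  have : expNegInvGlue =ᶠ[𝓝 s] fun _ => 0 := by
    filter_upwards [Iio_mem_nhds hs] with u hu
    exact expNegInvGlue.zero_of_nonpos (le_of_lt hu)
  rw [this.deriv_eq, deriv_const]

theorem continuous_deriv_expNegInvGlue : Continuous (deriv expNegInvGlue) :=
  (expNegInvGlue.contDiff (n := 1)).continuous_deriv le_rfl

theorem fderiv_coneWeight_time (x₀ : Space d) (T : ℝ) (z : Space d × ℝ) :
    fderiv ℝ (coneWeight x₀ T) z (0, 1)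
      = deriv expNegInvGlue (coneFun x₀ T z) * (-(2 * (T - z.2))) := by
  have hg := ((expNegInvGlue.contDiff (n := 1)).differentiable one_ne_zero
    (coneFun x₀ T z)).hasDerivAt
  have hf : HasDerivAt (fun s : ℝ => coneFun x₀ T (z.1, s)) (-(2 * (T - z.2))) z.2 := by
    have := (((hasDerivAt_id z.2).const_sub T).pow 2).sub_const (‖z.1 - x₀‖ ^ 2)
    simp only [id, Nat.cast_ofNat, Nat.add_one_sub_one, pow_one, mul_neg, mul_one] at this
    exact this
  have h1 := hg.comp z.2 hf
  have h2 : HasDerivAt (fun s : ℝ => coneWeight x₀ T (z.1, s))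
      (fderiv ℝ (coneWeight x₀ T) z (0, 1)) z.2 :=
    HasFDerivAt.comp_hasDerivAt (l := coneWeight x₀ T) z.2
      (((contDiff_coneWeight x₀ T).differentiable one_ne_zero z).hasFDerivAt)
      ((hasDerivAt_const z.2 z.1).prodMk (hasDerivAt_id z.2))
  exact h2.unique h1

theorem fderiv_coneWeight_space (x₀ : Space d) (T : ℝ) (z : Space d × ℝ) (i : Fin d) :
    fderiv ℝ (coneWeight x₀ T) z (EuclideanSpace.single i 1, 0)
      = deriv expNegInvGlue (coneFun x₀ T z) * (-(2 * (z.1 - x₀) i)) := by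
  have hg := ((expNegInvGlue.contDiff (n := 1)).differentiable one_ne_zero
    (coneFun x₀ T z)).hasDerivAt
  set e : Space d := EuclideanSpace.single i 1
  have hl : HasDerivAt (fun s : ℝ => z.1 + s • e) e 0 := by
    simpa using ((hasDerivAt_id (0 : ℝ)).smul_const e).const_add z.1
  have hf : HasDerivAt (fun s : ℝ => coneFun x₀ T (z.1 + s • e, z.2)) (-(2 * (z.1 - x₀) i)) 0 := by
    have := ((hl.sub_const x₀).norm_sq).const_sub ((T - z.2) ^ 2)
    refine this.congr_deriv ?_
    simp [e, EuclideanSpace.inner_single_right]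
  have hg' : HasDerivAt expNegInvGlue (deriv expNegInvGlue (coneFun x₀ T z))
      (coneFun x₀ T (z.1 + (0 : ℝ) • e, z.2)) := by simpa using hg
  have h1 := hg'.comp (0 : ℝ) hf
  have hz : HasFDerivAt (coneWeight x₀ T) (fderiv ℝ (coneWeight x₀ T) z)
      (z.1 + (0 : ℝ) • e, z.2) := by
    simpa using ((contDiff_coneWeight x₀ T).differentiable one_ne_zero z).hasFDerivAt
  have h2 : HasDerivAt (fun s : ℝ => coneWeight x₀ T (z.1 + s • e, z.2))
      (fderiv ℝ (coneWeight x₀ T) z (e, 0)) 0 :=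
    HasFDerivAt.comp_hasDerivAt (l := coneWeight x₀ T) (0 : ℝ) hz
      (hl.prodMk (hasDerivAt_const (0 : ℝ) z.2))
  exact h2.unique h1

/-- The pointwise inequality behind the decay of the energy: the flux through the cone does not
exceed the loss caused by the shrinking of the cone. -/
theorem energy_flux_le {r α : ℝ} (hr : 0 < r) (X β : Fin d → ℝ) (hX : ∑ i, X i ^ 2 ≤ r ^ 2) :
    2 * α * ∑ i, X i * β i ≤ r * (α ^ 2 + ∑ i, β i ^ 2) := by
  have hcs := Finset.sum_mul_sq_le_sq_mul_sq Finset.univ X β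
  have hB : 0 ≤ ∑ i, β i ^ 2 := Finset.sum_nonneg fun i _ => sq_nonneg _
  set s := ∑ i, X i * β i
  set B := ∑ i, β i ^ 2
  have h1 : s ^ 2 ≤ r ^ 2 * B := hcs.trans (mul_le_mul_of_nonneg_right hX hB)
  have h2 : r * (2 * α * s) ≤ r * (r * (α ^ 2 + B)) := by nlinarith [sq_nonneg (r * α - s)]
  exact le_of_mul_le_mul_left h2 hr

theorem integrable_of_continuous_of_eq_zero {g : Space d → ℝ} {x₀ : Space d} {T : ℝ}
    (hg : Continuous g) (h0 : ∀ x ∉ Metric.closedBall x₀ T, g x = 0) : Integrable g :=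
  hg.integrable_of_hasCompactSupport
    (HasCompactSupport.intro (isCompact_closedBall x₀ T) fun x hx => h0 x hx)

/-- Integration by parts in the direction `e` against a compactly supported weight. -/
theorem integral_weight_mul_deriv_mul {W α β : Space d → ℝ} {W' α' β' : Space d → Space d →L[ℝ] ℝ}
    {e : Space d} (hW : HasCompactSupport W) (hW' : ∀ x, HasFDerivAt W (W' x) x)
    (hα' : ∀ x, HasFDerivAt α (α' x) x) (hβ' : ∀ x, HasFDerivAt β (β' x) x)
    (hWc : Continuous fun x => W' x e) (hαc : Continuous fun x => α' x e)
    (hβc : Continuous fun x => β' x e) :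
    ∫ x, W x * (α x * β' x e + β x * α' x e) = -∫ x, W' x e * (α x * β x) := by
  have hWcont : Continuous W := continuous_iff_continuousAt.2 fun x => (hW' x).continuousAt
  have hαcont : Continuous α := continuous_iff_continuousAt.2 fun x => (hα' x).continuousAt
  have hβcont : Continuous β := continuous_iff_continuousAt.2 fun x => (hβ' x).continuousAt
  have hprod : ∀ x, HasFDerivAt (fun y => α y * β y) (α x • β' x + β x • α' x) x := fun x =>
    (hα' x).mul (hβ' x)
  have hWe : (fun x => W' x e) = fun x => fderiv ℝ W x e := by
    funext x; rw [(hW' x).fderiv]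
  have hWe' : HasCompactSupport fun x => W' x e := hWe ▸ hW.fderiv_apply ℝ e
  have hpe : ∀ x, fderiv ℝ (fun y => α y * β y) x e = α x * β' x e + β x * α' x e := fun x => by
    rw [(hprod x).fderiv]; rfl
  have i1 : Integrable fun x => W' x e * (α x * β x) :=
    (hWc.mul (hαcont.mul hβcont)).integrable_of_hasCompactSupport hWe'.mul_right
  have i2 : Integrable fun x => W x * (α x * β' x e + β x * α' x e) :=
    (hWcont.mul ((hαcont.mul hβc).add (hβcont.mul hαc))).integrable_of_hasCompactSupport
      hW.mul_right
  have i3 : Integrable fun x => W x * (α x * β x) :=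
    (hWcont.mul (hαcont.mul hβcont)).integrable_of_hasCompactSupport hW.mul_right
  have := integral_mul_fderiv_eq_neg_fderiv_mul_of_integrable (μ := volume) (v := e)
    (f := W) (g := fun y => α y * β y) (by simpa only [congrFun hWe] using i1)
    (by simpa only [hpe] using i2) i3 (fun x _ => (hW' x).differentiableAt)
    (fun x _ => (hprod x).differentiableAt)
  simp only [hpe] at this
  rw [this]
  simp only [congrFun hWe]

set_option maxHeartbeats 1000000 in
/-- Energy estimate in the backward light cone for the symmetric hyperbolic system satisfied by
`a = p_t` and `b = ∇ p`, where `p` solves the wave equation. -/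
theorem eq_zero_of_symmetric_system (x₀ : Space d) (T : ℝ) {a : Space d × ℝ → ℝ}
    {b : Fin d → Space d × ℝ → ℝ}
    (ha : ContinuousOn a (univ ×ˢ Ici 0)) (hb : ∀ i, ContinuousOn (b i) (univ ×ˢ Ici 0))
    (ha1 : ContDiffOn ℝ 1 a (univ ×ˢ Ioi 0)) (hb1 : ∀ i, ContDiffOn ℝ 1 (b i) (univ ×ˢ Ioi 0))
    (hab : ∀ z : Space d × ℝ, 0 < z.2 →
      fderiv ℝ a z (0, 1) = ∑ i, fderiv ℝ (b i) z (EuclideanSpace.single i 1, 0))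
    (hba : ∀ z : Space d × ℝ, 0 < z.2 → ∀ i,
      fderiv ℝ (b i) z (0, 1) = fderiv ℝ a z (EuclideanSpace.single i 1, 0))
    (ha0 : ∀ x ∈ Metric.ball x₀ T, a (x, 0) = 0)
    (hb0 : ∀ x ∈ Metric.ball x₀ T, ∀ i, b i (x, 0) = 0)
    {t : ℝ} (ht : 0 < t) (htT : t < T) : a (x₀, t) = 0 := by
  have hT : 0 < T := ht.trans htT
  have hopen : IsOpen ((univ : Set (Space d)) ×ˢ Ioi (0 : ℝ)) := isOpen_univ.prod isOpen_Ioi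
  have hda : ∀ z : Space d × ℝ, 0 < z.2 → DifferentiableAt ℝ a z := fun z hz =>
    (ha1.contDiffAt (hopen.mem_nhds ⟨mem_univ _, hz⟩)).differentiableAt one_ne_zero
  have hdb : ∀ i, ∀ z : Space d × ℝ, 0 < z.2 → DifferentiableAt ℝ (b i) z := fun i z hz =>
    ((hb1 i).contDiffAt (hopen.mem_nhds ⟨mem_univ _, hz⟩)).differentiableAt one_ne_zero
  have hfa : ∀ v, ContinuousOn (fun z => fderiv ℝ a z v) (univ ×ˢ Ioi 0) := fun v =>
    (ha1.continuousOn_fderiv_of_isOpen hopen le_rfl).clm_apply continuousOn_const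
  have hfb : ∀ i v, ContinuousOn (fun z => fderiv ℝ (b i) z v) (univ ×ˢ Ioi 0) := fun i v =>
    ((hb1 i).continuousOn_fderiv_of_isOpen hopen le_rfl).clm_apply continuousOn_const
  set W := coneWeight x₀ T with hW
  set φ' : Space d × ℝ → ℝ := fun z => deriv expNegInvGlue (coneFun x₀ T z) with hφ'
  have hWc : Continuous W := (contDiff_coneWeight x₀ T).continuous
  have hφc : Continuous φ' :=
    continuous_deriv_expNegInvGlue.comp (contDiff_coneFun x₀ T).continuous
  set en : Space d × ℝ → ℝ := fun z => (a z ^ 2 + ∑ i, b i z ^ 2) / 2 with hen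
  have henc : ContinuousOn en (univ ×ˢ Ici 0) :=
    ((ha.pow 2).add (continuousOn_finsetSum _ fun i _ => (hb i).pow 2)).div_const 2
  -- time derivative of the energy density
  set F' : Space d × ℝ → ℝ := fun z => φ' z * (-(2 * (T - z.2))) * en z + W z *
    (a z * fderiv ℝ a z (0, 1) + ∑ i, b i z * fderiv ℝ (b i) z (0, 1)) with hF'
  have hsub : (univ : Set (Space d)) ×ˢ Ioi (0 : ℝ) ⊆ univ ×ˢ Ici 0 :=
    prod_mono_right Ioi_subset_Ici_self
  have hF'c : ContinuousOn F' (univ ×ˢ Ioi 0) := by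
    refine ContinuousOn.add (ContinuousOn.mul ?_ (henc.mono hsub))
      (hWc.continuousOn.mul (((ha.mono hsub).mul (hfa _)).add
        (continuousOn_finsetSum _ fun i _ => ((hb i).mono hsub).mul (hfb i _))))
    exact (hφc.mul (by fun_prop)).continuousOn
  have hF : ∀ z : Space d × ℝ, 0 < z.2 →
      HasDerivAt (fun s => W (z.1, s) * en (z.1, s)) (F' z) z.2 := by
    intro z hz
    have hl : HasDerivAt (fun s : ℝ => (z.1, s)) ((0 : Space d), (1 : ℝ)) z.2 :=
      (hasDerivAt_const z.2 z.1).prodMk (hasDerivAt_id z.2)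
    have h1 :=
      (((contDiff_coneWeight x₀ T).differentiable one_ne_zero z).hasFDerivAt).comp_hasDerivAt z.2 hl
    rw [fderiv_coneWeight_time] at h1
    have h2 := ((hda z hz).hasFDerivAt.comp_hasDerivAt z.2 hl).pow 2
    have h3 := HasDerivAt.fun_sum (u := Finset.univ) fun i _ =>
      ((hdb i z hz).hasFDerivAt.comp_hasDerivAt z.2 hl).pow 2
    have h4 := h1.mul ((h2.add h3).div_const 2)
    refine h4.congr_deriv ?_
    simp only [hF', hen, hφ', hW, Function.comp, Pi.pow_apply, Pi.add_apply]
    congr 2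
    rw [show ∀ p q : ℝ, (p + q) / 2 = p / 2 + q / 2 from fun p q => by ring, Finset.sum_div]
    congr 1
    · push_cast; ring
    · refine Finset.sum_congr rfl fun i _ => ?_
      push_cast; ring
  have hF'0 : ∀ z : Space d × ℝ, 0 ≤ z.2 → z.2 ≤ T → z.1 ∉ Metric.closedBall x₀ T → F' z = 0 := by
    intro z h0 h1 hz
    have hneg := coneFun_neg h0 h1 hz
    have e1 : φ' z = 0 := deriv_expNegInvGlue_of_neg hneg
    have e2 : W z = 0 := expNegInvGlue.zero_of_nonpos hneg.le
    simp [hF', e1, e2]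
  have hW0 : ∀ z : Space d × ℝ, 0 ≤ z.2 → z.2 ≤ T → z.1 ∉ Metric.closedBall x₀ T → W z = 0 :=
    fun z h0 h1 hz => expNegInvGlue.zero_of_nonpos (coneFun_neg h0 h1 hz).le
  have hslice : ∀ s : ℝ, 0 ≤ s → ∀ g : Space d × ℝ → ℝ, ContinuousOn g (univ ×ˢ Ici 0) →
      Continuous fun x => g (x, s) := fun s hs g hg =>
    hg.comp_continuous (by fun_prop) fun x => ⟨mem_univ _, hs⟩
  have hslice' : ∀ s : ℝ, 0 < s → ∀ g : Space d × ℝ → ℝ, ContinuousOn g (univ ×ˢ Ioi 0) →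
      Continuous fun x => g (x, s) := fun s hs g hg =>
    hg.comp_continuous (by fun_prop) fun x => ⟨mem_univ _, hs⟩
  set En : ℝ → ℝ := fun s => ∫ x, W (x, s) * en (x, s) with hEn
  have hEint : ∀ s, 0 ≤ s → s ≤ T → Integrable fun x => W (x, s) * en (x, s) := fun s h0 h1 =>
    integrable_of_continuous_of_eq_zero (x₀ := x₀) (T := T)
      (hslice s h0 _ (hWc.continuousOn.mul henc)) fun x hx => by rw [hW0 (x, s) h0 h1 hx, zero_mul]
  have hEnderiv : ∀ s, 0 < s → s < T → HasDerivAt En (∫ x, F' (x, s)) s := by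
    intro s hs hsT
    obtain ⟨M, hM⟩ := ((isCompact_closedBall x₀ T).prod
      (isCompact_Icc (a := s / 2) (b := (s + T) / 2))).exists_bound_of_continuousOn
      (hF'c.mono (prod_mono (subset_univ _) fun u hu => lt_of_lt_of_le (half_pos hs) hu.1))
    have hnhds : Icc (s / 2) ((s + T) / 2) ∈ 𝓝 s := Icc_mem_nhds (by linarith) (by linarith)
    refine (hasDerivAt_integral_of_dominated_loc_of_deriv_le
      (bound := (Metric.closedBall x₀ T).indicator fun _ => M) hnhds ?_ (hEint s hs.le hsT.le)
      (F' := fun u x => F' (x, u)) ?_ ?_ ?_ ?_).2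
    · filter_upwards [Ioo_mem_nhds hs hsT] with u hu
      exact (hEint u hu.1.le hu.2.le).aestronglyMeasurable
    · exact (hslice' s hs _ hF'c).aestronglyMeasurable
    · refine ae_of_all _ fun x u hu => ?_
      by_cases hx : x ∈ Metric.closedBall x₀ T
      · rw [indicator_of_mem hx]
        exact hM (x, u) ⟨hx, hu⟩
      · rw [indicator_of_notMem hx, hF'0 (x, u) _ _ hx, norm_zero]
        · exact (half_pos hs).le.trans hu.1
        · exact hu.2.trans (by linarith)
    · exact (integrable_indicator_iff measurableSet_closedBall).2
        (integrableOn_const (isCompact_closedBall x₀ T).measure_lt_top.ne)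
    · exact ae_of_all _ fun x u hu => hF (x, u) (lt_of_lt_of_le (half_pos hs) hu.1)
  -- integrating by parts, the derivative of the energy is the flux through the cone
  have hparts : ∀ s, 0 < s → s < T → ∀ i,
      ∫ x, W (x, s) * (a (x, s) * fderiv ℝ (b i) (x, s) (EuclideanSpace.single i 1, 0)
        + b i (x, s) * fderiv ℝ a (x, s) (EuclideanSpace.single i 1, 0))
      = ∫ x, φ' (x, s) * (2 * (x - x₀) i) * a (x, s) * b i (x, s) := by
    intro s hs hsT i
    have hin : ∀ x, HasFDerivAt (fun y : Space d => (y, s))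
        (ContinuousLinearMap.inl ℝ (Space d) ℝ) x := fun x => hasFDerivAt_prodMk_left x s
    have hWd : ∀ x, HasFDerivAt (fun y => W (y, s))
        ((fderiv ℝ W (x, s)).comp (ContinuousLinearMap.inl ℝ (Space d) ℝ)) x := fun x =>
      HasFDerivAt.comp (g := W) x
        ((contDiff_coneWeight x₀ T).differentiable one_ne_zero (x, s)).hasFDerivAt (hin x)
    have hWe : ∀ x, fderiv ℝ W (x, s) (EuclideanSpace.single i 1, 0)
        = -(φ' (x, s) * (2 * (x - x₀) i)) := fun x => by
      rw [hW, fderiv_coneWeight_space, mul_neg]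
    have key := integral_weight_mul_deriv_mul (e := EuclideanSpace.single i 1)
      (HasCompactSupport.intro (isCompact_closedBall x₀ T) fun x hx => hW0 (x, s) hs.le hsT.le hx)
      (W' := fun x => (fderiv ℝ W (x, s)).comp (ContinuousLinearMap.inl ℝ (Space d) ℝ))
      (α' := fun x => (fderiv ℝ a (x, s)).comp (ContinuousLinearMap.inl ℝ (Space d) ℝ))
      (β' := fun x => (fderiv ℝ (b i) (x, s)).comp (ContinuousLinearMap.inl ℝ (Space d) ℝ))
      hWd (fun x => (hda (x, s) hs).hasFDerivAt.comp x (hin x))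
      (fun x => (hdb i (x, s) hs).hasFDerivAt.comp x (hin x))
      (by
        refine Continuous.congr (f := fun x => -(φ' (x, s) * (2 * (x - x₀) i))) ?_ fun x =>
          (hWe x).symm
        exact ((hslice s hs.le _ hφc.continuousOn).mul (by fun_prop)).neg)
      (hslice' s hs _ (hfa _)) (hslice' s hs _ (hfb i _))
    refine key.trans ?_
    rw [← integral_neg]
    refine integral_congr_ae (ae_of_all _ fun x => ?_)
    simp only [ContinuousLinearMap.comp_apply, ContinuousLinearMap.inl_apply, hWe,
        Function.comp_apply]
    ring
  have hEn' : ∀ s, 0 < s → s < T → ∫ x, F' (x, s) ≤ 0 := by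
    intro s hs hsT
    have hz : ∀ x ∉ Metric.closedBall x₀ T, W (x, s) = 0 ∧ φ' (x, s) = 0 := fun x hx =>
      ⟨hW0 (x, s) hs.le hsT.le hx, deriv_expNegInvGlue_of_neg (coneFun_neg hs.le hsT.le hx)⟩
    have hac := hslice s hs.le _ ha
    have hbc := fun i => hslice s hs.le _ (hb i)
    have hWs := hslice s hs.le _ hWc.continuousOn
    have hφs := hslice s hs.le _ hφc.continuousOn
    have hens := hslice s hs.le _ henc
    have hfas := fun i : Fin d => hslice' s hs _ (hfa (EuclideanSpace.single i 1, 0))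
    have hfbs := fun i : Fin d => hslice' s hs _ (hfb i (EuclideanSpace.single i 1, 0))
    have hxc : ∀ i, Continuous fun x : Space d => (x - x₀) i := fun i => by fun_prop
    have j1 : Integrable fun x => φ' (x, s) * (-(2 * (T - s))) * en (x, s) :=
      integrable_of_continuous_of_eq_zero (x₀ := x₀) (T := T)
        ((hφs.mul continuous_const).mul hens) fun x hx => by simp [hz x hx]
    have j2 : ∀ i, Integrable fun x =>
        W (x, s) * (a (x, s) * fderiv ℝ (b i) (x, s) (EuclideanSpace.single i 1, 0)
        + b i (x, s) * fderiv ℝ a (x, s) (EuclideanSpace.single i 1, 0)) := fun i =>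
      integrable_of_continuous_of_eq_zero (x₀ := x₀) (T := T)
        (hWs.mul ((hac.mul (hfbs i)).add ((hbc i).mul (hfas i)))) fun x hx => by
        simp [hz x hx]
    have j3 : ∀ i, Integrable fun x => φ' (x, s) * (2 * (x - x₀) i) * a (x, s) * b i (x, s) :=
      fun i => integrable_of_continuous_of_eq_zero (x₀ := x₀) (T := T)
        (((hφs.mul (continuous_const.mul (hxc i))).mul hac).mul (hbc i)) fun x hx => by
        simp [hz x hx]
    have e1 : ∫ x, F' (x, s) = (∫ x, φ' (x, s) * (-(2 * (T - s))) * en (x, s))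
        + ∑ i, ∫ x, φ' (x, s) * (2 * (x - x₀) i) * a (x, s) * b i (x, s) := by
      simp_rw [← hparts s hs hsT]
      rw [← integral_finsetSum _ fun i _ => j2 i,
        ← integral_add j1 (integrable_finsetSum _ fun i _ => j2 i)]
      refine integral_congr_ae (ae_of_all _ fun x => ?_)
      simp only [hF', hab (x, s) hs, hba (x, s) hs, Finset.mul_sum, ← Finset.sum_add_distrib,
        mul_add]
    rw [e1, ← integral_finsetSum _ fun i _ => j3 i,
      ← integral_add j1 (integrable_finsetSum _ fun i _ => j3 i)]
    refine integral_nonpos fun x => ?_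
    have hre : φ' (x, s) * (-(2 * (T - s))) * en (x, s)
        + ∑ i, φ' (x, s) * (2 * (x - x₀) i) * a (x, s) * b i (x, s)
        = φ' (x, s) * (2 * a (x, s) * ∑ i, (x - x₀) i * b i (x, s)
          - (T - s) * (a (x, s) ^ 2 + ∑ i, b i (x, s) ^ 2)) := by
      simp only [hen, mul_sub, Finset.mul_sum]
      rw [sub_eq_add_neg, add_comm]
      congr 1
      · exact Finset.sum_congr rfl fun i _ => by ring
      · ring
    change φ' (x, s) * (-(2 * (T - s))) * en (x, s)
        + ∑ i, φ' (x, s) * (2 * (x - x₀) i) * a (x, s) * b i (x, s) ≤ 0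
    rw [hre]
    by_cases hneg : coneFun x₀ T (x, s) < 0
    · simp [hφ', deriv_expNegInvGlue_of_neg hneg]
    · refine mul_nonpos_of_nonneg_of_nonpos (deriv_expNegInvGlue_nonneg _) ?_
      rw [sub_nonpos]
      refine energy_flux_le (sub_pos.2 hsT) _ _ ?_
      have : ‖x - x₀‖ ^ 2 ≤ (T - s) ^ 2 := by simpa [coneFun] using hneg
      rwa [EuclideanSpace.real_norm_sq_eq] at this
  have hEncont : ContinuousOn En (Ico 0 T) := by
    refine continuousOn_integral_of_compact_support (isCompact_closedBall x₀ T) ?_ ?_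
    · refine ContinuousOn.comp (g := fun z => W z * en z)
        (f := fun q : ℝ × Space d => (q.2, q.1)) (hWc.continuousOn.mul henc)
        (by fun_prop) fun q hq => ⟨mem_univ _, hq.1.1⟩
    · intro s x hs hx
      rw [hW0 (x, s) hs.1 hs.2.le hx, zero_mul]
  have hanti : AntitoneOn En (Ico 0 T) := by
    refine antitoneOn_of_deriv_nonpos (convex_Ico 0 T) hEncont ?_ ?_
    · rw [interior_Ico]
      exact fun s hs => (hEnderiv s hs.1 hs.2).differentiableAt.differentiableWithinAt
    · rw [interior_Ico]
      intro s hs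
      rw [(hEnderiv s hs.1 hs.2).deriv]
      exact hEn' s hs.1 hs.2
  -- the energy vanishes initially, is nonincreasing and nonnegative
  have hE0 : En 0 = 0 := by
    refine integral_eq_zero_of_ae (ae_of_all _ fun x => ?_)
    by_cases hx : x ∈ Metric.ball x₀ T
    · simp [hen, ha0 x hx, hb0 x hx]
    · have : W (x, 0) = 0 := coneWeight_eq_zero le_rfl hT.le hx
      simp [this]
  have hennn : ∀ z, 0 ≤ en z := fun z => by
    have : 0 ≤ ∑ i, b i z ^ 2 := Finset.sum_nonneg fun i _ => sq_nonneg _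
    simp only [hen]; positivity
  have hnn : 0 ≤ fun x => W (x, t) * en (x, t) := fun x =>
    mul_nonneg (expNegInvGlue.nonneg _) (hennn _)
  have hEt : En t = 0 := le_antisymm
    ((hanti ⟨le_rfl, hT⟩ ⟨ht.le, htT⟩ ht.le).trans hE0.le) (integral_nonneg hnn)
  have hae := (integral_eq_zero_iff_of_nonneg hnn (hEint t ht.le htT.le)).1 hEt
  have hall := Continuous.ae_eq_iff_eq volume (hslice t ht.le _ (hWc.continuousOn.mul henc))
    (continuous_const (y := (0 : ℝ))) |>.1 hae
  have hx₀ : W (x₀, t) * en (x₀, t) = 0 := congrFun hall x₀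
  have hWpos : 0 < W (x₀, t) := expNegInvGlue.pos_of_pos (by
    have := sub_pos.2 htT
    simp only [coneFun, sub_self, norm_zero, ne_eq, OfNat.ofNat_ne_zero, not_false_eq_true,
      zero_pow, sub_zero]
    exact pow_pos this 2)
  have hen0 : en (x₀, t) = 0 := (mul_eq_zero.1 hx₀).resolve_left hWpos.ne'
  have hB : 0 ≤ ∑ i, b i (x₀, t) ^ 2 := Finset.sum_nonneg fun i _ => sq_nonneg _
  have : a (x₀, t) ^ 2 = 0 := by
    simp only [hen] at hen0
    nlinarith [sq_nonneg (a (x₀, t))]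
  exact pow_eq_zero_iff two_ne_zero |>.1 this

end Energy

/-! ### Domain of dependence and uniqueness -/

section DomainOfDependence

variable {d : ℕ}

/-- The wave operator `∂_t² - Δ` as a linear functional of the second derivative on `ℝ^d × ℝ`. -/
def boxForm (d : ℕ) :
    ContinuousMultilinearMap ℝ (fun _ : Fin 2 => Space d × ℝ) ℝ →L[ℝ] ℝ :=
  ContinuousMultilinearMap.apply ℝ (fun _ : Fin 2 => Space d × ℝ) ℝ ![(0, 1), (0, 1)] -
    ∑ i, ContinuousMultilinearMap.apply ℝ (fun _ : Fin 2 => Space d × ℝ) ℝ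
      ![(EuclideanSpace.single i 1, 0), (EuclideanSpace.single i 1, 0)]

theorem boxForm_apply (M : ContinuousMultilinearMap ℝ (fun _ : Fin 2 => Space d × ℝ) ℝ) :
    boxForm d M = M ![(0, 1), (0, 1)] -
      ∑ i, M ![(EuclideanSpace.single i 1, 0), (EuclideanSpace.single i 1, 0)] := by
  simp [boxForm]

theorem iteratedFDeriv_two_comp_affine {E F : Type*} [NormedAddCommGroup E] [NormedSpace ℝ E]
    [NormedAddCommGroup F] [NormedSpace ℝ F] {P : E → ℝ} {a : E} {L : F →L[ℝ] E} {y : F}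
    (h : ContDiffAt ℝ 2 P (a + L y)) (u v : F) :
    iteratedFDeriv ℝ 2 (fun y => P (a + L y)) y ![u, v] =
      iteratedFDeriv ℝ 2 P (a + L y) ![L u, L v] := by
  have hL : ∀ y, HasFDerivAt (fun y => a + L y) L y := fun y => L.hasFDerivAt.const_add a
  have hev : fderiv ℝ (fun y => P (a + L y)) =ᶠ[𝓝 y] fun y' => (fderiv ℝ P (a + L y')).comp L := by
    have h1 : ∀ᶠ z in 𝓝 (a + L y), ContDiffAt ℝ 2 P z := h.eventually (by simp)
    filter_upwards [(hL y).continuousAt.eventually h1] with y' hy'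
    exact ((hy'.differentiableAt two_ne_zero).hasFDerivAt.comp y' (hL y')).fderiv
  have h2 : HasFDerivAt (fderiv ℝ P) (fderiv ℝ (fderiv ℝ P) (a + L y)) (a + L y) :=
    ((h.fderiv_right (m := 1) le_rfl).differentiableAt one_ne_zero).hasFDerivAt
  have h3 := (h2.comp y (hL y)).clm_comp (hasFDerivAt_const L y)
  rw [iteratedFDeriv_two_apply, iteratedFDeriv_two_apply, hev.fderiv_eq]
  rw [show (fun y' => (fderiv ℝ P (a + L y')).comp L)
    = fun y' => ((fderiv ℝ P ∘ fun y => a + L y) y').comp L from rfl, h3.fderiv]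
  simp

theorem iteratedDeriv_time {P : Space d × ℝ → ℝ} {x : Space d} {t : ℝ}
    (h : ContDiffAt ℝ 2 P (x, t)) :
    iteratedDeriv 2 (fun s => P (x, s)) t = iteratedFDeriv ℝ 2 P (x, t) ![(0, 1), (0, 1)] := by
  have := iteratedFDeriv_two_comp_affine (P := P) (a := (x, 0))
    (L := ContinuousLinearMap.inr ℝ (Space d) ℝ) (y := t) (by simpa using h) 1 1
  simp only [ContinuousLinearMap.inr_apply, Prod.mk_add_mk, add_zero, zero_add] at this
  rw [← this, iteratedDeriv_eq_iteratedFDeriv]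
  congr 1
  ext i; fin_cases i <;> rfl

theorem laplacian_space {P : Space d × ℝ → ℝ} {x : Space d} {t : ℝ}
    (h : ContDiffAt ℝ 2 P (x, t)) :
    (Δ (fun y => P (y, t))) x = ∑ i, iteratedFDeriv ℝ 2 P (x, t)
      ![(EuclideanSpace.single i 1, 0), (EuclideanSpace.single i 1, 0)] := by
  rw [InnerProductSpace.laplacian_eq_iteratedFDeriv_orthonormalBasis _
    (EuclideanSpace.basisFun (Fin d) ℝ)]
  refine Finset.sum_congr rfl fun i _ => ?_
  have := iteratedFDeriv_two_comp_affine (P := P) (a := (0, t))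
    (L := ContinuousLinearMap.inl ℝ (Space d) ℝ) (y := x) (by simpa using h)
    (EuclideanSpace.single i 1) (EuclideanSpace.single i 1)
  simp only [ContinuousLinearMap.inl_apply, Prod.mk_add_mk, add_zero, zero_add] at this
  simpa using this

/-- A `C²` function on `ℝ^d × ℝ` that is even in time and solves the wave equation restricts to a
classical solution; evenness encodes the initial condition `p_t(·, 0) = 0`. -/
theorem isWaveSolution_of_even {P : Space d × ℝ → ℝ} {f : Space d → ℝ} (hP : ContDiff ℝ 2 P)
    (heven : ∀ x t, P (x, -t) = P (x, t)) (hbox : ∀ z, boxForm d (iteratedFDeriv ℝ 2 P z) = 0)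
    (h0 : ∀ x, P (x, 0) = f x) : IsWaveSolution f fun x t => P (x, t) where
  contDiffOn := hP.contDiffOn
  wave_eq x t _ := by
    rw [iteratedDeriv_time hP.contDiffAt, laplacian_space hP.contDiffAt]
    have := hbox (x, t)
    rwa [boxForm_apply, sub_eq_zero] at this
  init := h0
  init_deriv x := by
    have hd : DifferentiableAt ℝ (fun s => P (x, s)) 0 :=
      (hP.differentiable two_ne_zero (x, 0)).comp (0 : ℝ) (by fun_prop)
    have h1 : HasDerivAt (fun s => P (x, -s)) (-deriv (fun s => P (x, s)) 0) 0 := by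
      have h2 : HasDerivAt (fun s => P (x, s)) (deriv (fun s => P (x, s)) 0) (-0) := by
        simpa using hd.hasDerivAt
      have h3 := h2.scomp (0 : ℝ) (hasDerivAt_neg (0 : ℝ))
      rw [neg_one_smul] at h3
      exact h3
    have h3 : deriv (fun s => P (x, s)) 0 = -deriv (fun s => P (x, s)) 0 := by
      simp_rw [heven] at h1
      exact h1.deriv
    have h4 : deriv (fun s => P (x, s)) 0 = 0 := by linarith
    exact (h4 ▸ hd.hasDerivAt).hasDerivWithinAt

theorem IsWaveSolution.contDiffAt {f : Space d → ℝ} {p : Space d → ℝ → ℝ} (hp : IsWaveSolution f p)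
    {z : Space d × ℝ} (hz : 0 < z.2) : ContDiffAt ℝ 2 (fun z : Space d × ℝ => p z.1 z.2) z :=
  hp.contDiffOn.contDiffAt (prod_mem_nhds univ_mem (Ici_mem_nhds hz))

theorem IsWaveSolution.box_eq_zero {f : Space d → ℝ} {p : Space d → ℝ → ℝ}
    (hp : IsWaveSolution f p) {z : Space d × ℝ} (hz : 0 < z.2) :
    boxForm d (iteratedFDeriv ℝ 2 (fun z : Space d × ℝ => p z.1 z.2) z) = 0 := by
  have h1 := iteratedDeriv_time (x := z.1) (t := z.2) (hp.contDiffAt hz)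
  have h2 := laplacian_space (x := z.1) (t := z.2) (hp.contDiffAt hz)
  rw [boxForm_apply, sub_eq_zero]
  exact h1.symm.trans ((hp.wave_eq z.1 z.2 hz).trans h2)

/-- **Domain of dependence**: two classical solutions whose data agree on the ball of radius `T`
about `x` agree at `(x, t)` for `t < T`. -/
theorem IsWaveSolution.eq_of_eqOn_ball {f g : Space d → ℝ} {p q : Space d → ℝ → ℝ}
    (hp : IsWaveSolution f p) (hq : IsWaveSolution g q) {x₀ : Space d} {T : ℝ}
    (hfg : EqOn f g (Metric.ball x₀ T)) {t : ℝ} (ht : 0 ≤ t) (htT : t < T) :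
    p x₀ t = q x₀ t := by
  have hT : 0 < T := ht.trans_lt htT
  set S : Set (Space d × ℝ) := univ ×ˢ Ici 0 with hS
  set P : Space d × ℝ → ℝ := fun z => p z.1 z.2 - q z.1 z.2 with hP
  have hC : ContDiffOn ℝ 2 P S := hp.contDiffOn.sub hq.contDiffOn
  have hSu : UniqueDiffOn ℝ S := uniqueDiffOn_univ.prod (uniqueDiffOn_Ici 0)
  have hnhds : ∀ z : Space d × ℝ, 0 < z.2 → S ∈ 𝓝 z := fun z hz =>
    prod_mem_nhds univ_mem (Ici_mem_nhds hz)
  have hCat : ∀ z : Space d × ℝ, 0 < z.2 → ContDiffAt ℝ 2 P z := fun z hz =>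
    hC.contDiffAt (hnhds z hz)
  have hbox : ∀ z : Space d × ℝ, 0 < z.2 → boxForm d (iteratedFDeriv ℝ 2 P z) = 0 := by
    intro z hz
    have : iteratedFDeriv ℝ 2 P z = iteratedFDeriv ℝ 2 (fun z : Space d × ℝ => p z.1 z.2) z
        - iteratedFDeriv ℝ 2 (fun z : Space d × ℝ => q z.1 z.2) z :=
      iteratedFDeriv_sub_apply (hp.contDiffAt hz) (hq.contDiffAt hz)
    rw [this, map_sub, hp.box_eq_zero hz, hq.box_eq_zero hz, sub_zero]
  set A : Space d × ℝ → (Space d × ℝ →L[ℝ] ℝ) := fderivWithin ℝ P S with hA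
  have hAc : ContinuousOn A S := hC.continuousOn_fderivWithin hSu one_le_two
  have hAeq : ∀ z : Space d × ℝ, 0 < z.2 → A =ᶠ[𝓝 z] fderiv ℝ P := by
    intro z hz
    filter_upwards [(isOpen_univ.prod isOpen_Ioi).mem_nhds
      (show z ∈ (univ : Set (Space d)) ×ˢ Ioi (0 : ℝ) from ⟨mem_univ _, hz⟩)] with z' hz'
    exact fderivWithin_of_mem_nhds (hnhds z' hz'.2)
  have hAcd : ContDiffOn ℝ 1 A (univ ×ˢ Ioi 0) := by
    intro z hz
    exact (((hCat z hz.2).fderiv_right (m := 1) le_rfl).congr_of_eventuallyEq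
      (hAeq z hz.2)).contDiffWithinAt
  have hAfd : ∀ z : Space d × ℝ, 0 < z.2 → ∀ u v,
      fderiv ℝ (fun z => A z v) z u = iteratedFDeriv ℝ 2 P z ![u, v] := by
    intro z hz u v
    have h1 : DifferentiableAt ℝ (fderiv ℝ P) z :=
      ((hCat z hz).fderiv_right (m := 1) le_rfl).differentiableAt one_ne_zero
    have h2 : (fun z => A z v) =ᶠ[𝓝 z] fun z => fderiv ℝ P z v :=
      (hAeq z hz).mono fun z' hz' => by simp only [hz']
    rw [h2.fderiv_eq, iteratedFDeriv_two_apply, (h1.hasFDerivAt.clm_apply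
      (hasFDerivAt_const v z)).fderiv]
    simp
  have hsymm : ∀ z : Space d × ℝ, 0 < z.2 → ∀ u v,
      iteratedFDeriv ℝ 2 P z ![u, v] = iteratedFDeriv ℝ 2 P z ![v, u] := by
    intro z hz u v
    have := (hCat z hz).isSymmSndFDerivAt (by simp) u v
    simpa [iteratedFDeriv_two_apply] using this
  have hPder : ∀ z ∈ S, HasFDerivWithinAt P (A z) S z := fun z hz =>
    ((hC.differentiableOn two_ne_zero) z hz).hasFDerivWithinAt
  have htime : ∀ x s, 0 ≤ s → HasDerivWithinAt (fun s => P (x, s)) (A (x, s) (0, 1)) (Ici 0) s := by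
    intro x s hs
    exact (hPder (x, s) ⟨mem_univ _, hs⟩).comp_hasDerivWithinAt s
      ((hasDerivWithinAt_const s _ x).prodMk (hasDerivWithinAt_id s _))
      fun u hu => ⟨mem_univ _, hu⟩
  have hinit : ∀ x, HasDerivWithinAt (fun s => P (x, s)) 0 (Ici 0) 0 := fun x => by
    have := (hp.init_deriv x).sub (hq.init_deriv x)
    rwa [sub_zero] at this
  have hat : ∀ s, 0 < s → s < T → A (x₀, s) (0, 1) = 0 := by
    intro s hs hsT
    refine eq_zero_of_symmetric_system x₀ T (a := fun z => A z (0, 1))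
      (b := fun i z => A z (EuclideanSpace.single i 1, 0))
      (hAc.clm_apply continuousOn_const) (fun i => hAc.clm_apply continuousOn_const)
      (hAcd.clm_apply contDiffOn_const) (fun i => hAcd.clm_apply contDiffOn_const)
      (fun z hz => ?_) (fun z hz i => ?_) (fun x hx => ?_) (fun x hx i => ?_) hs hsT
    · have := hbox z hz
      rw [boxForm_apply, sub_eq_zero] at this
      simp_rw [hAfd z hz]
      exact this
    · rw [hAfd z hz, hAfd z hz, hsymm z hz]
    · exact (uniqueDiffOn_Ici (0 : ℝ) 0 self_mem_Ici).eq_deriv _ (htime x 0 le_rfl) (hinit x)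
    · have h1 : HasFDerivAt (fun y => P (y, 0))
          ((A (x, 0)).comp (ContinuousLinearMap.inl ℝ (Space d) ℝ)) x := by
        have := (hPder (x, 0) ⟨mem_univ _, self_mem_Ici⟩).comp x
          ((hasFDerivAt_prodMk_left (𝕜 := ℝ) x (0 : ℝ)).hasFDerivWithinAt (s := univ))
          (fun y _ => (⟨mem_univ _, self_mem_Ici⟩ : (y, (0 : ℝ)) ∈ S))
        rw [hasFDerivWithinAt_univ] at this
        exact this
      have h2 : (fun y => P (y, 0)) =ᶠ[𝓝 x] fun _ => 0 := by
        filter_upwards [Metric.isOpen_ball.mem_nhds hx] with y hy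
        simp [hP, hp.init, hq.init, hfg hy]
      have h3 := h1.unique ((hasFDerivAt_const (0 : ℝ) x).congr_of_eventuallyEq h2)
      simpa using congrArg (fun M => M (EuclideanSpace.single i 1)) h3
  -- the time derivative vanishes along the axis of the cone, so `P` keeps its initial value there
  have hconst := constant_of_has_deriv_right_zero (f := fun s => P (x₀, s)) (a := 0) (b := t)
    (fun s hs => ((htime x₀ s hs.1).continuousWithinAt).mono fun u hu => hu.1)
    (fun s hs => by
      rcases hs.1.eq_or_lt with h | h
      · subst h
        exact hinit x₀
      · have := htime x₀ s hs.1
        rw [hat s h (hs.2.trans htT)] at this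
        exact this.mono (Ici_subset_Ici.2 hs.1)) t ⟨ht, le_rfl⟩
  have h0 : P (x₀, 0) = 0 := by
    simp [hP, hp.init, hq.init, hfg (Metric.mem_ball_self hT)]
  have : P (x₀, t) = 0 := hconst.trans h0
  exact sub_eq_zero.1 this

theorem IsWaveSolution.eq {f : Space d → ℝ} {p q : Space d → ℝ → ℝ}
    (hp : IsWaveSolution f p) (hq : IsWaveSolution f q) (x : Space d) {t : ℝ} (ht : 0 ≤ t) :
    p x t = q x t :=
  hp.eq_of_eqOn_ball hq (fun _ _ => rfl) ht (lt_add_one t)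

theorem IsWaveSolution.isWaveSolution_waveOp {f : Space d → ℝ} {p : Space d → ℝ → ℝ}
    (hp : IsWaveSolution f p) : IsWaveSolution f (waveOp f) := by
  have h : ∃ p : Space d → ℝ → ℝ, IsWaveSolution f p := ⟨p, hp⟩
  rw [waveOp, dif_pos h]
  exact h.choose_spec

theorem IsWaveSolution.waveOp_eq {f : Space d → ℝ} {p : Space d → ℝ → ℝ}
    (hp : IsWaveSolution f p) (x : Space d) {t : ℝ} (ht : 0 ≤ t) : waveOp f x t = p x t :=
  hp.isWaveSolution_waveOp.eq hp x ht

end DomainOfDependence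

/-! ### Plane-wave solutions for compactly supported data -/

section FourierSolution

open scoped FourierTransform RealInnerProductSpace

variable {d : ℕ}

/-- The sum of the `L¹` norms of the derivatives of order at most `N`. -/
def sobolevSum (N : ℕ) (g : Space d → ℝ) : ℝ :=
  ∑ p ∈ Finset.range (N + 1), ∫ y, ‖iteratedFDeriv ℝ p g y‖

theorem norm_iteratedFDeriv_ofReal {g : Space d → ℝ} (hg : ContDiff ℝ ∞ g) (p : ℕ) (y : Space d) :
    ‖iteratedFDeriv ℝ p (fun y => (g y : ℂ)) y‖ = ‖iteratedFDeriv ℝ p g y‖ :=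
  Complex.ofRealLI.norm_iteratedFDeriv_comp_left (f := g) (hg.contDiffAt (x := y)) (by
    exact_mod_cast le_top)

theorem contDiff_ofReal_comp {g : Space d → ℝ} (hg : ContDiff ℝ ∞ g) :
    ContDiff ℝ ∞ fun y => (g y : ℂ) := Complex.ofRealCLM.contDiff.comp hg

theorem integrable_norm_iteratedFDeriv {g : Space d → ℝ} (hg : ContDiff ℝ ∞ g)
    (hc : HasCompactSupport g) (p : ℕ) : Integrable fun y => ‖iteratedFDeriv ℝ p g y‖ :=
  ((hg.continuous_iteratedFDeriv (m := p)
    (by exact_mod_cast le_top)).integrable_of_hasCompactSupport (hc.iteratedFDeriv p)).norm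

theorem sobolevSum_mono {M N : ℕ} (h : M ≤ N) (g : Space d → ℝ) :
    sobolevSum M g ≤ sobolevSum N g :=
  Finset.sum_le_sum_of_subset_of_nonneg (Finset.range_mono (by omega)) fun _ _ _ =>
    integral_nonneg fun _ => norm_nonneg _

theorem pow_mul_norm_fourier_le {g : Space d → ℝ} (hg : ContDiff ℝ ∞ g) (hc : HasCompactSupport g)
    (n : ℕ) (ξ : Space d) :
    ‖ξ‖ ^ n * ‖𝓕 (fun y => (g y : ℂ)) ξ‖ ≤ 2 ^ n * sobolevSum n g := by
  have h := Real.pow_mul_norm_iteratedFDeriv_fourier_le (K := 0) (N := ⊤) (k := 0) (n := n)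
    (contDiff_ofReal_comp hg) (fun k m hk hm => ?_) le_rfl le_top ξ
  · simpa [sobolevSum, Finset.sum_product, norm_iteratedFDeriv_ofReal hg] using h
  · obtain rfl : k = 0 := by simpa using hk
    simpa [norm_iteratedFDeriv_ofReal hg] using integrable_norm_iteratedFDeriv hg hc m

/-- A bound for the `n`-th absolute moment of the Fourier transform of a function, in terms of the
`L¹` norms of its derivatives of order at most `n + d + 1`. -/
def momentConst (d n : ℕ) : ℝ :=
  2 ^ d * (2 ^ n + 2 ^ (n + (d + 1))) * ∫ ξ : Space d, (1 + ‖ξ‖) ^ (-((d : ℝ) + 1))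

/-- Using `d + 1` more derivatives than the power of `‖ξ‖` requires leaves an integrable
majorant. -/
theorem pow_mul_norm_fourier_le_rpow {g : Space d → ℝ} (hg : ContDiff ℝ ∞ g)
    (hc : HasCompactSupport g) (n : ℕ) (ξ : Space d) :
    ‖ξ‖ ^ n * ‖𝓕 (fun y => (g y : ℂ)) ξ‖ ≤
      2 ^ d * (2 ^ n + 2 ^ (n + (d + 1))) * sobolevSum (n + (d + 1)) g
        * (1 + ‖ξ‖) ^ (-((d : ℝ) + 1)) := by
  have hpos : 0 < 1 + ‖ξ‖ := by positivity
  rw [Real.rpow_neg hpos.le, show ((d : ℝ) + 1) = ((d + 1 : ℕ) : ℝ) by push_cast; ring,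
    Real.rpow_natCast, ← div_eq_mul_inv, le_div_iff₀ (by positivity)]
  have h1 : (1 + ‖ξ‖) ^ (d + 1) ≤ 2 ^ d * (1 + ‖ξ‖ ^ (d + 1)) := by
    simpa using add_pow_le zero_le_one (norm_nonneg ξ) (d + 1)
  have h2 := pow_mul_norm_fourier_le hg hc n ξ
  have h3 := pow_mul_norm_fourier_le hg hc (n + (d + 1)) ξ
  have h4 := sobolevSum_mono (show n ≤ n + (d + 1) by omega) g
  set F := ‖𝓕 (fun y => (g y : ℂ)) ξ‖ with hF
  have hF0 : 0 ≤ F := norm_nonneg _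
  calc ‖ξ‖ ^ n * F * (1 + ‖ξ‖) ^ (d + 1)
      ≤ ‖ξ‖ ^ n * F * (2 ^ d * (1 + ‖ξ‖ ^ (d + 1))) := by gcongr
    _ = 2 ^ d * (‖ξ‖ ^ n * F + ‖ξ‖ ^ (n + (d + 1)) * F) := by ring
    _ ≤ 2 ^ d * (2 ^ n * sobolevSum (n + (d + 1)) g
          + 2 ^ (n + (d + 1)) * sobolevSum (n + (d + 1)) g) := by
        exact mul_le_mul_of_nonneg_left (add_le_add
          (h2.trans (mul_le_mul_of_nonneg_left h4 (by positivity))) h3) (by positivity)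
    _ = _ := by ring

theorem integrable_one_add_norm_rpow (d : ℕ) :
    Integrable fun ξ : Space d => (1 + ‖ξ‖) ^ (-((d : ℝ) + 1)) :=
  integrable_one_add_norm (by simp)

theorem continuous_fourier_ofReal {g : Space d → ℝ} (hg : ContDiff ℝ ∞ g)
    (hc : HasCompactSupport g) : Continuous (𝓕 fun y => (g y : ℂ)) :=
  VectorFourier.fourierIntegral_continuous Real.continuous_fourierChar
    (by exact continuous_inner)
    ((contDiff_ofReal_comp hg).continuous.integrable_of_hasCompactSupport
      (hc.comp_left Complex.ofReal_zero))

theorem integrable_pow_mul_norm_fourier {g : Space d → ℝ} (hg : ContDiff ℝ ∞ g)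
    (hc : HasCompactSupport g) (n : ℕ) :
    Integrable fun ξ => ‖ξ‖ ^ n * ‖𝓕 (fun y => (g y : ℂ)) ξ‖ := by
  refine ((integrable_one_add_norm_rpow d).const_mul
    (2 ^ d * (2 ^ n + 2 ^ (n + (d + 1))) * sobolevSum (n + (d + 1)) g)).mono' ?_
    (ae_of_all _ fun ξ => ?_)
  · have := continuous_fourier_ofReal hg hc
    exact Continuous.aestronglyMeasurable (by fun_prop)
  · rw [Real.norm_of_nonneg (by positivity)]
    exact pow_mul_norm_fourier_le_rpow hg hc n ξ

theorem integral_pow_mul_norm_fourier_le {g : Space d → ℝ} (hg : ContDiff ℝ ∞ g)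
    (hc : HasCompactSupport g) (n : ℕ) :
    ∫ ξ, ‖ξ‖ ^ n * ‖𝓕 (fun y => (g y : ℂ)) ξ‖ ≤
      momentConst d n * sobolevSum (n + (d + 1)) g := by
  refine (integral_mono (integrable_pow_mul_norm_fourier hg hc n)
    ((integrable_one_add_norm_rpow d).const_mul
    (2 ^ d * (2 ^ n + 2 ^ (n + (d + 1))) * sobolevSum (n + (d + 1)) g))
    (pow_mul_norm_fourier_le_rpow hg hc n)).trans_eq ?_
  rw [integral_const_mul, momentConst]
  ring

/-- The sum of the pushforwards of Lebesgue measure to the two sheets `s = ±‖ξ‖` of the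
characteristic cone of the wave equation. -/
def coneMeasure (d : ℕ) : Measure (Space d × ℝ) :=
  Measure.map (fun ξ => (ξ, ‖ξ‖)) volume + Measure.map (fun ξ => (ξ, -‖ξ‖)) volume

theorem integrable_coneMeasure {G : Type*} [NormedAddCommGroup G] {F : Space d × ℝ → G}
    (hF : Continuous F) (h₁ : Integrable fun ξ => F (ξ, ‖ξ‖))
    (h₂ : Integrable fun ξ => F (ξ, -‖ξ‖)) : Integrable F (coneMeasure d) := by
  rw [coneMeasure, integrable_add_measure, integrable_map_measure, integrable_map_measure]
  · exact ⟨h₁, h₂⟩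
  all_goals first
    | exact hF.aestronglyMeasurable
    | exact Continuous.aemeasurable (by fun_prop)

theorem integral_coneMeasure {G : Type*} [NormedAddCommGroup G] [NormedSpace ℝ G]
    {F : Space d × ℝ → G}
    (hF : Continuous F) (h₁ : Integrable fun ξ => F (ξ, ‖ξ‖))
    (h₂ : Integrable fun ξ => F (ξ, -‖ξ‖)) :
    ∫ v, F v ∂coneMeasure d = (∫ ξ, F (ξ, ‖ξ‖)) + ∫ ξ, F (ξ, -‖ξ‖) := by
  have h := integrable_coneMeasure hF h₁ h₂
  rw [coneMeasure, integrable_add_measure] at h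
  rw [coneMeasure, integral_add_measure h.1 h.2, integral_map, integral_map]
  all_goals first
    | exact hF.aestronglyMeasurable
    | exact Continuous.aemeasurable (by fun_prop)

/-- Almost every frequency is characteristic for the wave operator. -/
theorem ae_coneMeasure : ∀ᵐ v ∂coneMeasure d, v.2 ^ 2 = ‖v.1‖ ^ 2 := by
  have hm : MeasurableSet {v : Space d × ℝ | v.2 ^ 2 = ‖v.1‖ ^ 2} :=
    measurableSet_eq_fun (by fun_prop) (by fun_prop)
  rw [coneMeasure, ae_add_measure_iff, ae_map_iff (Continuous.aemeasurable (by fun_prop)) hm,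
    ae_map_iff (Continuous.aemeasurable (by fun_prop)) hm]
  simp

/-- The pairing `((ξ, s), (x, t)) ↦ -(⟪ξ, x⟫ + s t)` of frequencies with space-time points. -/
def phasePairing (d : ℕ) : Space d × ℝ →L[ℝ] Space d × ℝ →L[ℝ] ℝ :=
  -((show Space d →L[ℝ] Space d →L[ℝ] ℝ from innerSL ℝ).bilinearComp
      (ContinuousLinearMap.fst ℝ (Space d) ℝ)
      (ContinuousLinearMap.fst ℝ (Space d) ℝ) +
    (ContinuousLinearMap.mul ℝ ℝ).bilinearComp (ContinuousLinearMap.snd ℝ (Space d) ℝ)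
      (ContinuousLinearMap.snd ℝ (Space d) ℝ))

theorem phasePairing_apply (v z : Space d × ℝ) :
    phasePairing d v z = -(⟪v.1, z.1⟫ + v.2 * z.2) := by
  simp [phasePairing]
  rfl

/-- The complex superposition of plane waves with amplitude the Fourier transform of `g`. -/
def planeWaves (g : Space d → ℝ) : Space d × ℝ → ℂ :=
  VectorFourier.fourierIntegral Real.fourierChar (coneMeasure d) (phasePairing d).toLinearMap₁₂
    fun v => 𝓕 (fun y => (g y : ℂ)) v.1

/-- The solution of the wave equation with compactly supported smooth initial data `g` and
vanishing initial velocity, as a superposition of plane waves. -/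
def fourierWave (g : Space d → ℝ) (z : Space d × ℝ) : ℝ := 1 / 2 * (planeWaves g z).re

theorem continuous_amplitude {g : Space d → ℝ} (hg : ContDiff ℝ ∞ g)
    (hc : HasCompactSupport g) :
    Continuous fun v : Space d × ℝ => 𝓕 (fun y => (g y : ℂ)) v.1 :=
  (continuous_fourier_ofReal hg hc).comp continuous_fst

theorem norm_cone_mk (ξ : Space d) : ‖(ξ, ‖ξ‖)‖ = ‖ξ‖ := by simp [Prod.norm_def]

theorem norm_cone_mk_neg (ξ : Space d) : ‖(ξ, -‖ξ‖)‖ = ‖ξ‖ := by simp [Prod.norm_def]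

theorem integrable_pow_mul_amplitude {g : Space d → ℝ} (hg : ContDiff ℝ ∞ g)
    (hc : HasCompactSupport g) (n : ℕ) :
    Integrable (fun v => ‖v‖ ^ n * ‖𝓕 (fun y => (g y : ℂ)) v.1‖) (coneMeasure d) := by
  have := continuous_amplitude hg hc
  refine integrable_coneMeasure (by fun_prop) ?_ ?_
  · simpa only [norm_cone_mk] using integrable_pow_mul_norm_fourier hg hc n
  · simpa only [norm_cone_mk_neg] using integrable_pow_mul_norm_fourier hg hc n

theorem integral_pow_mul_amplitude_le {g : Space d → ℝ} (hg : ContDiff ℝ ∞ g)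
    (hc : HasCompactSupport g) (n : ℕ) :
    ∫ v, ‖v‖ ^ n * ‖𝓕 (fun y => (g y : ℂ)) v.1‖ ∂coneMeasure d ≤
      2 * (momentConst d n * sobolevSum (n + (d + 1)) g) := by
  have := continuous_amplitude hg hc
  rw [integral_coneMeasure (by fun_prop)]
  · simp only [norm_cone_mk, norm_cone_mk_neg]
    linarith [integral_pow_mul_norm_fourier_le hg hc n]
  · simpa only [norm_cone_mk] using integrable_pow_mul_norm_fourier hg hc n
  · simpa only [norm_cone_mk_neg] using integrable_pow_mul_norm_fourier hg hc n

theorem contDiff_planeWaves {g : Space d → ℝ} (hg : ContDiff ℝ ∞ g) (hc : HasCompactSupport g) :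
    ContDiff ℝ ∞ (planeWaves g) :=
  VectorFourier.contDiff_fourierIntegral (N := ⊤) (phasePairing d)
    fun n _ => integrable_pow_mul_amplitude hg hc n

theorem iteratedFDeriv_planeWaves {g : Space d → ℝ} (hg : ContDiff ℝ ∞ g)
    (hc : HasCompactSupport g) (n : ℕ) :
    iteratedFDeriv ℝ n (planeWaves g) =
      VectorFourier.fourierIntegral Real.fourierChar (coneMeasure d)
        (phasePairing d).toLinearMap₁₂
        fun v => VectorFourier.fourierPowSMulRight (phasePairing d)
          (fun v => 𝓕 (fun y => (g y : ℂ)) v.1) v n :=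
  VectorFourier.iteratedFDeriv_fourierIntegral (N := ⊤) (phasePairing d)
    (fun n _ => integrable_pow_mul_amplitude hg hc n)
    (continuous_amplitude hg hc).aestronglyMeasurable le_top

theorem contDiff_fourierWave {g : Space d → ℝ} (hg : ContDiff ℝ ∞ g) (hc : HasCompactSupport g) :
    ContDiff ℝ ∞ (fourierWave g) :=
  contDiff_const.mul (Complex.reCLM.contDiff.comp (contDiff_planeWaves hg hc))

theorem iteratedFDeriv_fourierWave {g : Space d → ℝ} (hg : ContDiff ℝ ∞ g)
    (hc : HasCompactSupport g) (n : ℕ) (z : Space d × ℝ) :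
    iteratedFDeriv ℝ n (fourierWave g) z = (1 / 2 : ℝ) •
      Complex.reCLM.compContinuousMultilinearMap (iteratedFDeriv ℝ n (planeWaves g) z) := by
  have h1 := (contDiff_planeWaves hg hc).contDiffAt (x := z)
  have h2 : iteratedFDeriv ℝ n (fun z => (planeWaves g z).re) z =
      Complex.reCLM.compContinuousMultilinearMap (iteratedFDeriv ℝ n (planeWaves g) z) :=
    Complex.reCLM.iteratedFDeriv_comp_left h1 (by exact_mod_cast le_top)
  rw [← h2]
  exact iteratedFDeriv_const_smul_apply (𝕜 := ℝ) (a := (1 / 2 : ℝ))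
    (f := fun z => (planeWaves g z).re)
    ((Complex.reCLM.contDiff.comp (contDiff_planeWaves hg hc)).contDiffAt.of_le
      (by exact_mod_cast le_top))

/-- A bound for the derivatives of order `n` of `fourierWave g`, in terms of `sobolevSum`. -/
def waveConst (d n : ℕ) : ℝ := (2 * Real.pi * ‖phasePairing d‖) ^ n * momentConst d n

theorem norm_iteratedFDeriv_fourierWave_le {g : Space d → ℝ} (hg : ContDiff ℝ ∞ g)
    (hc : HasCompactSupport g) (n : ℕ) (z : Space d × ℝ) :
    ‖iteratedFDeriv ℝ n (fourierWave g) z‖ ≤ waveConst d n * sobolevSum (n + (d + 1)) g := by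
  rw [iteratedFDeriv_fourierWave hg hc, iteratedFDeriv_planeWaves hg hc, norm_smul]
  have h1 : ‖Complex.reCLM.compContinuousMultilinearMap
      (VectorFourier.fourierIntegral Real.fourierChar (coneMeasure d)
        (phasePairing d).toLinearMap₁₂
        (fun v => VectorFourier.fourierPowSMulRight (phasePairing d)
          (fun v => 𝓕 (fun y => (g y : ℂ)) v.1) v n) z)‖ ≤
      ‖VectorFourier.fourierIntegral Real.fourierChar (coneMeasure d)
        (phasePairing d).toLinearMap₁₂
        (fun v => VectorFourier.fourierPowSMulRight (phasePairing d)
          (fun v => 𝓕 (fun y => (g y : ℂ)) v.1) v n) z‖ := by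
    refine (ContinuousLinearMap.norm_compContinuousMultilinearMap_le _ _).trans ?_
    rw [Complex.reCLM_norm, one_mul]
  have h2 := VectorFourier.norm_fourierIntegral_le_integral_norm Real.fourierChar (coneMeasure d)
    (phasePairing d).toLinearMap₁₂ (fun v => VectorFourier.fourierPowSMulRight (phasePairing d)
          (fun v => 𝓕 (fun y => (g y : ℂ)) v.1) v n) z
  have h3 : ∫ v, ‖VectorFourier.fourierPowSMulRight (phasePairing d)
          (fun v => 𝓕 (fun y => (g y : ℂ)) v.1) v n‖ ∂coneMeasure d ≤
      ∫ v, (2 * Real.pi * ‖phasePairing d‖) ^ n *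
        (‖v‖ ^ n * ‖𝓕 (fun y => (g y : ℂ)) v.1‖) ∂coneMeasure d := by
    refine integral_mono_of_nonneg (ae_of_all _ fun _ => norm_nonneg _)
      ((integrable_pow_mul_amplitude hg hc n).const_mul _) (ae_of_all _ fun v => ?_)
    refine (VectorFourier.norm_fourierPowSMulRight_le _ _ _ _).trans_eq ?_
    ring
  rw [integral_const_mul] at h3
  have h4 := mul_le_mul_of_nonneg_left (integral_pow_mul_amplitude_le hg hc n)
    (show 0 ≤ (2 * Real.pi * ‖phasePairing d‖) ^ n by positivity)
  have h5 := h1.trans (h2.trans (h3.trans h4))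
  rw [Real.norm_of_nonneg (by norm_num)]
  calc _ ≤ 1 / 2 * ((2 * Real.pi * ‖phasePairing d‖) ^ n *
        (2 * (momentConst d n * sobolevSum (n + (d + 1)) g))) := by gcongr
    _ = _ := by rw [waveConst]; ring

theorem iteratedFDeriv_two_planeWaves_apply {g : Space d → ℝ} (hg : ContDiff ℝ ∞ g)
    (hc : HasCompactSupport g) (z u : Space d × ℝ) :
    iteratedFDeriv ℝ 2 (planeWaves g) z ![u, u] =
      VectorFourier.fourierIntegral Real.fourierChar (coneMeasure d)
        (phasePairing d).toLinearMap₁₂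
        (fun v => (-(2 * Real.pi * Complex.I)) ^ 2 •
          ((phasePairing d v u) ^ 2 • 𝓕 (fun y => (g y : ℂ)) v.1)) z ∧
    Integrable (fun v => Real.fourierChar (-((phasePairing d).toLinearMap₁₂ v z)) •
      ((-(2 * Real.pi * Complex.I)) ^ 2 •
          ((phasePairing d v u) ^ 2 • 𝓕 (fun y => (g y : ℂ)) v.1))) (coneMeasure d) := by
  have hi := VectorFourier.integrable_fourierPowSMulRight (phasePairing d)
    (integrable_pow_mul_amplitude hg hc 2) (continuous_amplitude hg hc).aestronglyMeasurable
  have happ : ∀ v, VectorFourier.fourierPowSMulRight (phasePairing d)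
      (fun v => 𝓕 (fun y => (g y : ℂ)) v.1) v 2 ![u, u] =
      (-(2 * Real.pi * Complex.I)) ^ 2 •
          ((phasePairing d v u) ^ 2 • 𝓕 (fun y => (g y : ℂ)) v.1) := by
    intro v
    rw [VectorFourier.fourierPowSMulRight_apply]
    simp [Fin.prod_univ_two, pow_two]
  constructor
  · rw [iteratedFDeriv_planeWaves hg hc,
      Real.fourierIntegral_continuousMultilinearMap_apply' hi]
    simp only [happ]
  · have h2 : Integrable (fun v => VectorFourier.fourierPowSMulRight (phasePairing d)
      (fun v => 𝓕 (fun y => (g y : ℂ)) v.1) v 2 ![u, u]) (coneMeasure d) :=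
      ContinuousLinearMap.integrable_comp
        (ContinuousMultilinearMap.apply ℝ (fun _ : Fin 2 => Space d × ℝ) ℂ ![u, u]) hi
    simp only [happ] at h2
    exact (VectorFourier.fourierIntegral_convergent_iff Real.continuous_fourierChar
      (by exact (phasePairing d).continuous₂) z).2 h2

/-- The wave equation holds because the symbol of `∂_t² - Δ` vanishes on the frequencies used. -/
theorem boxForm_fourierWave {g : Space d → ℝ} (hg : ContDiff ℝ ∞ g)
    (hc : HasCompactSupport g) (z : Space d × ℝ) :
    boxForm d (iteratedFDeriv ℝ 2 (fourierWave g) z) = 0 := by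
  rw [iteratedFDeriv_fourierWave hg hc, map_smul, boxForm_apply]
  simp only [ContinuousLinearMap.compContinuousMultilinearMap_coe, Function.comp_apply]
  rw [← map_sum, ← map_sub]
  have key : iteratedFDeriv ℝ 2 (planeWaves g) z ![(0, 1), (0, 1)] -
      ∑ i, iteratedFDeriv ℝ 2 (planeWaves g) z
        ![(EuclideanSpace.single i 1, 0), (EuclideanSpace.single i 1, 0)] = 0 := by
    rw [(iteratedFDeriv_two_planeWaves_apply hg hc z _).1]
    simp_rw [(iteratedFDeriv_two_planeWaves_apply hg hc z (EuclideanSpace.single _ 1, 0)).1]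
    unfold VectorFourier.fourierIntegral
    rw [← integral_finsetSum _ fun i _ =>
        (iteratedFDeriv_two_planeWaves_apply hg hc z (EuclideanSpace.single i 1, 0)).2,
      ← integral_sub (iteratedFDeriv_two_planeWaves_apply hg hc z _).2
        (integrable_finsetSum _ fun i _ =>
        (iteratedFDeriv_two_planeWaves_apply hg hc z (EuclideanSpace.single i 1, 0)).2)]
    refine integral_eq_zero_of_ae ?_
    filter_upwards [ae_coneMeasure (d := d)] with v hv
    have hsum : ∑ i, phasePairing d v (EuclideanSpace.single i 1, 0) ^ 2
        = phasePairing d v (0, 1) ^ 2 := by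
      simp only [phasePairing_apply]
      simp [hv, EuclideanSpace.real_norm_sq_eq, EuclideanSpace.inner_single_right]
    simp only [Pi.zero_apply]
    rw [← Finset.smul_sum, ← Finset.smul_sum, ← Finset.sum_smul, hsum, sub_self]
  rw [key, map_zero, smul_zero]

theorem integrable_fourier_ofReal {g : Space d → ℝ} (hg : ContDiff ℝ ∞ g)
    (hc : HasCompactSupport g) : Integrable (𝓕 fun y => (g y : ℂ)) := by
  have := integrable_pow_mul_norm_fourier hg hc 0
  simp only [pow_zero, one_mul] at this
  exact (integrable_norm_iff (continuous_fourier_ofReal hg hc).aestronglyMeasurable).1 this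

/-- The two sheets of the characteristic cone combine to a cosine in time. -/
theorem fourierWave_eq {g : Space d → ℝ} (hg : ContDiff ℝ ∞ g)
    (hc : HasCompactSupport g) (x : Space d) (t : ℝ) :
    fourierWave g (x, t) = (∫ ξ, (Real.cos (2 * Real.pi * (t * ‖ξ‖)) : ℂ) *
      (Real.fourierChar ⟪ξ, x⟫ • 𝓕 (fun y => (g y : ℂ)) ξ)).re := by
  have hi := integrable_fourier_ofReal hg hc
  have hcont := continuous_fourier_ofReal hg hc
  have hF : Continuous fun v : Space d × ℝ =>
      Real.fourierChar (⟪v.1, x⟫ + v.2 * t) • 𝓕 (fun y => (g y : ℂ)) v.1 := by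
    have := continuous_amplitude hg hc
    fun_prop
  have hb : ∀ s : Space d → ℝ, Continuous s → Integrable fun ξ : Space d =>
      Real.fourierChar (⟪ξ, x⟫ + s ξ * t) • 𝓕 (fun y => (g y : ℂ)) ξ := fun s hs => by
    refine hi.norm.mono' (Continuous.aestronglyMeasurable (by fun_prop)) (ae_of_all _ fun ξ => ?_)
    rw [Circle.norm_smul]
  rw [fourierWave, planeWaves, VectorFourier.fourierIntegral]
  have e1 : ∀ v : Space d × ℝ, -((phasePairing d).toLinearMap₁₂ v (x, t)) = ⟪v.1, x⟫ + v.2 * t := by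
    intro v
    have := phasePairing_apply v (x, t)
    change -(phasePairing d v (x, t)) = _
    rw [this, neg_neg]
  simp_rw [e1]
  rw [integral_coneMeasure hF (hb _ continuous_norm) (hb (fun ξ => -‖ξ‖) continuous_norm.neg)]
  rw [← integral_add (hb _ continuous_norm) (hb (fun ξ => -‖ξ‖) continuous_norm.neg)]
  rw [show (1 / 2 : ℝ) * (∫ ξ : Space d, (Real.fourierChar (⟪ξ, x⟫ + ‖ξ‖ * t) •
        𝓕 (fun y => (g y : ℂ)) ξ + Real.fourierChar (⟪ξ, x⟫ + -‖ξ‖ * t) •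
        𝓕 (fun y => (g y : ℂ)) ξ)).re = (((1 / 2 : ℝ) : ℂ) * (∫ ξ : Space d,
        (Real.fourierChar (⟪ξ, x⟫ + ‖ξ‖ * t) •
        𝓕 (fun y => (g y : ℂ)) ξ + Real.fourierChar (⟪ξ, x⟫ + -‖ξ‖ * t) •
        𝓕 (fun y => (g y : ℂ)) ξ))).re from (Complex.re_ofReal_mul _ _).symm]
  rw [← integral_const_mul]
  congr 2
  funext ξ
  simp only [Circle.smul_def, Real.fourierChar_apply, smul_eq_mul, Complex.ofReal_cos, Complex.cos]
  push_cast
  rw [show (2 * (Real.pi : ℂ) * (((⟪ξ, x⟫ : ℝ) : ℂ) + ‖ξ‖ * t) * Complex.I)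
      = 2 * Real.pi * (t * ‖ξ‖) * Complex.I + 2 * Real.pi * ((⟪ξ, x⟫ : ℝ) : ℂ) * Complex.I by ring,
    show (2 * (Real.pi : ℂ) * (((⟪ξ, x⟫ : ℝ) : ℂ) + -‖ξ‖ * t) * Complex.I)
      = -(2 * Real.pi * (t * ‖ξ‖)) * Complex.I + 2 * Real.pi * ((⟪ξ, x⟫ : ℝ) : ℂ) * Complex.I by
      ring,
    Complex.exp_add, Complex.exp_add]
  ring

theorem fourierWave_neg {g : Space d → ℝ} (hg : ContDiff ℝ ∞ g)
    (hc : HasCompactSupport g) (x : Space d) (t : ℝ) :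
    fourierWave g (x, -t) = fourierWave g (x, t) := by
  rw [fourierWave_eq hg hc, fourierWave_eq hg hc]
  simp [Real.cos_neg]

theorem fourierInv_fourier_ofReal {g : Space d → ℝ} (hg : ContDiff ℝ ∞ g)
    (hc : HasCompactSupport g) (x : Space d) :
    ∫ ξ, Real.fourierChar ⟪ξ, x⟫ • 𝓕 (fun y => (g y : ℂ)) ξ = g x := by
  have h := Continuous.fourierInv_fourier_eq (f := fun y => (g y : ℂ))
    (contDiff_ofReal_comp hg).continuous
    ((contDiff_ofReal_comp hg).continuous.integrable_of_hasCompactSupport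
      (hc.comp_left Complex.ofReal_zero)) (integrable_fourier_ofReal hg hc)
  rw [← Real.fourierInv_eq]
  exact congrFun h x

theorem fourierWave_zero {g : Space d → ℝ} (hg : ContDiff ℝ ∞ g)
    (hc : HasCompactSupport g) (x : Space d) : fourierWave g (x, 0) = g x := by
  rw [fourierWave_eq hg hc]
  simp [fourierInv_fourier_ofReal hg hc]

theorem isWaveSolution_fourierWave {g : Space d → ℝ} (hg : ContDiff ℝ ∞ g)
    (hc : HasCompactSupport g) : IsWaveSolution g fun x t => fourierWave g (x, t) :=
  isWaveSolution_of_even ((contDiff_fourierWave hg hc).of_le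
    (mod_cast le_top : ((2 : ℕ∞) : ℕ∞ω) ≤ ∞))
    (fourierWave_neg hg hc) (boxForm_fourierWave hg hc) (fourierWave_zero hg hc)

end FourierSolution

/-! ### Smooth truncation -/

section Cutoff

variable {d : ℕ}

/-- A fixed smooth mollifier: nonnegative, supported in the unit ball, of integral `1`. -/
def mollifier (d : ℕ) : Space d → ℝ :=
  (⟨1 / 2, 1, by norm_num, by norm_num⟩ : ContDiffBump (0 : Space d)).normed volume

theorem contDiff_mollifier : ContDiff ℝ ∞ (mollifier d) := ContDiffBump.contDiff_normed _

theorem hasCompactSupport_mollifier : HasCompactSupport (mollifier d) :=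
  ContDiffBump.hasCompactSupport_normed _

theorem mollifier_eq_zero {y : Space d} (hy : 1 ≤ ‖y‖) : mollifier d y = 0 := by
  have h := ContDiffBump.support_normed_eq (μ := volume)
    (⟨1 / 2, 1, by norm_num, by norm_num⟩ : ContDiffBump (0 : Space d))
  by_contra hne
  have : y ∈ Function.support (mollifier d) := hne
  rw [mollifier, h, mem_ball_zero_iff] at this
  exact absurd this (not_lt.2 hy)

theorem integral_mollifier : ∫ y, mollifier d y = 1 := ContDiffBump.integral_normed _

/-- The indicator function of the ball of radius `R + 1`, mollified at unit scale. Its derivatives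
are bounded uniformly in `R`. -/
def cutoff (d : ℕ) (R : ℝ) (y : Space d) : ℝ :=
  ∫ a, (Metric.closedBall (0 : Space d) (R + 1)).indicator 1 a * mollifier d (y - a)

/-- A bound, uniform in `R`, for the derivatives of order `k` of `cutoff d R`. -/
def cutoffConst (d k : ℕ) : ℝ := ∫ y, ‖iteratedFDeriv ℝ k (mollifier d) y‖

theorem cutoff_taylor (d : ℕ) (R : ℝ) :
    HasFTaylorSeriesUpTo ∞ (cutoff d R) (fun y k => ∫ a,
      (Metric.closedBall (0 : Space d) (R + 1)).indicator (1 : Space d → ℝ) a •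
        iteratedFDeriv ℝ k (mollifier d) (y - a)) := by
  have hball : Integrable ((Metric.closedBall (0 : Space d) (R + 1)).indicator (1 : Space d → ℝ)) :=
    (integrable_indicator_iff measurableSet_closedBall).2
      (integrableOn_const (isCompact_closedBall _ _).measure_lt_top.ne)
  refine hasFTaylorSeriesUpTo_integral_translate (n := ⊤) (j := id) contDiff_mollifier
    hball.aestronglyMeasurable aestronglyMeasurable_id fun k _ z₀ => ?_
  obtain ⟨M, hM⟩ := (contDiff_mollifier (d := d)).continuous_iteratedFDeriv (m := k)
    (by exact_mod_cast le_top) |>.bounded_above_of_compact_support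
      (hasCompactSupport_mollifier.iteratedFDeriv k)
  exact ⟨_, hball.norm.mul_const M, fun a z _ => by gcongr; exact hM _⟩

theorem contDiff_cutoff (R : ℝ) : ContDiff ℝ ∞ (cutoff d R) :=
  (cutoff_taylor d R).contDiff

theorem norm_iteratedFDeriv_cutoff_le (R : ℝ) (k : ℕ) (y : Space d) :
    ‖iteratedFDeriv ℝ k (cutoff d R) y‖ ≤ cutoffConst d k := by
  rw [← (cutoff_taylor d R).eq_iteratedFDeriv (by exact_mod_cast le_top) y, cutoffConst,
    ← integral_sub_left_eq_self (fun a => ‖iteratedFDeriv ℝ k (mollifier d) a‖) volume y]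
  refine norm_integral_le_of_norm_le
    ((integrable_norm_iteratedFDeriv contDiff_mollifier hasCompactSupport_mollifier k).comp_sub_left
      y) (ae_of_all _ fun a => ?_)
  rw [norm_smul]
  refine mul_le_of_le_one_left (norm_nonneg _) ?_
  by_cases ha : a ∈ Metric.closedBall (0 : Space d) (R + 1) <;> simp [ha]

theorem cutoff_eq_one {R : ℝ} {y : Space d} (hy : ‖y‖ ≤ R) : cutoff d R y = 1 := by
  refine Eq.trans (b := ∫ a, mollifier d (y - a)) ?_
    ((integral_sub_left_eq_self (mollifier d) volume y).trans integral_mollifier)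
  refine integral_congr_ae (ae_of_all _ fun a => ?_)
  by_cases ha : a ∈ Metric.closedBall (0 : Space d) (R + 1)
  · simp [ha]
  · rw [mem_closedBall_zero_iff, not_le] at ha
    have : 1 ≤ ‖y - a‖ := by
      have := norm_sub_norm_le a y
      rw [norm_sub_rev] at this
      linarith
    simp [mollifier_eq_zero this]

theorem cutoff_eq_zero {R : ℝ} {y : Space d} (hy : R + 2 ≤ ‖y‖) : cutoff d R y = 0 := by
  rw [cutoff]
  refine integral_eq_zero_of_ae (ae_of_all _ fun a => ?_)
  by_cases ha : a ∈ Metric.closedBall (0 : Space d) (R + 1)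
  · rw [mem_closedBall_zero_iff] at ha
    have : 1 ≤ ‖y - a‖ := by
      have := norm_sub_norm_le y a
      linarith
    simp [mollifier_eq_zero this]
  · simp [ha]

/-- The function `f`, cut off smoothly between the balls of radius `R` and `R + 2` about `x`. -/
def truncate (f : Space d → ℝ) (x : Space d) (R : ℝ) (y : Space d) : ℝ := cutoff d R (y - x) * f y

theorem contDiff_truncate {f : Space d → ℝ} (hf : ContDiff ℝ ∞ f) (x : Space d) (R : ℝ) :
    ContDiff ℝ ∞ (truncate f x R) :=
  ((contDiff_cutoff R).comp (contDiff_id.sub contDiff_const)).mul hf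

theorem truncate_eq {f : Space d → ℝ} {x y : Space d} {R : ℝ} (hy : dist y x ≤ R) :
    truncate f x R y = f y := by
  rw [truncate, cutoff_eq_one (by rwa [← dist_eq_norm]), one_mul]

theorem truncate_eq_zero {f : Space d → ℝ} {x y : Space d} {R : ℝ}
    (hy : y ∉ Metric.closedBall x (R + 2)) : truncate f x R y = 0 := by
  rw [Metric.mem_closedBall, not_le, dist_eq_norm] at hy
  rw [truncate, cutoff_eq_zero hy.le, zero_mul]

theorem hasCompactSupport_truncate (f : Space d → ℝ) (x : Space d) (R : ℝ) :
    HasCompactSupport (truncate f x R) :=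
  HasCompactSupport.intro (isCompact_closedBall x (R + 2)) fun _ hy => truncate_eq_zero hy

theorem iteratedFDeriv_truncate_eq_zero {f : Space d → ℝ} {x y : Space d} {R : ℝ} (k : ℕ)
    (hy : y ∉ Metric.closedBall x (R + 2)) : iteratedFDeriv ℝ k (truncate f x R) y = 0 := by
  have h1 : truncate f x R =ᶠ[𝓝 y] fun _ => 0 := by
    filter_upwards [Metric.isClosed_closedBall.isOpen_compl.mem_nhds hy] with y' hy'
    exact truncate_eq_zero hy'
  rw [(h1.iteratedFDeriv ℝ k).eq_of_nhds]
  exact congrFun (iteratedFDeriv_fun_zero (𝕜 := ℝ) (E := Space d) (F := ℝ) (n := k)) y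

/-- A bound for the derivatives of order `k` of a cut-off function in terms of those of the
function. -/
def truncateConst (d k : ℕ) : ℝ :=
  ∑ i ∈ Finset.range (k + 1), (k.choose i : ℝ) * cutoffConst d i

theorem cutoffConst_nonneg (d k : ℕ) : 0 ≤ cutoffConst d k := integral_nonneg fun _ => norm_nonneg _

theorem truncateConst_nonneg (d k : ℕ) : 0 ≤ truncateConst d k :=
  Finset.sum_nonneg fun i _ => mul_nonneg (Nat.cast_nonneg _) (cutoffConst_nonneg d i)

theorem norm_iteratedFDeriv_truncate_le {f : Space d → ℝ} (hf : ContDiff ℝ ∞ f) (x : Space d)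
    (R : ℝ) {k : ℕ} {y : Space d} {B : ℝ} (hB : ∀ i ≤ k, ‖iteratedFDeriv ℝ i f y‖ ≤ B) :
    ‖iteratedFDeriv ℝ k (truncate f x R) y‖ ≤ truncateConst d k * B := by
  refine (norm_iteratedFDeriv_mul_le (N := ∞)
    ((contDiff_cutoff R).comp (contDiff_id.sub contDiff_const)) hf y
    (by exact_mod_cast le_top)).trans ?_
  rw [truncateConst, Finset.sum_mul]
  refine Finset.sum_le_sum fun i hi => ?_
  have h1 : iteratedFDeriv ℝ i (fun y => cutoff d R (y - x)) y =
      iteratedFDeriv ℝ i (cutoff d R) (y - x) :=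
    iteratedFDeriv_comp_sub i x y
  have h2 : ‖iteratedFDeriv ℝ i (fun y => cutoff d R (y - x)) y‖ ≤ cutoffConst d i :=
    h1 ▸ norm_iteratedFDeriv_cutoff_le R i _
  have h3 := hB (k - i) (by omega)
  have := cutoffConst_nonneg d i
  exact mul_le_mul (mul_le_mul_of_nonneg_left h2 (Nat.cast_nonneg _)) h3 (norm_nonneg _)
    (by positivity)

/-- The `L¹` norms of the derivatives of a truncation, bounded by the volume of its support. -/
theorem sobolevSum_truncate_le {f : Space d → ℝ} (hf : ContDiff ℝ ∞ f) (x : Space d)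
    {R : ℝ} (hR : 0 ≤ R) {N : ℕ} {B : ℝ}
    (hB : ∀ i ≤ N, ∀ y ∈ Metric.closedBall x (R + 2), ‖iteratedFDeriv ℝ i f y‖ ≤ B) :
    sobolevSum N (truncate f x R) ≤ (∑ k ∈ Finset.range (N + 1), truncateConst d k) *
      volume.real (Metric.ball (0 : Space d) 1) * (R + 2) ^ d * B := by
  rw [sobolevSum, Finset.sum_mul, Finset.sum_mul, Finset.sum_mul]
  refine Finset.sum_le_sum fun k hk => ?_
  have hk' : k ≤ N := by simpa [Nat.lt_succ_iff] using hk
  rw [← setIntegral_eq_integral_of_forall_compl_eq_zero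
    (s := Metric.closedBall x (R + 2)) fun y hy => by
      rw [iteratedFDeriv_truncate_eq_zero k hy, norm_zero]]
  have h1 : ∀ y ∈ Metric.closedBall x (R + 2), ‖‖iteratedFDeriv ℝ k (truncate f x R) y‖‖ ≤
      truncateConst d k * B := fun y hy => by
    rw [norm_norm]
    exact norm_iteratedFDeriv_truncate_le hf x R fun i hi => hB i (hi.trans hk') y hy
  have h2 := norm_setIntegral_le_of_norm_le_const (μ := volume)
    (isCompact_closedBall x (R + 2)).measure_lt_top h1
  refine (le_abs_self _).trans (h2.trans_eq ?_)
  rw [Measure.real, Measure.addHaar_closedBall _ _ (by linarith), ENNReal.toReal_mul,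
    ENNReal.toReal_ofReal (by positivity), Measure.real]
  simp
  ring

end Cutoff

/-! ### Solutions for general smooth data -/

section SmoothWave

variable {d : ℕ}

/-- The solution of the wave equation with smooth initial data `f` and vanishing initial velocity:
by finite speed of propagation it may be computed from a truncation of `f`. -/
def smoothWave (f : Space d → ℝ) (z : Space d × ℝ) : ℝ :=
  fourierWave (truncate f 0 (‖z.1‖ + |z.2| + 1)) z

theorem fourierWave_eq_of_eqOn {g h : Space d → ℝ} (hg : ContDiff ℝ ∞ g) (hgc : HasCompactSupport g)
    (hh : ContDiff ℝ ∞ h) (hhc : HasCompactSupport h) {x : Space d} {t R : ℝ}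
    (hgh : EqOn g h (Metric.ball x R)) (htR : |t| < R) :
    fourierWave g (x, t) = fourierWave h (x, t) := by
  have key := (isWaveSolution_fourierWave hg hgc).eq_of_eqOn_ball
    (isWaveSolution_fourierWave hh hhc) hgh (abs_nonneg t) htR
  rcases abs_choice t with ht | ht
  · rwa [ht] at key
  · rwa [ht, fourierWave_neg hg hgc, fourierWave_neg hh hhc] at key

theorem smoothWave_eq_of_eqOn {f g : Space d → ℝ} (hf : ContDiff ℝ ∞ f) (hg : ContDiff ℝ ∞ g)
    (hgc : HasCompactSupport g) {x : Space d} {t R : ℝ} (hfg : EqOn f g (Metric.ball x R))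
    (htR : |t| < R) : smoothWave f (x, t) = fourierWave g (x, t) := by
  refine fourierWave_eq_of_eqOn (R := min R (|t| + 1)) (contDiff_truncate hf _ _)
    (hasCompactSupport_truncate _ _ _) hg hgc (fun y hy => ?_) (lt_min htR (lt_add_one _))
  rw [Metric.mem_ball, lt_min_iff] at hy
  rw [truncate_eq, hfg (Metric.mem_ball.2 hy.1)]
  have := norm_le_norm_add_norm_sub' y x
  rw [dist_zero_right]
  rw [dist_eq_norm] at hy
  dsimp only
  linarith

/-- Locally, a single truncation of the data determines `smoothWave f`. -/
theorem smoothWave_eventuallyEq {f : Space d → ℝ} (hf : ContDiff ℝ ∞ f) {z : Space d × ℝ} {R : ℝ}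
    (hR : |z.2| < R) : smoothWave f =ᶠ[𝓝 z] fourierWave (truncate f z.1 R) := by
  have hcont : Continuous fun z' : Space d × ℝ => R - dist z'.1 z.1 - |z'.2| := by fun_prop
  have hev : ∀ᶠ z' in 𝓝 z, 0 < R - dist z'.1 z.1 - |z'.2| :=
    hcont.continuousAt.eventually (lt_mem_nhds (by simpa using hR))
  filter_upwards [hev] with z' hz'
  refine smoothWave_eq_of_eqOn (x := z'.1) (t := z'.2) (R := R - dist z'.1 z.1) hf
    (contDiff_truncate hf _ _) (hasCompactSupport_truncate _ _ _) (fun y hy => ?_) (by linarith)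
  rw [Metric.mem_ball] at hy
  exact (truncate_eq (by linarith [dist_triangle y z'.1 z.1])).symm

theorem contDiff_smoothWave {f : Space d → ℝ} (hf : ContDiff ℝ ∞ f) : ContDiff ℝ ∞ (smoothWave f) :=
  contDiff_iff_contDiffAt.2 fun z =>
    (contDiff_fourierWave (contDiff_truncate hf _ _)
      (hasCompactSupport_truncate _ _ _)).contDiffAt.congr_of_eventuallyEq
      (smoothWave_eventuallyEq hf (lt_add_one |z.2|))

theorem iteratedFDeriv_smoothWave {f : Space d → ℝ} (hf : ContDiff ℝ ∞ f) (n : ℕ)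
    (z : Space d × ℝ) : iteratedFDeriv ℝ n (smoothWave f) z =
      iteratedFDeriv ℝ n (fourierWave (truncate f z.1 (|z.2| + 1))) z :=
  ((smoothWave_eventuallyEq hf (lt_add_one |z.2|)).iteratedFDeriv ℝ n).eq_of_nhds

theorem boxForm_smoothWave {f : Space d → ℝ} (hf : ContDiff ℝ ∞ f) (z : Space d × ℝ) :
    boxForm d (iteratedFDeriv ℝ 2 (smoothWave f) z) = 0 := by
  rw [iteratedFDeriv_smoothWave hf]
  exact boxForm_fourierWave (contDiff_truncate hf _ _) (hasCompactSupport_truncate _ _ _) z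

theorem smoothWave_neg {f : Space d → ℝ} (hf : ContDiff ℝ ∞ f) (x : Space d) (t : ℝ) :
    smoothWave f (x, -t) = smoothWave f (x, t) := by
  simp only [smoothWave, abs_neg]
  exact fourierWave_neg (contDiff_truncate hf _ _) (hasCompactSupport_truncate _ _ _) x t

theorem isWaveSolution_smoothWave {f : Space d → ℝ} (hf : ContDiff ℝ ∞ f) :
    IsWaveSolution f fun x t => smoothWave f (x, t) := by
  refine isWaveSolution_of_even ((contDiff_smoothWave hf).of_le
    (mod_cast le_top : ((2 : ℕ∞) : ℕ∞ω) ≤ ∞)) (smoothWave_neg hf) (boxForm_smoothWave hf)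
    fun x => ?_
  rw [smoothWave, fourierWave_zero (contDiff_truncate hf _ _) (hasCompactSupport_truncate _ _ _),
    truncate_eq]
  rw [dist_zero_right]
  simp only [abs_zero]
  linarith

/-- Constant in the growth estimate for the derivatives of order `n` of solutions. -/
def growthConst (d n : ℕ) : ℝ :=
  waveConst d n * ((∑ k ∈ Finset.range (n + (d + 1) + 1), truncateConst d k) *
    volume.real (Metric.ball (0 : Space d) 1)) * 3 ^ d

theorem waveConst_nonneg (d n : ℕ) : 0 ≤ waveConst d n := by
  have : 0 ≤ ∫ ξ : Space d, (1 + ‖ξ‖) ^ (-((d : ℝ) + 1)) :=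
    integral_nonneg fun ξ => by positivity
  unfold waveConst momentConst
  positivity

theorem growthConst_nonneg (d n : ℕ) : 0 ≤ growthConst d n := by
  have h1 := waveConst_nonneg d n
  have h2 : 0 ≤ ∑ k ∈ Finset.range (n + (d + 1) + 1), truncateConst d k :=
    Finset.sum_nonneg fun k _ => truncateConst_nonneg d k
  unfold growthConst
  positivity

/-- Growth of the solution: the factor `(1 + |t|)^d` comes from the volume of the domain of
dependence. -/
theorem norm_iteratedFDeriv_smoothWave_le {f : Space d → ℝ} (hf : ContDiff ℝ ∞ f) {w : ℝ → ℝ}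
    (hw : MonotoneOn w (Ici 0)) {n : ℕ} {A : ℝ} (hA : 0 ≤ A)
    (hfA : ∀ i ≤ n + (d + 1), ∀ y, ‖iteratedFDeriv ℝ i f y‖ ≤ A * w ‖y‖) (z : Space d × ℝ) :
    ‖iteratedFDeriv ℝ n (smoothWave f) z‖ ≤
      growthConst d n * A * ((1 + |z.2|) ^ d * w (‖z.1‖ + |z.2| + 3)) := by
  rw [iteratedFDeriv_smoothWave hf]
  have hB : ∀ i ≤ n + (d + 1), ∀ y ∈ Metric.closedBall z.1 (|z.2| + 1 + 2),
      ‖iteratedFDeriv ℝ i f y‖ ≤ A * w (‖z.1‖ + |z.2| + 3) := by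
    intro i hi y hy
    refine (hfA i hi y).trans (mul_le_mul_of_nonneg_left (hw (norm_nonneg y)
      (show (0 : ℝ) ≤ _ by positivity) ?_) hA)
    rw [Metric.mem_closedBall, dist_eq_norm] at hy
    linarith [norm_le_norm_add_norm_sub' y z.1]
  have hw0 : 0 ≤ A * w (‖z.1‖ + |z.2| + 3) :=
    (norm_nonneg _).trans (hB 0 (Nat.zero_le _) z.1 (Metric.mem_closedBall_self (by positivity)))
  have h1 := sobolevSum_truncate_le hf z.1 (R := |z.2| + 1) (by positivity) hB
  have h2 := norm_iteratedFDeriv_fourierWave_le (contDiff_truncate hf z.1 (|z.2| + 1))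
    (hasCompactSupport_truncate _ _ _) n z
  have h3 : 0 ≤ ∑ k ∈ Finset.range (n + (d + 1) + 1), truncateConst d k :=
    Finset.sum_nonneg fun k _ => truncateConst_nonneg d k
  have h4 : (|z.2| + 1 + 2) ^ d ≤ 3 ^ d * (1 + |z.2|) ^ d := by
    rw [← mul_pow]
    gcongr
    linarith [abs_nonneg z.2]
  refine h2.trans ((mul_le_mul_of_nonneg_left h1 (waveConst_nonneg d n)).trans ?_)
  have h5 := waveConst_nonneg d n
  calc waveConst d n * ((∑ k ∈ Finset.range (n + (d + 1) + 1), truncateConst d k) *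
        volume.real (Metric.ball (0 : Space d) 1) * (|z.2| + 1 + 2) ^ d *
        (A * w (‖z.1‖ + |z.2| + 3)))
      ≤ waveConst d n * ((∑ k ∈ Finset.range (n + (d + 1) + 1), truncateConst d k) *
        volume.real (Metric.ball (0 : Space d) 1) * (3 ^ d * (1 + |z.2|) ^ d) *
        (A * w (‖z.1‖ + |z.2| + 3))) := by gcongr
    _ = _ := by rw [growthConst]; ring

end SmoothWave

/-! ### Plane integrals and the Fourier slice theorem for radial functions -/

section Radial

open scoped FourierTransform RealInnerProductSpace

/-- The splitting of `ℝ^(n + m)` into orthogonal coordinate subspaces preserves volume. -/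
theorem measurePreserving_finAddEquivProd (n m : ℕ) :
    MeasurePreserving (EuclideanSpace.finAddEquivProd (𝕜 := ℝ) (n := n) (m := m)) := by
  have h1 := (LinearIsometryEquiv.piLpCongrLeft 2 ℝ ℝ
    (finSumFinEquiv (m := n) (n := m)).symm).measurePreserving
  have h2 := (PiLp.sumPiLpEquivProdLpPiLp (𝕜 := ℝ) 2
    (fun _ : Fin n ⊕ Fin m => ℝ)).measurePreserving
  have h3 := WithLp.volume_preserving_ofLp (Space n) (Space m)
  exact h3.comp (h2.comp h1)

theorem norm_sq_finAddEquivProd {n m : ℕ} (y : Space (n + m)) :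
    ‖(EuclideanSpace.finAddEquivProd (𝕜 := ℝ) (n := n) (m := m) y).1‖ ^ 2 +
      ‖(EuclideanSpace.finAddEquivProd (𝕜 := ℝ) (n := n) (m := m) y).2‖ ^ 2 = ‖y‖ ^ 2 := by
  have h1 := (LinearIsometryEquiv.piLpCongrLeft 2 ℝ ℝ
    (finSumFinEquiv (m := n) (n := m)).symm).norm_map y
  have h2 := (PiLp.sumPiLpEquivProdLpPiLp (𝕜 := ℝ) 2
    (fun _ : Fin n ⊕ Fin m => ℝ)).norm_map ((LinearIsometryEquiv.piLpCongrLeft 2 ℝ ℝ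
    (finSumFinEquiv (m := n) (n := m)).symm) y)
  rw [← h1, ← h2, WithLp.prod_norm_sq_eq_of_L2]
  rfl

/-- The integral of the radial function with profile `U` over an `m`-dimensional affine subspace at
distance `|t|` from the origin. -/
def planeIntegral (m : ℕ) (U : ℝ → ℝ) (t : ℝ) : ℝ := ∫ y : Space m, U √(t ^ 2 + ‖y‖ ^ 2)

/-- Absolute convergence of `planeIntegral m U t`. -/
def PlaneIntegrable (m : ℕ) (U : ℝ → ℝ) (t : ℝ) : Prop :=
  Integrable fun y : Space m => U √(t ^ 2 + ‖y‖ ^ 2)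

theorem planeIntegrable_zero_iff {m : ℕ} {U : ℝ → ℝ} :
    PlaneIntegrable m U 0 ↔ Integrable fun y : Space m => U ‖y‖ := by
  simp [PlaneIntegrable]

theorem planeIntegrable_add_iff {n m : ℕ} {U : ℝ → ℝ} {t : ℝ} : PlaneIntegrable (n + m) U t ↔
    Integrable (fun p : Space n × Space m => U √(t ^ 2 + ‖p.1‖ ^ 2 + ‖p.2‖ ^ 2))
      (volume.prod volume) := by
  have h := (measurePreserving_finAddEquivProd n m).integrable_comp_emb
    (EuclideanSpace.finAddEquivProd (𝕜 := ℝ) (n := n) (m := m)).toHomeomorph.measurableEmbedding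
    (g := fun p : Space n × Space m => U √(t ^ 2 + ‖p.1‖ ^ 2 + ‖p.2‖ ^ 2))
  rw [PlaneIntegrable, ← Measure.volume_eq_prod]
  simp only [Function.comp_def, add_assoc, norm_sq_finAddEquivProd] at h
  simpa only [add_assoc] using h

theorem sqrt_sq_add_sq (t : ℝ) {E : Type*} [NormedAddCommGroup E] (y : E) :
    √(t ^ 2 + ‖y‖ ^ 2) ^ 2 = t ^ 2 + ‖y‖ ^ 2 := Real.sq_sqrt (by positivity)

theorem PlaneIntegrable.ae {n m : ℕ} {U : ℝ → ℝ} {t : ℝ} (h : PlaneIntegrable (n + m) U t) :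
    ∀ᵐ y : Space n, PlaneIntegrable m U √(t ^ 2 + ‖y‖ ^ 2) := by
  filter_upwards [(planeIntegrable_add_iff.1 h).prod_right_ae] with y hy
  simpa only [PlaneIntegrable, sqrt_sq_add_sq] using hy

theorem PlaneIntegrable.planeIntegral {n m : ℕ} {U : ℝ → ℝ} {t : ℝ}
    (h : PlaneIntegrable (n + m) U t) : PlaneIntegrable n (planeIntegral m U) t := by
  simpa only [PlaneIntegrable, AcousticReciprocity.planeIntegral, sqrt_sq_add_sq] using
    (planeIntegrable_add_iff.1 h).integral_prod_left

theorem planeIntegral_planeIntegral {n m : ℕ} {U : ℝ → ℝ} {t : ℝ}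
    (h : PlaneIntegrable (n + m) U t) :
    planeIntegral n (planeIntegral m U) t = planeIntegral (n + m) U t := by
  have h1 := integral_prod _ (planeIntegrable_add_iff.1 h)
  have h2 := (measurePreserving_finAddEquivProd n m).integral_comp
    (EuclideanSpace.finAddEquivProd (𝕜 := ℝ) (n := n) (m := m)).toHomeomorph.measurableEmbedding
    (fun p : Space n × Space m => U √(t ^ 2 + ‖p.1‖ ^ 2 + ‖p.2‖ ^ 2))
  simp only [add_assoc, norm_sq_finAddEquivProd] at h1 h2
  simp only [planeIntegral, sqrt_sq_add_sq, add_assoc]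
  rw [h2]
  exact h1.symm

theorem sphereVolume_succ {m : ℕ} : sphereVolume (m + 1) = m *
    (volume : Measure (Space m)).real (Metric.ball 0 1) := by
  change (volume : Measure (Space m)).toSphere.real univ = _
  rw [Measure.toSphere_real_apply_univ, finrank_euclideanSpace, Fintype.card_fin]

theorem hasDerivAt_sqrt_sq_sub {t s : ℝ} (hs : |t| < s) :
    HasDerivAt (fun s => √(s ^ 2 - t ^ 2)) (s / √(s ^ 2 - t ^ 2)) s := by
  have hpos : 0 < s ^ 2 - t ^ 2 := by
    rw [sub_pos, ← sq_abs t]; exact pow_lt_pow_left₀ hs (abs_nonneg t) two_ne_zero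
  have := (((hasDerivAt_id s).pow 2).sub_const (t ^ 2)).sqrt hpos.ne'
  refine this.congr_deriv ?_
  simp
  field_simp

theorem image_sqrt_sq_sub (t : ℝ) : (fun s => √(s ^ 2 - t ^ 2)) '' Ioi |t| = Ioi 0 := by
  ext ρ
  constructor
  · rintro ⟨s, hs, rfl⟩
    refine Real.sqrt_pos.2 ?_
    rw [sub_pos, ← sq_abs t]; exact pow_lt_pow_left₀ hs (abs_nonneg t) two_ne_zero
  · intro hρ
    have hρ' : 0 < ρ := hρ
    refine ⟨√(t ^ 2 + ρ ^ 2), ?_, ?_⟩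
    · exact Real.lt_sqrt_of_sq_lt (by rw [sq_abs]; linarith [pow_pos hρ' 2])
    · dsimp only
      rw [Real.sq_sqrt (by positivity), add_sub_cancel_left, Real.sqrt_sq hρ'.le]

theorem injOn_sqrt_sq_sub (t : ℝ) : InjOn (fun s => √(s ^ 2 - t ^ 2)) (Ioi |t|) := by
  intro a ha b hb hab
  have hpos : ∀ s ∈ Ioi |t|, 0 < s ^ 2 - t ^ 2 := fun s hs => by
    rw [sub_pos, ← sq_abs t]; exact pow_lt_pow_left₀ hs (abs_nonneg t) two_ne_zero
  have h1 := (Real.sqrt_inj (hpos a ha).le (hpos b hb).le).1 hab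
  have ha0 : 0 ≤ a := (abs_nonneg t).trans (le_of_lt ha)
  have hb0 : 0 ≤ b := (abs_nonneg t).trans (le_of_lt hb)
  exact (pow_left_inj₀ ha0 hb0 two_ne_zero).1 (by linarith)

/-- The Jacobian of the substitution `ρ = √(s² - t²)`, which takes the radial variable `ρ` in a
hyperplane at distance `|t|` to the distance `s` from the origin. -/
theorem radonIntegrand_eq {n : ℕ} (U : ℝ → ℝ) {t s : ℝ} (hs : s ∈ Ioi |t|) :
    |s / √(s ^ 2 - t ^ 2)| • (√(s ^ 2 - t ^ 2) ^ n • U √(t ^ 2 + √(s ^ 2 - t ^ 2) ^ 2)) =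
      radonIntegrand (n + 1 + 1) U t s := by
  have hq : 0 < s ^ 2 - t ^ 2 := by
    rw [sub_pos, ← sq_abs t]; exact pow_lt_pow_left₀ hs (abs_nonneg t) two_ne_zero
  have hs0 : 0 ≤ s := (abs_nonneg t).trans (le_of_lt hs)
  rw [Real.sq_sqrt hq.le, add_sub_cancel, Real.sqrt_sq hs0, abs_of_nonneg (by positivity),
    radonIntegrand, smul_eq_mul, smul_eq_mul]
  have : √(s ^ 2 - t ^ 2) ^ n / √(s ^ 2 - t ^ 2)
      = (s ^ 2 - t ^ 2) ^ ((((n + 1 + 1 : ℕ) : ℝ) - 3) / 2) := by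
    rw [Real.sqrt_eq_rpow, ← Real.rpow_natCast, ← Real.rpow_mul hq.le, ← Real.rpow_sub hq]
    congr 1
    push_cast; ring
  rw [← this]
  ring

theorem planeIntegrable_iff {n : ℕ} {U : ℝ → ℝ} {t : ℝ} : PlaneIntegrable (n + 1) U t ↔
    IntegrableOn (radonIntegrand (n + 1 + 1) U t) (Ioi |t|) := by
  rw [PlaneIntegrable, integrable_fun_norm_addHaar (E := Space (n + 1)) volume
    (f := fun ρ => U √(t ^ 2 + ρ ^ 2)), finrank_euclideanSpace, Fintype.card_fin,
    Nat.add_sub_cancel, ← image_sqrt_sq_sub t,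
    integrableOn_image_iff_integrableOn_abs_deriv_smul measurableSet_Ioi
      (fun s hs => (hasDerivAt_sqrt_sq_sub hs).hasDerivWithinAt) (injOn_sqrt_sq_sub t)]
  exact integrableOn_congr_fun (fun s hs => radonIntegrand_eq U hs) measurableSet_Ioi

theorem planeIntegral_eq {n : ℕ} {U : ℝ → ℝ} {t : ℝ} : planeIntegral (n + 1) U t =
    sphereVolume (n + 1 + 1) * ∫ s in Ioi |t|, radonIntegrand (n + 1 + 1) U t s := by
  rw [planeIntegral, integral_fun_norm_addHaar (E := Space (n + 1)) volume
    (f := fun ρ => U √(t ^ 2 + ρ ^ 2)), finrank_euclideanSpace, Fintype.card_fin,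
    Nat.add_sub_cancel, ← image_sqrt_sq_sub t,
    integral_image_eq_integral_abs_deriv_smul measurableSet_Ioi
      (fun s hs => (hasDerivAt_sqrt_sq_sub hs).hasDerivWithinAt) (injOn_sqrt_sq_sub t),
    setIntegral_congr_fun measurableSet_Ioi fun s hs => radonIntegrand_eq U hs, sphereVolume_succ]
  simp
  ring

theorem planeIntegral_zero {U : ℝ → ℝ} {t : ℝ} : planeIntegral 0 U t = U |t| := by
  have : ∀ y : Space 0, y = 0 := fun y => Subsingleton.elim _ _
  have hvol : (volume : Measure (Space 0)) univ = 1 := by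
    have := (PiLp.volume_preserving_ofLp (Fin 0)).measure_preimage
      (s := univ) MeasurableSet.univ.nullMeasurableSet
    rw [preimage_univ] at this
    rw [this, volume_pi, Measure.pi_of_empty, Measure.dirac_apply_of_mem (mem_univ _)]
  simp [planeIntegral, this, Real.sqrt_sq_eq_abs, Measure.real, hvol]

/-- The Radon transform of a radial function is the integral over hyperplanes. -/
theorem radialRadon_eq_planeIntegral {m : ℕ} (U : ℝ → ℝ) (t : ℝ) :
    radialRadon (m + 1) U t = planeIntegral m U t := by
  rcases m with _ | n
  · simp [radialRadon, planeIntegral_zero]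
  · rw [planeIntegral_eq, radialRadon, if_neg (by omega)]

/-- **Fourier slice theorem** for radial functions: the Fourier transform of a radial function is
the one-dimensional Fourier transform of its hyperplane integrals. -/
theorem fourier_radial {m : ℕ} {φ : ℝ → ℝ} (hφ : Integrable fun y : Space (m + 1) => φ ‖y‖)
    (ξ : Space (m + 1)) : 𝓕 (fun y : Space (m + 1) => (φ ‖y‖ : ℂ)) ξ =
      ∫ t : ℝ, Real.fourierChar (-(t * ‖ξ‖)) • (planeIntegral m φ t : ℂ) := by
  set η : Space (m + 1) := EuclideanSpace.single (Fin.last m) ‖ξ‖ with hη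
  -- by rotation invariance the frequency may be taken on the last coordinate axis
  have hrot : 𝓕 (fun y : Space (m + 1) => (φ ‖y‖ : ℂ)) ξ
      = ∫ y : Space (m + 1), Real.fourierChar (-(y (Fin.last m) * ‖ξ‖)) • (φ ‖y‖ : ℂ) := by
    have hnorm : ‖ξ‖ = ‖η‖ := by simp [hη]
    set ρ := (ℝ ∙ (ξ - η))ᗮ.reflection
    have hρ : ρ ξ = η := Submodule.reflection_sub hnorm
    rw [Real.fourier_eq]
    refine Eq.trans ?_ (ρ.measurePreserving.integral_comp ρ.toHomeomorph.measurableEmbedding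
      fun y : Space (m + 1) => Real.fourierChar (-(y (Fin.last m) * ‖ξ‖)) • (φ ‖y‖ : ℂ))
    refine integral_congr_ae (ae_of_all _ fun y => ?_)
    have : ⟪y, ξ⟫ = (ρ y) (Fin.last m) * ‖ξ‖ := by
      rw [← ρ.inner_map_map, hρ, hη, EuclideanSpace.inner_single_right]
      simp [mul_comm]
    simp only [this, LinearIsometryEquiv.norm_map]
  have hone : ∀ b : Space 1, ‖b‖ ^ 2 = b 0 ^ 2 := fun b => by
    simp [EuclideanSpace.real_norm_sq_eq]
  have hlast : ∀ y : Space (m + 1),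
      (EuclideanSpace.finAddEquivProd (𝕜 := ℝ) (n := m) (m := 1) y).2 0 = y (Fin.last m) := by
    intro y
    rfl
  have hint : Integrable (fun p : Space m × Space 1 =>
      Real.fourierChar (-(p.2 0 * ‖ξ‖)) • (φ √((p.2 0) ^ 2 + ‖p.1‖ ^ 2) : ℂ))
      (volume.prod volume) := by
    have h1 := planeIntegrable_add_iff.1 (planeIntegrable_zero_iff.2 hφ)
    have h2 : Integrable (fun p : Space m × Space 1 => (φ √((p.2 0) ^ 2 + ‖p.1‖ ^ 2) : ℂ))
        (volume.prod volume) := by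
      have := h1.ofReal (𝕜 := ℂ)
      simpa [hone, add_comm] using this
    have hc : Continuous fun p : Space m × Space 1 => Real.fourierChar (-(p.2 0 * ‖ξ‖)) := by
      fun_prop
    refine h2.norm.mono' (hc.aestronglyMeasurable.smul h2.aestronglyMeasurable)
      (ae_of_all _ fun p => ?_)
    rw [Circle.norm_smul]
  have h2 := (measurePreserving_finAddEquivProd m 1).integral_comp
    (EuclideanSpace.finAddEquivProd (𝕜 := ℝ) (n := m) (m := 1)).toHomeomorph.measurableEmbedding
    (fun p : Space m × Space 1 =>
      Real.fourierChar (-(p.2 0 * ‖ξ‖)) • (φ √((p.2 0) ^ 2 + ‖p.1‖ ^ 2) : ℂ))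
  have hnorm : ∀ y : Space (m + 1),
      √(((EuclideanSpace.finAddEquivProd (𝕜 := ℝ) (n := m) (m := 1) y).2 0) ^ 2 +
        ‖(EuclideanSpace.finAddEquivProd (𝕜 := ℝ) (n := m) (m := 1) y).1‖ ^ 2) = ‖y‖ := by
    intro y
    rw [← hone, add_comm, norm_sq_finAddEquivProd, Real.sqrt_sq (norm_nonneg y)]
  simp only [hnorm] at h2
  simp only [hlast] at h2
  rw [hrot, h2, Measure.volume_eq_prod, integral_prod_symm _ hint]
  have h3 : ∀ b : Space 1, ∫ a : Space m,
      Real.fourierChar (-(b 0 * ‖ξ‖)) • (φ √((b 0) ^ 2 + ‖a‖ ^ 2) : ℂ) =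
      Real.fourierChar (-(b 0 * ‖ξ‖)) • (planeIntegral m φ (b 0) : ℂ) := by
    intro b
    have h : (planeIntegral m φ (b 0) : ℂ) = ∫ a : Space m, (φ √((b 0) ^ 2 + ‖a‖ ^ 2) : ℂ) :=
      integral_complex_ofReal.symm
    rw [h]
    exact integral_const_mul _ _
  simp only [h3]
  have hmp : MeasurePreserving (fun b : Space 1 => b 0) :=
    (volume_preserving_funUnique (Fin 1) ℝ).comp (PiLp.volume_preserving_ofLp (Fin 1))
  have hemb : MeasurableEmbedding (fun b : Space 1 => b 0) :=
    (MeasurableEquiv.funUnique (Fin 1) ℝ).measurableEmbedding.comp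
      (MeasurableEquiv.toLp 2 (Fin 1 → ℝ)).symm.measurableEmbedding
  exact hmp.integral_comp hemb
    (fun t => Real.fourierChar (-(t * ‖ξ‖)) • (planeIntegral m φ t : ℂ))

end Radial

/-! ### Inversion of the radial Radon transform -/

section Inversion

theorem contDiffOn_radialDeriv {n : ℕ} {v : ℝ → ℝ} (hv : ContDiffOn ℝ (n + 1 : ℕ) v (Ioi 0)) :
    ContDiffOn ℝ n (radialDeriv v) (Ioi 0) := by
  refine ContDiffOn.mul ?_ (hv.deriv_of_isOpen isOpen_Ioi (by norm_cast))
  exact contDiffOn_const.div (contDiffOn_const.mul contDiffOn_id) fun t ht =>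
    mul_ne_zero two_ne_zero (ne_of_gt ht)

theorem contDiffOn_radialDeriv_iterate {n j : ℕ} {v : ℝ → ℝ}
    (hv : ContDiffOn ℝ (n + j : ℕ) v (Ioi 0)) :
    ContDiffOn ℝ n (radialDeriv^[j] v) (Ioi 0) := by
  induction j generalizing n with
  | zero => simpa using hv
  | succ j ih =>
    rw [Function.iterate_succ_apply']
    exact contDiffOn_radialDeriv (ih (by rwa [show n + 1 + j = n + (j + 1) by omega]))

theorem contDiffOn_of_sqrt {k : ℕ} {v : ℝ → ℝ}
    (hv : ContDiffOn ℝ k (fun τ => v (√τ)) (Ici 0)) : ContDiffOn ℝ k v (Ioi 0) := by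
  have h : ContDiffOn ℝ k (fun t : ℝ => v √(t ^ 2)) (Ioi 0) :=
    hv.comp (f := fun t : ℝ => t ^ 2) (contDiff_id.pow 2).contDiffOn fun t _ => sq_nonneg t
  exact h.congr fun t ht => by rw [Real.sqrt_sq (le_of_lt ht)]

theorem continuous_of_sqrt {k : ℕ} {v : ℝ → ℝ} (heven : ∀ t, v (-t) = v t)
    (hv : ContDiffOn ℝ k (fun τ => v (√τ)) (Ici 0)) : Continuous v := by
  have h : Continuous fun t : ℝ => v √(t ^ 2) :=
    hv.continuousOn.comp_continuous (continuous_id.pow 2) fun t => sq_nonneg t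
  refine h.congr fun t => ?_
  rw [Real.sqrt_sq_eq_abs]
  rcases abs_choice t with h | h <;> rw [h]
  exact heven t

theorem hasDerivAt_radialDeriv_iterate {k i : ℕ} {v : ℝ → ℝ} (hv : ContDiffOn ℝ k v (Ioi 0))
    (hi : i < k) {s : ℝ} (hs : 0 < s) :
    HasDerivAt (radialDeriv^[i] v) (2 * s * radialDeriv^[i + 1] v s) s := by
  have h1 : ContDiffOn ℝ (1 : ℕ) (radialDeriv^[i] v) (Ioi 0) :=
    contDiffOn_radialDeriv_iterate (hv.of_le (by exact_mod_cast (by omega : 1 + i ≤ k)))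
  have h2 := (h1.contDiffAt (Ioi_mem_nhds hs)).differentiableAt (by simp)
  rw [Function.iterate_succ_apply', radialDeriv]
  refine h2.hasDerivAt.congr_deriv ?_
  field_simp

theorem continuousOn_radialDeriv_iterate {k : ℕ} {v : ℝ → ℝ} (hv : ContDiffOn ℝ k v (Ioi 0)) :
    ContinuousOn (radialDeriv^[k] v) (Ioi 0) :=
  (contDiffOn_radialDeriv_iterate (n := 0) (by simpa using hv)).continuousOn

/-- If `F_j` is eventually bounded below by a positive constant, so are its iterated primitives with
respect to `2 s ds`. -/
theorem eventually_pos_of_chain {F : ℕ → ℝ → ℝ} {j : ℕ}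
    (hF : ∀ i < j, ∀ s, 0 < s → HasDerivAt (F i) (2 * s * F (i + 1) s) s)
    (hj : ∃ c > 0, ∀ᶠ s in atTop, c ≤ F j s) : ∃ c > 0, ∀ᶠ s in atTop, c ≤ F 0 s := by
  induction j with
  | zero => exact hj
  | succ j ih =>
    refine ih (fun i hi => hF i (hi.trans (Nat.lt_succ_self j))) ?_
    obtain ⟨c, hc, hev⟩ := hj
    obtain ⟨a, ha⟩ := eventually_atTop.1 hev
    set b := max a 1
    have hb1 : 1 ≤ b := le_max_right _ _
    have hderiv : ∀ s ∈ Ici b, HasDerivAt (F j) (2 * s * F (j + 1) s) s := fun s hs =>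
      hF j (Nat.lt_succ_self j) s (by linarith [mem_Ici.1 hs])
    have hgrow : ∀ s ∈ Ici b, c * (s - b) ≤ F j s - F j b := by
      intro s hs
      refine (convex_Ici b).mul_sub_le_image_sub_of_le_deriv
        (fun u hu => (hderiv u hu).continuousAt.continuousWithinAt)
        (fun u hu => (hderiv u (interior_subset hu)).differentiableAt.differentiableWithinAt)
        (fun u hu => ?_) b self_mem_Ici s hs hs
      have hu' : b ≤ u := interior_subset hu
      rw [(hderiv u hu').deriv]
      have := ha u ((le_max_left _ _).trans hu')
      nlinarith
    refine ⟨1, one_pos, ?_⟩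
    filter_upwards [eventually_ge_atTop b, eventually_ge_atTop (b + (1 - F j b) / c)] with s hs hs'
    have h1 := hgrow s hs
    have h2 : 1 - F j b ≤ c * (s - b) := by
      have h3 : (1 - F j b) / c ≤ s - b := by linarith
      rw [div_le_iff₀ hc] at h3
      linarith
    linarith

/-- A function that stays away from zero at infinity is not integrable. -/
theorem not_integrableOn_of_eventually_ge {f : ℝ → ℝ} {c : ℝ} (hc : 0 < c)
    (h : ∀ᶠ s in atTop, c ≤ f s) : ¬IntegrableOn f (Ioi 0) := by
  intro hint
  obtain ⟨a, ha⟩ := eventually_atTop.1 h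
  have h1 : IntegrableOn f (Ioi (max a 0)) := hint.mono_set (Ioi_subset_Ioi (le_max_right _ _))
  have h2 : IntegrableOn (fun _ => c) (Ioi (max a 0)) := by
    refine h1.mono' aestronglyMeasurable_const ?_
    refine (ae_restrict_iff' measurableSet_Ioi).2 (ae_of_all _ fun s hs => ?_)
    rw [Real.norm_of_nonneg hc.le]
    exact ha s ((le_max_left _ _).trans (le_of_lt hs))
  rw [integrableOn_const_iff] at h2
  simp [hc.ne'] at h2

/-- A limit at infinity of an iterated derivative, with respect to `s²`, of an integrable
function can only be zero. -/
theorem tendsto_zero_of_chain {F : ℕ → ℝ → ℝ} {j : ℕ}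
    (hF : ∀ i < j, ∀ s, 0 < s → HasDerivAt (F i) (2 * s * F (i + 1) s) s)
    (hF0 : IntegrableOn (F 0) (Ioi 0)) {L : ℝ} (hL : Tendsto (F j) atTop (𝓝 L)) : L = 0 := by
  by_contra hne
  rcases lt_or_gt_of_ne hne with hneg | hpos
  · obtain ⟨c, hc, h⟩ := eventually_pos_of_chain (F := fun i s => -F i s) (j := j)
      (fun i hi s hs => (hF i hi s hs).neg.congr_deriv (by ring))
      ⟨-L / 2, by linarith, (hL.neg.eventually (lt_mem_nhds (show -L / 2 < -L by linarith))).mono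
        fun s hs => hs.le⟩
    exact not_integrableOn_of_eventually_ge hc h hF0.neg
  · obtain ⟨c, hc, h⟩ := eventually_pos_of_chain hF
      ⟨L / 2, by linarith, (hL.eventually (lt_mem_nhds (show L / 2 < L by linarith))).mono
        fun s hs => hs.le⟩
    exact not_integrableOn_of_eventually_ge hc h hF0

/-- The profile `(-1/π)^k ((1/(2t)) ∂_t)^k v`, which is the profile of `R♯ v` in dimension
`2 k + 1`. -/
def oddProfile (k : ℕ) (v : ℝ → ℝ) (r : ℝ) : ℝ :=
  (-1) ^ k / Real.pi ^ k * (radialDeriv^[k] v) r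

theorem sharpProfile_odd (k : ℕ) (v : ℝ → ℝ) : sharpProfile (2 * k + 1) v = oddProfile k v := by
  funext r
  have h : √(Real.pi ^ (2 * k)) = Real.pi ^ k := by
    rw [mul_comm, pow_mul, Real.sqrt_sq (by positivity)]
  rw [sharpProfile, if_pos ⟨k, rfl⟩, oddProfile]
  simp [h]

theorem sphereVolume_three : sphereVolume 3 = 2 * Real.pi := by
  rw [sphereVolume_succ (m := 2), Measure.real, EuclideanSpace.volume_ball_fin_two]
  simp [Real.pi_nonneg]

theorem sphereVolume_two : sphereVolume 2 = 2 := by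
  rw [sphereVolume_succ (m := 1), Measure.real, EuclideanSpace.volume_ball]
  have : Real.Gamma (1 / 2 + 1) = √Real.pi / 2 := by
    rw [Real.Gamma_add_one (by norm_num), Real.Gamma_one_half_eq]; ring
  have hpi : √Real.pi ≠ 0 := (Real.sqrt_pos.2 Real.pi_pos).ne'
  simp only [Fintype.card_fin, ENNReal.ofReal_one, pow_one, one_mul, Nat.cast_one, this]
  rw [ENNReal.toReal_ofReal (by positivity)]
  field_simp

theorem radonIntegrand_three (U : ℝ → ℝ) (r s : ℝ) : radonIntegrand 3 U r s = U s * s := by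
  simp [radonIntegrand]

/-- Integration over two-dimensional planes undoes one application of `-(1/π) (1/(2t)) ∂_t`. -/
theorem planeIntegral_two_oddProfile {k j : ℕ} {v : ℝ → ℝ} (hv : ContDiffOn ℝ k v (Ioi 0))
    (hv0 : IntegrableOn v (Ioi 0)) (hj : j < k) {r : ℝ} (hr : 0 ≤ r)
    (hcont : ContinuousWithinAt (radialDeriv^[j] v) (Ici r) r)
    (hint : PlaneIntegrable 2 (oddProfile (j + 1) v) r) :
    planeIntegral 2 (oddProfile (j + 1) v) r = oddProfile j v r := by
  set c : ℝ := (-1) ^ (j + 1) / Real.pi ^ (j + 1) with hc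
  have hc0 : c ≠ 0 := div_ne_zero (pow_ne_zero _ (by norm_num)) (pow_ne_zero _ Real.pi_ne_zero)
  have hi := planeIntegrable_iff.1 hint
  rw [abs_of_nonneg hr] at hi
  have hfun : radonIntegrand (1 + 1 + 1) (oddProfile (j + 1) v) r =
      fun s => c / 2 * (2 * s * radialDeriv^[j + 1] v s) := by
    funext s
    rw [show 1 + 1 + 1 = 3 from rfl, radonIntegrand_three, oddProfile]
    ring
  rw [hfun] at hi
  have hi' : IntegrableOn (fun s => 2 * s * radialDeriv^[j + 1] v s) (Ioi r) := by
    refine (hi.const_mul (2 / c)).congr (ae_of_all _ fun s => ?_)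
    field_simp
  have hderiv : ∀ s ∈ Ioi r, HasDerivAt (radialDeriv^[j] v) (2 * s * radialDeriv^[j + 1] v s) s :=
    fun s hs => hasDerivAt_radialDeriv_iterate hv hj (hr.trans_lt hs)
  have hlim := tendsto_limUnder_of_hasDerivAt_of_integrableOn_Ioi hderiv hi'
  have h0 := tendsto_zero_of_chain (F := fun i => radialDeriv^[i] v)
    (fun i hi s hs => hasDerivAt_radialDeriv_iterate hv (hi.trans hj) hs) hv0 hlim
  rw [h0] at hlim
  have hftc := integral_Ioi_of_hasDerivAt_of_tendsto hcont hderiv hi' hlim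
  rw [planeIntegral_eq (n := 1), abs_of_nonneg hr, hfun, integral_const_mul, hftc,
    show 1 + 1 + 1 = 3 from rfl, sphereVolume_three, oddProfile, hc]
  have := Real.pi_ne_zero
  field_simp
  ring

/-- Integration over planes of dimension `2 j` undoes all `j` derivatives, two dimensions at a
time. -/
theorem planeIntegral_oddProfile {k : ℕ} {v : ℝ → ℝ} (hv : ContDiffOn ℝ k v (Ioi 0))
    (hvc : Continuous v) (heven : ∀ t, v (-t) = v t) (hv0 : IntegrableOn v (Ioi 0)) {j : ℕ}
    (hj : j ≤ k) {t : ℝ} (hint : PlaneIntegrable (2 * j) (oddProfile j v) t) :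
    planeIntegral (2 * j) (oddProfile j v) t = v t := by
  induction j with
  | zero =>
    rw [Nat.mul_zero, planeIntegral_zero]
    rcases abs_choice t with h | h <;> simp [oddProfile, h, heven]
  | succ j ih =>
    have hint' : PlaneIntegrable (2 * j + 2) (oddProfile (j + 1) v) t := hint
    have hae : ∀ᵐ y : Space (2 * j), planeIntegral 2 (oddProfile (j + 1) v) √(t ^ 2 + ‖y‖ ^ 2)
        = oddProfile j v √(t ^ 2 + ‖y‖ ^ 2) := by
      have hcont : ∀ᵐ y : Space (2 * j), ContinuousWithinAt (radialDeriv^[j] v)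
          (Ici √(t ^ 2 + ‖y‖ ^ 2)) √(t ^ 2 + ‖y‖ ^ 2) := by
        rcases Nat.eq_zero_or_pos j with rfl | hj0
        · exact ae_of_all _ fun y => hvc.continuousWithinAt
        · -- for `j ≥ 1` the iterated derivative is regular only off the origin
          have : Nonempty (Fin (2 * j)) := ⟨⟨0, by omega⟩⟩
          have : ∀ᵐ y : Space (2 * j), y ≠ 0 := by
            simp [ae_iff]
          filter_upwards [this] with y hy
          have hpos : 0 < √(t ^ 2 + ‖y‖ ^ 2) := Real.sqrt_pos.2 (by
            have := norm_pos_iff.2 hy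
            positivity)
          exact (hasDerivAt_radialDeriv_iterate hv hj hpos).continuousAt.continuousWithinAt
      filter_upwards [hint'.ae, hcont] with y hy hyc
      exact planeIntegral_two_oddProfile hv hv0 hj (Real.sqrt_nonneg _) hyc hy
    have h1 : PlaneIntegrable (2 * j) (oddProfile j v) t :=
      hint'.planeIntegral.congr hae
    rw [← ih (by omega) h1]
    refine (planeIntegral_planeIntegral hint').symm.trans ?_
    exact integral_congr_ae hae

variable {d : ℕ} {w v : ℝ → ℝ}

/-- A function bounded by the weighted function in `SufficientDecay` is integrable. -/
theorem integrableOn_of_decay {u : ℝ → ℝ} {c a : ℝ} (hc : 0 ≤ c) (ha : 0 ≤ a)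
    (hw_pos : ∀ r, 0 ≤ r → 0 < w r) (hw : MonotoneOn w (Ici 0))
    (hu : IntegrableOn (fun t => (1 + t) ^ d * w (c + t) * u t) (Ioi 0)) {g : ℝ → ℝ}
    (hg : AEStronglyMeasurable g (volume.restrict (Ioi a))) {B : ℝ}
    (hgu : ∀ t ∈ Ioi a, |g t| ≤ B * (1 + t) ^ d * |u t|) : IntegrableOn g (Ioi a) := by
  have hu' : IntegrableOn (fun t => (1 + t) ^ d * w (c + t) * u t) (Ioi a) :=
    hu.mono_set (Ioi_subset_Ioi ha)
  refine (hu'.norm.const_mul (|B| / w c)).mono' hg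
    ((ae_restrict_iff' measurableSet_Ioi).2 (ae_of_all _ fun t ht => ?_))
  have ht0 : 0 ≤ t := ha.trans (le_of_lt ht)
  have hwc : w c ≤ w (c + t) := hw hc (show (0 : ℝ) ≤ c + t by positivity) (by linarith)
  have hwc0 := hw_pos c hc
  rw [Real.norm_eq_abs, Real.norm_eq_abs, abs_mul, abs_mul,
    abs_of_nonneg (show 0 ≤ (1 + t) ^ d by positivity),
    abs_of_pos (hwc0.trans_le hwc)]
  calc |g t| ≤ B * (1 + t) ^ d * |u t| := hgu t ht
    _ ≤ |B| * (1 + t) ^ d * |u t| := by gcongr; exact le_abs_self B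
    _ = |B| / w c * ((1 + t) ^ d * w c * |u t|) := by field_simp
    _ ≤ |B| / w c * ((1 + t) ^ d * w (c + t) * |u t|) := by gcongr

theorem integrableOn_filter (hw_pos : ∀ r, 0 ≤ r → 0 < w r) (hw : MonotoneOn w (Ici 0))
    (hvc : Continuous v) (hdec : SufficientDecay d w v) : IntegrableOn v (Ioi 0) := by
  refine integrableOn_of_decay le_rfl le_rfl hw_pos hw (hdec 0 le_rfl).1
    hvc.aestronglyMeasurable (B := 1) fun t ht => ?_
  have : 1 ≤ (1 + t) ^ d := one_le_pow₀ (by linarith [mem_Ioi.1 ht])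
  rw [one_mul]
  exact le_mul_of_one_le_left (abs_nonneg _) this

theorem planeIntegrable_oddProfile (hw_pos : ∀ r, 0 ≤ r → 0 < w r) (hw : MonotoneOn w (Ici 0))
    {k : ℕ} (hk : d / 2 = k) (hv : ContDiffOn ℝ k v (Ioi 0)) (hdec : SufficientDecay d w v)
    (t : ℝ) : PlaneIntegrable (2 * k) (oddProfile k v) t := by
  rcases Nat.eq_zero_or_pos k with rfl | hk0
  · have : ∀ y : Space (2 * 0), y = 0 := fun y => PiLp.ext fun i => i.elim0
    simp only [PlaneIntegrable, this]
    have : IsFiniteMeasure (volume : Measure (Space (2 * 0))) :=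
      ⟨(isCompact_closedBall (0 : Space (2 * 0)) 1).measure_lt_top.trans_le' (measure_mono
        fun y _ => by rw [this y]; simp)⟩
    exact integrable_const _
  · obtain ⟨n, rfl⟩ : ∃ n, k = n + 1 := ⟨k - 1, by omega⟩
    rw [show 2 * (n + 1) = 2 * n + 1 + 1 by ring, planeIntegrable_iff]
    have hexp : ∀ s, radonIntegrand (2 * n + 1 + 1 + 1) (oddProfile (n + 1) v) t s =
        oddProfile (n + 1) v s * (s ^ 2 - t ^ 2) ^ n * s := fun s => by
      rw [radonIntegrand, ← Real.rpow_natCast _ n]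
      congr 3
      push_cast; ring
    have hcont : ContinuousOn (oddProfile (n + 1) v) (Ioi 0) :=
      continuousOn_const.mul (continuousOn_radialDeriv_iterate hv)
    have hd := (hdec 0 le_rfl).2
    rw [hk] at hd
    refine integrableOn_of_decay le_rfl (abs_nonneg t) hw_pos hw hd ?_
      (B := |(-1) ^ (n + 1) / Real.pi ^ (n + 1)|) fun s hs => ?_
    · simp only [funext hexp]
      refine ContinuousOn.aestronglyMeasurable ?_ measurableSet_Ioi
      exact ((hcont.mono (Ioi_subset_Ioi (abs_nonneg t))).mul (by fun_prop)).mul continuousOn_id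
    · have hs0 : 0 < s := (abs_nonneg t).trans_lt hs
      have hq : 0 ≤ s ^ 2 - t ^ 2 := by
        rw [sub_nonneg, ← sq_abs t]; exact pow_le_pow_left₀ (abs_nonneg t) (le_of_lt hs) 2
      rw [hexp, abs_mul, abs_mul, oddProfile, abs_mul, abs_of_nonneg (pow_nonneg hq n),
        abs_of_pos hs0]
      have h1 : (s ^ 2 - t ^ 2) ^ n * s ≤ (1 + s) ^ d := by
        calc (s ^ 2 - t ^ 2) ^ n * s ≤ (s ^ 2) ^ n * s := by
              gcongr; linarith [sq_nonneg t]
          _ = s ^ (2 * n + 1) := by ring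
          _ ≤ (1 + s) ^ (2 * n + 1) := by gcongr; linarith
          _ ≤ (1 + s) ^ d := pow_le_pow_right₀ (by linarith) (by omega)
      calc _ = |(-1) ^ (n + 1) / Real.pi ^ (n + 1)| * ((s ^ 2 - t ^ 2) ^ n * s) *
            |radialDeriv^[n + 1] v s| := by ring
        _ ≤ _ := by gcongr

theorem radonIntegrand_two (U : ℝ → ℝ) {r s : ℝ} (hr : 0 ≤ r) (hs : r < s) :
    radonIntegrand 2 U r s = U s / √(s ^ 2 - r ^ 2) * s := by
  have hq : 0 < s ^ 2 - r ^ 2 := sub_pos.2 (pow_lt_pow_left₀ hs hr two_ne_zero)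
  rw [radonIntegrand, show ((2 : ℕ) : ℝ) - 3 = -1 by norm_num, div_eq_mul_inv (U s),
    Real.sqrt_eq_rpow, ← Real.rpow_neg hq.le]
  congr 3
  norm_num

/-- In even dimensions, `R♯ v` is a partial Radon transform of the corresponding function in the
next (odd) dimension. -/
theorem sharpProfile_even (k : ℕ) (v : ℝ → ℝ) {r : ℝ} (hr : 0 ≤ r) :
    sharpProfile (2 * k) v r = planeIntegral 1 (oddProfile k v) r := by
  rw [planeIntegral_eq (n := 0), abs_of_nonneg hr, show 0 + 1 + 1 = 2 from rfl, sphereVolume_two,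
    setIntegral_congr_fun measurableSet_Ioi fun s hs => radonIntegrand_two _ hr hs, sharpProfile,
    if_neg (by simp), Nat.mul_div_cancel_left _ two_pos]
  have h : √(Real.pi ^ (2 * k)) = Real.pi ^ k := by
    rw [mul_comm, pow_mul, Real.sqrt_sq (by positivity)]
  rw [h, mul_div_assoc, mul_assoc, ← integral_const_mul]
  congr 2
  funext s
  rw [oddProfile]
  ring

theorem integrableOn_abel (hw_pos : ∀ r, 0 ≤ r → 0 < w r) (hw : MonotoneOn w (Ici 0))
    {k : ℕ} (hdk : 2 * k = d) (hk0 : 0 < k) (hv : ContDiffOn ℝ k v (Ioi 0))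
    (hdec : SufficientDecay d w v) {r : ℝ} (hr : 0 ≤ r) :
    IntegrableOn (fun t => (radialDeriv^[k] v) t / √(t ^ 2 - r ^ 2) * t) (Ioi r) := by
  have hd := (hdec 0 le_rfl).2
  rw [← hdk, Nat.mul_div_cancel_left _ two_pos] at hd
  have hcont := continuousOn_radialDeriv_iterate hv
  have hq : ∀ t ∈ Ioi r, 0 < t ^ 2 - r ^ 2 := fun t ht =>
    sub_pos.2 (pow_lt_pow_left₀ ht hr two_ne_zero)
  have hmeas : ContinuousOn (fun t => (radialDeriv^[k] v) t / √(t ^ 2 - r ^ 2) * t) (Ioi r) :=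
    ((hcont.mono (Ioi_subset_Ioi hr)).div (by fun_prop)
      fun t ht => (Real.sqrt_pos.2 (hq t ht)).ne').mul continuousOn_id
  rcases hr.eq_or_lt with rfl | hr0
  · refine integrableOn_of_decay (B := 1) le_rfl le_rfl hw_pos hw hd
      (hmeas.aestronglyMeasurable measurableSet_Ioi) fun t ht => ?_
    have ht0 : 0 < t := ht
    have : 1 ≤ (1 + t) ^ (2 * k) := one_le_pow₀ (by linarith)
    rw [zero_pow two_ne_zero, sub_zero, Real.sqrt_sq ht0.le, div_mul_cancel₀ _ ht0.ne', one_mul]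
    exact le_mul_of_one_le_left (abs_nonneg _) this
  · rw [← Ioc_union_Ioi_eq_Ioi (show r ≤ r + 1 by linarith)]
    refine IntegrableOn.union ?_ ?_
    · -- near the endpoint the singular factor is the derivative of `√(t² - r²)`
      have h1 : IntegrableOn (fun t => t / √(t ^ 2 - r ^ 2)) (Ioc r (r + 1)) := by
        refine intervalIntegral.integrableOn_deriv_of_nonneg (g := fun t => √(t ^ 2 - r ^ 2))
          (by fun_prop) (fun t ht => hasDerivAt_sqrt_sq_sub (by rw [abs_of_pos hr0]; exact ht.1))
          fun t ht => ?_
        exact div_nonneg (hr.trans ht.1.le) (Real.sqrt_nonneg _)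
      have h2 := h1.mul_continuousOn_of_subset (hcont.mono fun t (ht : t ∈ Icc r (r + 1)) =>
        hr0.trans_le ht.1) measurableSet_Ioc isCompact_Icc Ioc_subset_Icc_self
      refine h2.congr (ae_of_all _ fun t => ?_)
      dsimp only
      ring
    · refine integrableOn_of_decay (B := 1) le_rfl (by linarith) hw_pos hw hd
        ((hmeas.mono (Ioi_subset_Ioi (by linarith))).aestronglyMeasurable measurableSet_Ioi)
        fun t ht => ?_
      have ht1 : r + 1 < t := ht
      have ht0 : 0 < t := by linarith
      have hqt := hq t (by linarith [mem_Ioi.1 ht] : r < t)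
      have h3 : 1 ≤ √(t ^ 2 - r ^ 2) := Real.one_le_sqrt.2 (by nlinarith)
      have h4 : t ≤ (1 + t) ^ (2 * k) :=
        (by linarith : t ≤ 1 + t).trans (le_self_pow₀ (by linarith) (by omega))
      rw [abs_mul, abs_div, abs_of_pos ht0, abs_of_pos (Real.sqrt_pos.2 hqt), one_mul]
      calc |radialDeriv^[k] v t| / √(t ^ 2 - r ^ 2) * t ≤ |radialDeriv^[k] v t| * t := by
            gcongr; exact div_le_self (abs_nonneg _) h3
        _ ≤ _ := by rw [mul_comm]; gcongr

/-- The hyperplane integrals of `R♯ v` converge absolutely and reproduce `v`. -/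
theorem planeIntegral_sharpProfile (hw_pos : ∀ r, 0 ≤ r → 0 < w r) (hw : MonotoneOn w (Ici 0))
    {m : ℕ} (heven : ∀ t, v (-t) = v t)
    (hv : ContDiffOn ℝ ((m + 1) / 2 : ℕ) (fun τ => v (√τ)) (Ici 0))
    (hdec : SufficientDecay (m + 1) w v) (t : ℝ) :
    PlaneIntegrable m (sharpProfile (m + 1) v) t ∧
      planeIntegral m (sharpProfile (m + 1) v) t = v t := by
  have hvc := continuous_of_sqrt heven hv
  have hv' := contDiffOn_of_sqrt hv
  have hv0 := integrableOn_filter hw_pos hw hvc hdec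
  rcases Nat.even_or_odd' m with ⟨k, rfl | rfl⟩
  · rw [show (2 * k + 1) / 2 = k by omega] at hv'
    have h1 := planeIntegrable_oddProfile hw_pos hw (by omega) hv' hdec t
    rw [sharpProfile_odd]
    exact ⟨h1, planeIntegral_oddProfile hv' hvc heven hv0 le_rfl h1⟩
  · rw [show (2 * k + 1 + 1) / 2 = k + 1 by omega] at hv'
    have h1 : PlaneIntegrable (2 * k + 1 + 1) (oddProfile (k + 1) v) t :=
      planeIntegrable_oddProfile hw_pos hw (by omega) hv' hdec t
    have h2 : ∀ y : Space (2 * k + 1), sharpProfile (2 * k + 1 + 1) v √(t ^ 2 + ‖y‖ ^ 2)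
        = planeIntegral 1 (oddProfile (k + 1) v) √(t ^ 2 + ‖y‖ ^ 2) := fun y =>
      sharpProfile_even (k + 1) v (Real.sqrt_nonneg _)
    constructor
    · simpa only [PlaneIntegrable, h2] using h1.planeIntegral
    · rw [planeIntegral]
      simp only [h2]
      exact (planeIntegral_planeIntegral h1).trans
        (planeIntegral_oddProfile hv' hvc heven hv0 le_rfl h1)

end Inversion

/-! ### Weighted integrability of the filter and of its dual -/

section Weights

variable {d : ℕ} {w v : ℝ → ℝ}

/-- Polar coordinates in dimension one. -/
theorem integrable_comp_abs_iff {f : ℝ → ℝ} :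
    Integrable (fun s => f |s|) ↔ IntegrableOn f (Ioi 0) := by
  simpa using integrable_fun_norm_addHaar (E := ℝ) volume (f := f)

theorem measurable_weight_norm (hw : MonotoneOn w (Ici 0)) {c : ℝ} (hc : 0 ≤ c) (n : ℕ) :
    Measurable fun y : Space n => w (c + ‖y‖) := by
  have h : Monotone fun r : ℝ => w (c + max r 0) := fun a b hab =>
    hw (show (0 : ℝ) ≤ _ by positivity) (show (0 : ℝ) ≤ _ by positivity) (by gcongr)
  simpa [Function.comp_def] using h.measurable.comp (measurable_norm (α := Space n))

theorem integrable_filter_weight (heven : ∀ t, v (-t) = v t) (hdec : SufficientDecay d w v)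
    {c : ℝ} (hc : 0 ≤ c) : Integrable fun s => (1 + |s|) ^ d * w (c + |s|) * v s := by
  refine (integrable_comp_abs_iff.2 (hdec c hc).1).congr (ae_of_all _ fun s => ?_)
  rcases abs_choice s with h | h <;> simp [h, heven]

theorem integrable_filter (hw_pos : ∀ r, 0 ≤ r → 0 < w r) (hw : MonotoneOn w (Ici 0))
    (heven : ∀ t, v (-t) = v t) (hvc : Continuous v) (hdec : SufficientDecay d w v) :
    Integrable v := by
  refine (integrable_comp_abs_iff.2 (integrableOn_filter hw_pos hw hvc hdec)).congr
    (ae_of_all _ fun s => ?_)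
  rcases abs_choice s with h | h <;> simp [h, heven]

theorem integrable_oddProfile_weight {k : ℕ} (hk : d / 2 = k) (hdec : SufficientDecay d w v)
    {c : ℝ} (hc : 0 ≤ c) :
    Integrable fun y : Space (2 * k + 1) => oddProfile k v ‖y‖ * w (c + ‖y‖) := by
  rw [integrable_fun_norm_addHaar (E := Space (2 * k + 1)) volume
    (f := fun r => oddProfile k v r * w (c + r)), finrank_euclideanSpace, Fintype.card_fin,
    Nat.add_sub_cancel]
  have h1 := (hdec c hc).2
  rw [hk] at h1
  have hcont : ContinuousOn (fun t : ℝ => t ^ (2 * k) / (1 + t) ^ d) (Ioi 0) :=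
    (by fun_prop : ContinuousOn (fun t : ℝ => t ^ (2 * k)) (Ioi 0)).div (by fun_prop) fun t ht => by
      have : 0 < t := ht
      positivity
  have h2 := (Integrable.bdd_mul h1 (c := 1) (hcont.aestronglyMeasurable measurableSet_Ioi)
    ((ae_restrict_iff' measurableSet_Ioi).2 (ae_of_all _ fun t ht => by
      have ht0 : 0 < t := ht
      rw [Real.norm_of_nonneg (by positivity), div_le_one (by positivity)]
      calc t ^ (2 * k) ≤ (1 + t) ^ (2 * k) := by gcongr; linarith
        _ ≤ (1 + t) ^ d := pow_le_pow_right₀ (by linarith) (by omega)))).const_mul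
        ((-1) ^ k / Real.pi ^ k)
  refine IntegrableOn.congr_fun h2 (fun t ht => ?_) measurableSet_Ioi
  have ht0 : 0 < t := ht
  simp only [oddProfile, smul_eq_mul]
  field_simp

/-- The weight is bounded below by `w 0`, so weighted integrability implies integrability. -/
theorem integrable_of_weight (hw_pos : ∀ r, 0 ≤ r → 0 < w r) (hw : MonotoneOn w (Ici 0)) {n : ℕ}
    {u : Space n → ℝ} (hu : Integrable fun y => u y * w (0 + ‖y‖)) : Integrable u := by
  have hpos : ∀ y : Space n, 0 < w (0 + ‖y‖) := fun y => hw_pos _ (by positivity)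
  refine (hu.mul_bdd (c := (w 0)⁻¹) (g := fun y => (w (0 + ‖y‖))⁻¹)
    (measurable_weight_norm hw le_rfl n).inv.aestronglyMeasurable
    (ae_of_all _ fun y => ?_)).congr (ae_of_all _ fun y => ?_)
  · rw [Real.norm_of_nonneg (inv_nonneg.2 (hpos y).le)]
    exact inv_anti₀ (hw_pos 0 le_rfl) (hw self_mem_Ici (show (0 : ℝ) ≤ _ by positivity)
      (by positivity))
  · have := (hpos y).ne'
    dsimp only
    field_simp

/-- The weighted integrability of `R♯ v`. In even dimensions it is inherited from the next
dimension, since the weight is monotone. -/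
theorem integrable_sharp_weight (hw_pos : ∀ r, 0 ≤ r → 0 < w r) (hw : MonotoneOn w (Ici 0))
    (hdec : SufficientDecay d w v) {c : ℝ} (hc : 0 ≤ c) :
    Integrable fun y : Space d => sharp d v y * w (c + ‖y‖) := by
  rcases Nat.even_or_odd' d with ⟨k, rfl | rfl⟩
  · set U := oddProfile k v with hU
    have hk : 2 * k / 2 = k := Nat.mul_div_cancel_left _ two_pos
    have hUw : PlaneIntegrable (2 * k + 1) (fun r => U r * w (c + r)) 0 :=
      planeIntegrable_zero_iff.2 (integrable_oddProfile_weight hk hdec hc)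
    have hU1 : PlaneIntegrable (2 * k + 1) U 0 := planeIntegrable_zero_iff.2
      (integrable_of_weight hw_pos hw (integrable_oddProfile_weight hk hdec le_rfl))
    have hs : ∀ y : Space (2 * k), sharp (2 * k) v y = planeIntegral 1 U ‖y‖ := fun y =>
      sharpProfile_even k v (norm_nonneg y)
    have hsm : AEStronglyMeasurable (sharp (2 * k) v) volume := by
      have := (planeIntegrable_zero_iff.1 hU1.planeIntegral).aestronglyMeasurable
      exact this.congr (ae_of_all _ fun y => (hs y).symm)
    have hUabs : PlaneIntegrable (2 * k + 1) (fun r => ‖U r * w (c + r)‖) 0 := hUw.norm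
    refine (planeIntegrable_zero_iff.1 hUabs.planeIntegral).mono'
      (hsm.mul (measurable_weight_norm hw hc _).aestronglyMeasurable) ?_
    filter_upwards [hUabs.ae] with y hy
    rw [zero_pow two_ne_zero, zero_add, Real.sqrt_sq (norm_nonneg y)] at hy
    rw [hs, planeIntegral, ← integral_mul_const]
    refine norm_integral_le_of_norm_le hy (ae_of_all _ fun z => ?_)
    have hr : ‖y‖ ≤ √(‖y‖ ^ 2 + ‖z‖ ^ 2) := Real.le_sqrt_of_sq_le (by linarith [sq_nonneg ‖z‖])
    dsimp only
    rw [norm_mul, norm_mul]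
    gcongr
    rw [Real.norm_of_nonneg (hw_pos _ (by positivity)).le,
      Real.norm_of_nonneg (hw_pos _ (by positivity)).le]
    exact hw (show (0 : ℝ) ≤ _ by positivity) (show (0 : ℝ) ≤ _ by positivity) (by gcongr)
  · simpa only [sharp, sharpProfile_odd] using
      integrable_oddProfile_weight (k := k) (by omega) hdec hc

theorem integrable_sharp (hw_pos : ∀ r, 0 ≤ r → 0 < w r) (hw : MonotoneOn w (Ici 0))
    (hdec : SufficientDecay d w v) : Integrable (sharp d v) :=
  integrable_of_weight hw_pos hw (integrable_sharp_weight hw_pos hw hdec le_rfl)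

theorem SmoothOfGrowth.exists_bound (hw_pos : ∀ r, 0 ≤ r → 0 < w r) {f : Space d → ℝ}
    (hf : SmoothOfGrowth w f) (N : ℕ) :
    ∃ A, 0 ≤ A ∧ ∀ i ≤ N, ∀ y, ‖iteratedFDeriv ℝ i f y‖ ≤ A * w ‖y‖ := by
  choose C hC using hf.growth
  refine ⟨∑ i ∈ Finset.range (N + 1), |C i|, Finset.sum_nonneg fun _ _ => abs_nonneg _,
    fun i hi y => (hC i y).trans ?_⟩
  have hw := hw_pos ‖y‖ (norm_nonneg y)
  gcongr
  exact (le_abs_self _).trans (Finset.single_le_sum (f := fun i => |C i|)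
    (fun _ _ => abs_nonneg _) (Finset.mem_range.2 (Nat.lt_succ_of_le hi)))

theorem spaceConv_apply (u f : Space d → ℝ) (x : Space d) :
    spaceConv u f x = ∫ y, u y * f (x - y) := rfl

/-- Domination of the derivatives of `z ↦ u(y) f(z - y)`, locally uniformly in `z`. -/
theorem SmoothOfGrowth.dominated (hw_pos : ∀ r, 0 ≤ r → 0 < w r) (hw : MonotoneOn w (Ici 0))
    {f : Space d → ℝ} (hf : SmoothOfGrowth w f) {u : Space d → ℝ}
    (hu : ∀ c, 0 ≤ c → Integrable fun y => u y * w (c + ‖y‖)) (k : ℕ) (z₀ : Space d) :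
    ∃ b : Space d → ℝ, Integrable b ∧
      ∀ y, ∀ z ∈ Metric.ball z₀ 1, ‖u y‖ * ‖iteratedFDeriv ℝ k f (z - y)‖ ≤ b y := by
  obtain ⟨A, hA, hfA⟩ := hf.exists_bound hw_pos k
  have hc : 0 ≤ ‖z₀‖ + 1 := by positivity
  refine ⟨_, ((hu _ hc).norm.const_mul A), fun y z hz => ?_⟩
  rw [norm_mul, Real.norm_of_nonneg (hw_pos _ (by positivity)).le]
  have h1 : ‖z - y‖ ≤ ‖z₀‖ + 1 + ‖y‖ := by
    rw [mem_ball_iff_norm] at hz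
    linarith [norm_sub_le z y, norm_le_norm_add_norm_sub' z z₀]
  have h2 := hw (norm_nonneg (z - y)) (show (0 : ℝ) ≤ _ by positivity) h1
  calc ‖u y‖ * ‖iteratedFDeriv ℝ k f (z - y)‖ ≤ ‖u y‖ * (A * w ‖z - y‖) := by
        gcongr; exact hfA k le_rfl _
    _ ≤ ‖u y‖ * (A * w (‖z₀‖ + 1 + ‖y‖)) := by gcongr
    _ = A * (‖u y‖ * w (‖z₀‖ + 1 + ‖y‖)) := by ring

theorem SmoothOfGrowth.integrable_mul_translate (hw_pos : ∀ r, 0 ≤ r → 0 < w r)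
    (hw : MonotoneOn w (Ici 0)) {f : Space d → ℝ} (hf : SmoothOfGrowth w f) {u : Space d → ℝ}
    (hu : ∀ c, 0 ≤ c → Integrable fun y => u y * w (c + ‖y‖)) (x : Space d) :
    Integrable fun y => u y * f (x - y) := by
  obtain ⟨b, hb, hbd⟩ := hf.dominated hw_pos hw hu 0 x
  refine hb.mono' ((integrable_of_weight hw_pos hw (hu 0 le_rfl)).aestronglyMeasurable.mul
    (hf.smooth.continuous.comp (continuous_const.sub continuous_id)).aestronglyMeasurable)
    (ae_of_all _ fun y => ?_)
  simpa [norm_iteratedFDeriv_zero] using hbd y x (Metric.mem_ball_self one_pos)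

theorem SmoothOfGrowth.contDiff_spaceConv (hw_pos : ∀ r, 0 ≤ r → 0 < w r)
    (hw : MonotoneOn w (Ici 0)) {f : Space d → ℝ} (hf : SmoothOfGrowth w f) {u : Space d → ℝ}
    (hu : ∀ c, 0 ≤ c → Integrable fun y => u y * w (c + ‖y‖)) :
    ContDiff ℝ ∞ (spaceConv u f) :=
  (hasFTaylorSeriesUpTo_integral_translate (n := ⊤) (j := id) hf.smooth
    (integrable_of_weight hw_pos hw (hu 0 le_rfl)).aestronglyMeasurable aestronglyMeasurable_id
    fun k _ z₀ => hf.dominated hw_pos hw hu k z₀).contDiff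

end Weights

/-! ### The reciprocal principle for compactly supported data -/

section Reciprocity

open scoped FourierTransform RealInnerProductSpace

variable {m : ℕ} {v : ℝ → ℝ}

/-- For even `v` the cosine transform is the Fourier transform. -/
theorem integral_cos_mul (heven : ∀ t, v (-t) = v t) (hv : Integrable v) (a : ℝ) :
    ∫ s : ℝ, (v s : ℂ) * (Real.cos (2 * Real.pi * (s * a)) : ℂ) =
      ∫ t : ℝ, Real.fourierChar (-(t * a)) • (v t : ℂ) := by
  have hv' : Integrable fun t => (v t : ℂ) := hv.ofReal
  have hint : Integrable fun t : ℝ => Real.fourierChar (-(t * a)) • (v t : ℂ) :=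
    hv'.norm.mono' ((Real.continuous_fourierChar.comp
      (by fun_prop : Continuous fun t : ℝ => -(t * a))).aestronglyMeasurable.smul
      hv'.aestronglyMeasurable) (ae_of_all _ fun t => by rw [Circle.norm_smul])
  have hneg : ∫ t : ℝ, Real.fourierChar (t * a) • (v t : ℂ) =
      ∫ t : ℝ, Real.fourierChar (-(t * a)) • (v t : ℂ) := by
    rw [← integral_neg_eq_self fun t : ℝ => Real.fourierChar (t * a) • (v t : ℂ)]
    simp only [heven, neg_mul]
  have hint' : Integrable fun t : ℝ => Real.fourierChar (t * a) • (v t : ℂ) := by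
    simpa only [heven, neg_mul, neg_neg] using hint.comp_neg
  have hsum := integral_add hint' hint
  rw [hneg, ← two_mul] at hsum
  refine mul_left_cancel₀ (two_ne_zero' ℂ) (Eq.trans ?_ hsum)
  rw [← integral_const_mul]
  congr 1
  funext t
  simp only [Circle.smul_def, Real.fourierChar_apply, smul_eq_mul, Complex.ofReal_cos, Complex.cos]
  push_cast
  ring_nf

/-- The reciprocal principle for compactly supported data, from the Fourier slice theorem. -/
theorem integral_mul_fourierWave {φ : ℝ → ℝ} (hφ : Integrable fun y : Space (m + 1) => φ ‖y‖)
    (hv : Integrable v) (heven : ∀ t, v (-t) = v t) (hφv : ∀ t, planeIntegral m φ t = v t)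
    {g : Space (m + 1) → ℝ} (hg : ContDiff ℝ ∞ g) (hc : HasCompactSupport g) (x : Space (m + 1)) :
    ∫ s, v s * fourierWave g (x, s) = ∫ y, φ ‖y‖ * g (x - y) := by
  have hv' : Integrable fun t => (v t : ℂ) := hv.ofReal
  have hφ' : Integrable fun y : Space (m + 1) => (φ ‖y‖ : ℂ) := hφ.ofReal
  set G := 𝓕 (fun y => (g y : ℂ)) with hG
  have hGi : Integrable G := integrable_fourier_ofReal hg hc
  have hGc : Continuous G := continuous_fourier_ofReal hg hc
  -- by Fubini both sides become integrals over frequencies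
  have hleft : (∫ s, v s * fourierWave g (x, s)) = (∫ ξ,
      (∫ s : ℝ, (v s : ℂ) * (Real.cos (2 * Real.pi * (s * ‖ξ‖)) : ℂ)) *
        (Real.fourierChar ⟪ξ, x⟫ • G ξ)).re := by
    have hF : Integrable (fun p : ℝ × Space (m + 1) => (v p.1 : ℂ) *
        ((Real.cos (2 * Real.pi * (p.1 * ‖p.2‖)) : ℂ) * (Real.fourierChar ⟪p.2, x⟫ • G p.2)))
        (volume.prod volume) := by
      refine (hv'.mul_prod hGi).norm.mono' (hv'.aestronglyMeasurable.comp_fst.mul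
        (Continuous.aestronglyMeasurable ?_)) (ae_of_all _ fun p => ?_)
      · exact (Complex.continuous_ofReal.comp (by fun_prop)).mul
          ((Real.continuous_fourierChar.comp (by fun_prop)).smul (hGc.comp continuous_snd))
      · rw [norm_mul, norm_mul, Circle.norm_smul, norm_mul, Complex.norm_real (Real.cos _)]
        gcongr
        exact mul_le_of_le_one_left (norm_nonneg _) (Real.abs_cos_le_one _)
    have h1 : ∀ s, v s * fourierWave g (x, s) = (∫ ξ, (v s : ℂ) *
        ((Real.cos (2 * Real.pi * (s * ‖ξ‖)) : ℂ) * (Real.fourierChar ⟪ξ, x⟫ • G ξ))).re :=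
      fun s => by
        rw [fourierWave_eq hg hc, ← Complex.re_ofReal_mul]
        congr 1
        exact (integral_const_mul _ _).symm
    simp only [h1]
    refine (Complex.reCLM.integral_comp_comm hF.integral_prod_left).trans ?_
    rw [integral_integral_swap hF]
    simp only [Complex.reCLM_apply]
    congr 2
    funext ξ
    rw [← integral_mul_const]
    simp only [mul_assoc]
  have hright : ((∫ y, φ ‖y‖ * g (x - y) : ℝ) : ℂ) = ∫ ξ,
      𝓕 (fun y : Space (m + 1) => (φ ‖y‖ : ℂ)) ξ * (Real.fourierChar ⟪ξ, x⟫ • G ξ) := by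
    have hF : Integrable (fun p : Space (m + 1) × Space (m + 1) => (φ ‖p.1‖ : ℂ) *
        (Real.fourierChar ⟪p.2, x - p.1⟫ • G p.2)) (volume.prod volume) := by
      refine (hφ'.mul_prod hGi).norm.mono' (hφ'.aestronglyMeasurable.comp_fst.mul
        (Continuous.aestronglyMeasurable ?_)) (ae_of_all _ fun p => ?_)
      · exact (Real.continuous_fourierChar.comp (by fun_prop)).smul (hGc.comp continuous_snd)
      · rw [norm_mul, Circle.norm_smul, norm_mul]
    have h1 : ∀ y, ((φ ‖y‖ * g (x - y) : ℝ) : ℂ) =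
        ∫ ξ, (φ ‖y‖ : ℂ) * (Real.fourierChar ⟪ξ, x - y⟫ • G ξ) := fun y => by
      rw [Complex.ofReal_mul, ← fourierInv_fourier_ofReal hg hc (x - y)]
      exact (integral_const_mul _ _).symm
    rw [← integral_complex_ofReal]
    simp only [h1]
    rw [integral_integral_swap hF]
    congr 1
    funext ξ
    rw [Real.fourier_eq, ← integral_mul_const]
    congr 1
    funext y
    rw [inner_sub_right, sub_eq_add_neg, AddChar.map_add_eq_mul, real_inner_comm y ξ]
    simp only [Circle.smul_def, Circle.coe_mul, smul_eq_mul]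
    ring
  rw [hleft, ← Complex.ofReal_re (∫ y, φ ‖y‖ * g (x - y)), hright]
  congr 2
  funext ξ
  rw [integral_cos_mul heven hv, fourier_radial hφ]
  simp only [hφv]

end Reciprocity

/-! ### The time convolution -/

section TimeConvolution

variable {d : ℕ} {w v : ℝ → ℝ}

/-- Domination of the derivatives of `z ↦ v(s) W f (z - (0, s))`, locally uniformly in `z`. -/
theorem SmoothOfGrowth.dominated_smoothWave (hw_pos : ∀ r, 0 ≤ r → 0 < w r)
    (hw : MonotoneOn w (Ici 0)) (heven : ∀ t, v (-t) = v t) (hdec : SufficientDecay d w v)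
    {f : Space d → ℝ} (hf : SmoothOfGrowth w f) (k : ℕ) (z₀ : Space d × ℝ) :
    ∃ b : ℝ → ℝ, Integrable b ∧ ∀ s, ∀ z ∈ Metric.ball z₀ 1,
      ‖v s‖ * ‖iteratedFDeriv ℝ k (smoothWave f) (z - ((0 : Space d), s))‖ ≤ b s := by
  obtain ⟨A, hA, hfA⟩ := hf.exists_bound hw_pos (k + (d + 1))
  have hc : 0 ≤ ‖z₀.1‖ + |z₀.2| + 5 := by positivity
  have hC := growthConst_nonneg d k
  refine ⟨_, ((integrable_filter_weight heven hdec hc).norm.const_mul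
    (growthConst d k * A * (2 + |z₀.2|) ^ d)), fun s z hz => ?_⟩
  rw [Metric.mem_ball, Prod.dist_eq, max_lt_iff, dist_eq_norm, Real.dist_eq] at hz
  have h1 : ‖z.1‖ ≤ ‖z₀.1‖ + 1 := by linarith [norm_le_norm_add_norm_sub' z.1 z₀.1]
  have h2 : |z.2 - s| ≤ |z₀.2| + 1 + |s| := by
    have h3 := abs_sub z.2 s
    have h4 := abs_sub_abs_le_abs_sub z.2 z₀.2
    linarith
  have h3 := norm_iteratedFDeriv_smoothWave_le hf.smooth hw hA hfA (z - ((0 : Space d), s))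
  simp only [Prod.fst_sub, Prod.snd_sub, sub_zero] at h3
  have h4 : w (‖z.1‖ + |z.2 - s| + 3) ≤ w (‖z₀.1‖ + |z₀.2| + 5 + |s|) :=
    hw (show (0 : ℝ) ≤ _ by positivity) (show (0 : ℝ) ≤ _ by positivity) (by linarith)
  have h5 : (1 + |z.2 - s|) ^ d ≤ (2 + |z₀.2|) ^ d * (1 + |s|) ^ d := by
    rw [← mul_pow]
    gcongr
    nlinarith [abs_nonneg s, abs_nonneg z₀.2]
  have h6 := hw_pos (‖z₀.1‖ + |z₀.2| + 5 + |s|) (by positivity)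
  have h7 := hw_pos (‖z.1‖ + |z.2 - s| + 3) (by positivity)
  rw [norm_mul, norm_mul, Real.norm_of_nonneg h6.le,
    Real.norm_of_nonneg (show 0 ≤ (1 + |s|) ^ d by positivity)]
  calc _ ≤ ‖v s‖ * (growthConst d k * A * (((2 + |z₀.2|) ^ d * (1 + |s|) ^ d) *
          w (‖z₀.1‖ + |z₀.2| + 5 + |s|))) := by
        refine mul_le_mul_of_nonneg_left (h3.trans ?_) (norm_nonneg _)
        gcongr
    _ = _ := by ring

theorem continuous_smoothWave {f : Space d → ℝ} (hf : ContDiff ℝ ∞ f) : Continuous (smoothWave f) :=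
  (contDiff_smoothWave hf).continuous

theorem SmoothOfGrowth.integrable_mul_smoothWave (hw_pos : ∀ r, 0 ≤ r → 0 < w r)
    (hw : MonotoneOn w (Ici 0)) (heven : ∀ t, v (-t) = v t) (hvc : Continuous v)
    (hdec : SufficientDecay d w v) {f : Space d → ℝ} (hf : SmoothOfGrowth w f) (x : Space d)
    (t : ℝ) : Integrable fun s => v s * smoothWave f (x, t - s) := by
  obtain ⟨b, hb, hbd⟩ := hf.dominated_smoothWave hw_pos hw heven hdec 0 (x, t)
  refine hb.mono' (hvc.mul ((continuous_smoothWave hf.smooth).comp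
    (by fun_prop))).aestronglyMeasurable (ae_of_all _ fun s => ?_)
  simpa [norm_iteratedFDeriv_zero] using hbd s (x, t) (Metric.mem_ball_self one_pos)

/-- The reciprocal principle at time zero. Truncations of `f` reduce it to compactly supported
data; the growth estimate dominates both integrals. -/
theorem SmoothOfGrowth.integral_mul_smoothWave {m : ℕ} (hw_pos : ∀ r, 0 ≤ r → 0 < w r)
    (hw : MonotoneOn w (Ici 0)) (heven : ∀ t, v (-t) = v t)
    (hv : ContDiffOn ℝ ((m + 1) / 2 : ℕ) (fun τ => v (√τ)) (Ici 0))
    (hdec : SufficientDecay (m + 1) w v) {f : Space (m + 1) → ℝ} (hf : SmoothOfGrowth w f)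
    (x : Space (m + 1)) :
    ∫ s, v s * smoothWave f (x, s) = spaceConv (sharp (m + 1) v) f x := by
  have hvc := continuous_of_sqrt heven hv
  have hu := integrable_sharp hw_pos hw hdec
  obtain ⟨A, hA, hfA⟩ := hf.exists_bound hw_pos (m + 1 + 1)
  set g : ℕ → Space (m + 1) → ℝ := fun n => truncate f x n with hg
  have hgs : ∀ n, ContDiff ℝ ∞ (g n) := fun n => contDiff_truncate hf.smooth x n
  have hgc : ∀ n, HasCompactSupport (g n) := fun n => hasCompactSupport_truncate f x n
  have heq : ∀ n, ∫ s, v s * fourierWave (g n) (x, s) = ∫ y, sharp (m + 1) v y * g n (x - y) :=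
    fun n => integral_mul_fourierWave hu (integrable_filter hw_pos hw heven hvc hdec) heven
      (fun t => (planeIntegral_sharpProfile hw_pos hw heven hv hdec t).2) (hgs n) (hgc n) x
  set C := ∑ i ∈ Finset.range (m + 1 + 1 + 1), truncateConst (m + 1) i with hC
  have hC0 : 0 ≤ C := Finset.sum_nonneg fun i _ => truncateConst_nonneg _ i
  have hgA : ∀ n, ∀ i ≤ 0 + (m + 1 + 1), ∀ y, ‖iteratedFDeriv ℝ i (g n) y‖ ≤ C * A * w ‖y‖ := by
    intro n i hi y
    rw [zero_add] at hi
    refine (norm_iteratedFDeriv_truncate_le hf.smooth x n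
      fun j hj => hfA j (hj.trans hi) y).trans ?_
    have hw0 := hw_pos ‖y‖ (norm_nonneg y)
    rw [mul_assoc]
    gcongr
    exact Finset.single_le_sum (f := truncateConst (m + 1)) (fun j _ => truncateConst_nonneg _ j)
      (Finset.mem_range.2 (Nat.lt_succ_of_le hi))
  have hwave : ∀ n s, |fourierWave (g n) (x, s)| ≤
      growthConst (m + 1) 0 * (C * A) * ((1 + |s|) ^ (m + 1) * w (‖x‖ + 3 + |s|)) := by
    intro n s
    have h1 := norm_iteratedFDeriv_smoothWave_le (hgs n) hw (mul_nonneg hC0 hA) (hgA n) (x, s)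
    rw [norm_iteratedFDeriv_zero, smoothWave_eq_of_eqOn (hgs n) (hgs n) (hgc n)
      (fun y _ => rfl) (lt_add_one |s|)] at h1
    rwa [add_right_comm]
  have hlim1 : Tendsto (fun n => ∫ s, v s * fourierWave (g n) (x, s)) atTop
      (𝓝 (∫ s, v s * smoothWave f (x, s))) := by
    refine tendsto_integral_of_dominated_convergence _ (fun n => (hvc.mul
      ((contDiff_fourierWave (hgs n) (hgc n)).continuous.comp
        (by fun_prop))).aestronglyMeasurable)
      ((integrable_filter_weight heven hdec (c := ‖x‖ + 3) (by positivity)).norm.const_mul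
        (growthConst (m + 1) 0 * (C * A))) (fun n => ae_of_all _ fun s => ?_)
      (ae_of_all _ fun s => ?_)
    · have hw0 := hw_pos (‖x‖ + 3 + |s|) (by positivity)
      rw [norm_mul, norm_mul, norm_mul, Real.norm_of_nonneg hw0.le,
        Real.norm_of_nonneg (show 0 ≤ (1 + |s|) ^ (m + 1) by positivity)]
      calc _ ≤ ‖v s‖ * _ := mul_le_mul_of_nonneg_left (hwave n s) (norm_nonneg _)
        _ = _ := by ring
    · obtain ⟨N, hN⟩ := exists_nat_gt |s|
      refine tendsto_const_nhds.congr' ?_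
      filter_upwards [eventually_ge_atTop N] with n hn
      have hn' : |s| < n := hN.trans_le (by exact_mod_cast hn)
      rw [smoothWave_eq_of_eqOn hf.smooth (hgs n) (hgc n)
        (fun y hy => (truncate_eq (Metric.mem_ball.1 hy).le).symm) hn']
  have hlim2 : Tendsto (fun n => ∫ y, sharp (m + 1) v y * g n (x - y)) atTop
      (𝓝 (spaceConv (sharp (m + 1) v) f x)) := by
    have hint := hf.integrable_mul_translate hw_pos hw
      (fun c hc => integrable_sharp_weight hw_pos hw hdec hc) x
    rw [spaceConv_apply]
    refine tendsto_integral_of_dominated_convergence _ (fun n => hu.aestronglyMeasurable.mul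
      ((hgs n).continuous.comp (continuous_const.sub continuous_id)).aestronglyMeasurable)
      (hint.norm.const_mul (truncateConst (m + 1) 0)) (fun n => ae_of_all _ fun y => ?_)
      (ae_of_all _ fun y => ?_)
    · have h1 := norm_iteratedFDeriv_truncate_le hf.smooth x n (k := 0) (y := x - y)
        (B := ‖f (x - y)‖) fun i hi => by
          rw [Nat.le_zero.1 hi, norm_iteratedFDeriv_zero]
      rw [norm_iteratedFDeriv_zero] at h1
      rw [norm_mul, norm_mul]
      calc _ ≤ ‖sharp (m + 1) v y‖ * _ := mul_le_mul_of_nonneg_left h1 (norm_nonneg _)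
        _ = _ := by ring
    · obtain ⟨N, hN⟩ := exists_nat_gt ‖y‖
      refine tendsto_const_nhds.congr' ?_
      filter_upwards [eventually_ge_atTop N] with n hn
      have hn' : ‖y‖ < n := hN.trans_le (by exact_mod_cast hn)
      rw [hg]
      dsimp only
      rw [truncate_eq]
      rw [dist_eq_norm]
      simpa using hn'.le
  simp only [heq] at hlim1
  exact tendsto_nhds_unique hlim1 hlim2

/-- The time convolution solves the wave equation, being a superposition of time translates of a
solution that is even in time. -/
theorem SmoothOfGrowth.isWaveSolution_timeConv {m : ℕ} (hw_pos : ∀ r, 0 ≤ r → 0 < w r)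
    (hw : MonotoneOn w (Ici 0)) (heven : ∀ t, v (-t) = v t)
    (hv : ContDiffOn ℝ ((m + 1) / 2 : ℕ) (fun τ => v (√τ)) (Ici 0))
    (hdec : SufficientDecay (m + 1) w v) {f : Space (m + 1) → ℝ} (hf : SmoothOfGrowth w f) :
    IsWaveSolution (spaceConv (sharp (m + 1) v) f)
      fun x t => ∫ s, v s * smoothWave f ((x, t) - ((0 : Space (m + 1)), s)) := by
  have hvc := continuous_of_sqrt heven hv
  have hj : AEStronglyMeasurable (fun s : ℝ => ((0 : Space (m + 1)), s)) volume :=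
    (by fun_prop : Continuous fun s : ℝ => ((0 : Space (m + 1)), s)).aestronglyMeasurable
  have hP := contDiff_smoothWave hf.smooth
  have hdom := fun (k : ℕ) (_ : (k : ℕ∞) ≤ ⊤) z₀ =>
    hf.dominated_smoothWave hw_pos hw heven hdec k z₀
  have htaylor :=
    hasFTaylorSeriesUpTo_integral_translate (n := ⊤) hP hvc.aestronglyMeasurable hj hdom
  refine isWaveSolution_of_even
    (P := fun z => ∫ s, v s * smoothWave f (z - ((0 : Space (m + 1)), s)))
    (htaylor.contDiff.of_le (mod_cast le_top : ((2 : ℕ∞) : ℕ∞ω) ≤ ∞)) (fun x t => ?_)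
    (fun z => ?_) fun x => ?_
  · rw [← integral_neg_eq_self]
    congr 1
    funext s
    rw [heven, Prod.mk_sub_mk, Prod.mk_sub_mk, ← smoothWave_neg hf.smooth]
    congr 3
    ring
  · have hint := integrable_translate (n := ⊤) (k := 2) hP hvc.aestronglyMeasurable hj hdom le_top z
    rw [← htaylor.eq_iteratedFDeriv (m := 2) (mod_cast le_top : ((2 : ℕ∞) : ℕ∞ω) ≤ ∞) z,
      ← ContinuousLinearMap.integral_comp_comm (𝕜 := ℝ) (boxForm (m + 1)) hint]
    refine integral_eq_zero_of_ae (ae_of_all _ fun s => ?_)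
    dsimp only
    rw [map_smul, boxForm_smoothWave hf.smooth, smul_zero, Pi.zero_apply]
  · rw [← hf.integral_mul_smoothWave hw_pos hw heven hv hdec]
    congr 1
    funext s
    rw [Prod.mk_sub_mk, sub_zero, zero_sub, smoothWave_neg hf.smooth]

/-- `smoothWave f` is the even extension in time of `W f`. -/
theorem evenTime_waveOp {f : Space d → ℝ} (hf : ContDiff ℝ ∞ f) (x : Space d) :
    evenTime (waveOp f) x = fun t => smoothWave f (x, t) := by
  funext t
  rw [evenTime, (isWaveSolution_smoothWave hf).waveOp_eq x (abs_nonneg t)]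
  rcases abs_choice t with h | h <;> rw [h]
  exact smoothWave_neg hf x t

end TimeConvolution

end AcousticReciprocity

end

open AcousticReciprocity in
theorem proposition2p2 (d : ℕ) (hd : 1 ≤ d)
    (w : ℝ → ℝ) (hw_pos : ∀ r, 0 ≤ r → 0 < w r) (hw_mono : MonotoneOn w (Set.Ici 0))
    (v : ℝ → ℝ) (hv_even : ∀ t, v (-t) = v t)
    (hv_smooth : ContDiffOn ℝ (d / 2 : ℕ) (fun τ => v (√τ)) (Set.Ici 0))
    (hv_decay : SufficientDecay d w v) :
    -- `R♯ v` is well defined and inverts the radial Radon transform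
    ((Even d → ∀ r : ℝ, 0 ≤ r → MeasureTheory.IntegrableOn
        (fun t => (radialDeriv^[d / 2] v) t / √(t ^ 2 - r ^ 2) * t) (Set.Ioi r)) ∧
      (2 ≤ d → ∀ t : ℝ, MeasureTheory.IntegrableOn
        (radonIntegrand d (sharpProfile d v) t) (Set.Ioi |t|)) ∧
      ∀ t : ℝ, radialRadon d (sharpProfile d v) t = v t) ∧
    -- the reciprocal principle, with every term in it well defined
    ∀ f : Space d → ℝ, SmoothOfGrowth w f →
      MeasureTheory.ConvolutionExists (sharp d v) f (ContinuousLinearMap.mul ℝ ℝ)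
        MeasureTheory.volume ∧
      ContDiff ℝ ∞ (spaceConv (sharp d v) f) ∧
      IsWaveSolution f (waveOp f) ∧
      IsWaveSolution (spaceConv (sharp d v) f) (waveOp (spaceConv (sharp d v) f)) ∧
      ∀ (x : Space d) (t : ℝ), 0 < t →
        MeasureTheory.ConvolutionExistsAt v (evenTime (waveOp f) x) t
          (ContinuousLinearMap.mul ℝ ℝ) MeasureTheory.volume ∧
        timeConv v (waveOp f) x t = waveOp (spaceConv (sharp d v) f) x t := by
  obtain ⟨m, rfl⟩ : ∃ m, d = m + 1 := ⟨d - 1, by omega⟩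
  have hvc := continuous_of_sqrt hv_even hv_smooth
  have hplane := fun t => planeIntegral_sharpProfile hw_pos hw_mono hv_even hv_smooth hv_decay t
  refine ⟨⟨fun hd2 r hr => ?_, fun hd2 t => ?_, fun t => ?_⟩, fun f hf => ?_⟩
  · obtain ⟨k, hk⟩ := hd2.two_dvd
    have hk' : (m + 1) / 2 = k := by omega
    rw [hk'] at hv_smooth ⊢
    exact integrableOn_abel hw_pos hw_mono hk.symm (by omega) (contDiffOn_of_sqrt hv_smooth)
      hv_decay hr
  · obtain ⟨n, rfl⟩ : ∃ n, m = n + 1 := ⟨m - 1, by omega⟩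
    exact planeIntegrable_iff.1 (hplane t).1
  · rw [radialRadon_eq_planeIntegral, (hplane t).2]
  · have hu : ∀ c, 0 ≤ c → Integrable fun y : Space (m + 1) => sharp (m + 1) v y * w (c + ‖y‖) :=
      fun c hc => integrable_sharp_weight hw_pos hw_mono hv_decay hc
    have hsol := hf.isWaveSolution_timeConv hw_pos hw_mono hv_even hv_smooth hv_decay
    refine ⟨fun x => hf.integrable_mul_translate hw_pos hw_mono hu x,
      hf.contDiff_spaceConv hw_pos hw_mono hu,
      (isWaveSolution_smoothWave hf.smooth).isWaveSolution_waveOp,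
      hsol.isWaveSolution_waveOp, fun x t ht => ⟨?_, ?_⟩⟩
    · rw [evenTime_waveOp hf.smooth]
      exact hf.integrable_mul_smoothWave hw_pos hw_mono hv_even hvc hv_decay x t
    · rw [hsol.waveOp_eq x ht.le, timeConv, evenTime_waveOp hf.smooth, convolution_def]
      congr 1
      funext s
      rw [ContinuousLinearMap.mul_apply', Prod.mk_sub_mk, sub_zero]
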